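/- **Setting.** A network with $d$ real inputs consists of $M\ge 1$ layers of nodes followed by an affine output $h\mapsto c^\top h+e\in\mathbb R$; each node computes $h\mapsto\sigma(a^\top h+b)$ from the outputs $h$ of the previous layer (the first layer reads the input). It has *width at most $k$* if every layer of nodes has at most $k$ nodes, and it is *normalized* if $\|a\|_1+|b|\le 1$ at every node and $\|c\|_1+|e|\le 1$ (so the output may simply be a last node). In a *GELU network* every node has the activation $G(x)=\frac x2\bigl(1+\tanh(\sqrt{2/\pi}\,(x+0.044715\,x^3))\bigr)$; a *Swish network* has $x\mapsto x/(1+e^{-\beta x})$ with a fixed $\beta\in\mathbb R$, and a *SiLU network* is the case $\beta=1$. In a *rational network* each node has its own rational activation $P/Q$ with real polynomials $P,Q$. The *size* of a network is its number of nodes; its *parameters* are all weights and biases and, for rational networks, all coefficients of the activations. Put $S_M(L)=\sum_{j=0}^{M-1}L^j$, and for an activation $\sigma$ put $L_\sigma=\sup\{|\sigma'(t)|:|t|\le 1\}$. Let $d\ge 1$, $k\ge1$, $M\ge 1$. **Theorem.** 1. Let $\sigma$ be GELU, SiLU or Swish. There are $D\in\mathbb N$ and $C>0$, depending only on $\sigma$,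 such that for all $d,k,M$, all $0<\varepsilon<1$ and every normalized network $f$ with activation $\sigma$, $M$ layers of nodes and width at most $k$, there is a rational network $R:[-1,1]^d\to[-1,1]$, whose activations have numerators and denominators of degree at most $D$ and whose denominators never vanish for inputs in $[-1,1]^d$, with $\max_{x\in[-1,1]^d}|f(x)-R(x)|\le\varepsilon$ and size at most $$C\,kM\,\max\bigl\{1,\log\log(S_M(L_\sigma)/\varepsilon)\bigr\}^3$$ (where the maximum is read as $1$ if $\log(S_M(L_\sigma)/\varepsilon)\le 1$), and with at most $C(d+k)$ times $kM\max\{1,\log\log(S_M(L_\sigma)/\varepsilon)\}^3$ parameters. Moreover $L_G\le 1.083$, $|G'(t)|\le 1.129$ for all $t\in\mathbb R$, and hence $S_M(L_G)\le S_M(1.083)$. 2. Let $\rho>1$ and $K\in\mathbb R$. There is $C>0$, depending only on $\rho$ and $K$, such that for all $d,k,M$, all $0<\varepsilon<1$, all $L\ge0$ and every normalized rational network $R$ with $M$ layers of nodes and width at most $k$, each of whose activations $r$ maps $[-1,1]$ into $[-1,1]$, is $L$-Lipschitz on $[-1,1]$, and is analytic with $|r|\le K$ inside the Bernstein ellipse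 $\{z\in\mathbb C:|z-1|+|z+1|<\rho+\rho^{-1}\}$, there is a GELU network $f:[-1,1]^d\to[-1,1]$ with $\max_{x\in[-1,1]^d}|R(x)-f(x)|\le\varepsilon$, size at most $$C\,kM\,\max\{1,\log(S_M(L)/\varepsilon)\}^2,$$ and at most $C(d+k)$ times $kM\max\{1,\log(S_M(L)/\varepsilon)\}^2$ parameters. 3. For every $B>0$ there is $c>0$, depending only on $B$, such that for all $d,k,M$ and all $0<\varepsilon<\frac18$ there is a normalized rational network $R$ with $M$ layers of nodes and width at most $k$, whose activations have numerators and denominators of degree at most $2$, have no pole on $[-1,1]$ and map $[-1,1]$ into $[-1,1]$, such that every GELU network $F$ (of any depth, including depth $0$, and any widths) all of whose weights and biases have absolute value at most $B$ and which satisfies $\max_{x\in[-1,1]^d}|R(x)-F(x)|\le\varepsilon$ has size at least $c\,kM\log(1/\varepsilon)$; in particular it has at least that many parameters. -/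

import Mathlib

noncomputable section

/-- The hidden layers of a feedforward network with `d` inputs whose last layer has `n` nodes.
Node `i` of a new layer of width `m` computes `σᵢ (∑ⱼ Wᵢⱼ hⱼ + bᵢ)` from the previous layer `h`.
Activations are labelled by a type `A`; every node carries its own label. -/
inductive Layers (A : Type) (d : ℕ) : ℕ → Type
  | input : Layers A d d
  | layer {n : ℕ} (prev : Layers A d n) (m : ℕ) (W : Matrix (Fin m) (Fin n) ℝ)
      (b : Fin m → ℝ) (act : Fin m → A) : Layers A d m

namespace Layers

variable {A : Type} {d : ℕ}

/-- The output of the last layer; `ev a` is the real function that the label `a` stands for. -/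
def eval (ev : A → ℝ → ℝ) (x : Fin d → ℝ) : {n : ℕ} → Layers A d n → Fin n → ℝ
  | _, input => x
  | _, layer prev _ W b act => fun i => ev (act i) ((∑ j, W i j * eval ev x prev j) + b i)

/-- The number of layers of nodes. -/
def depth : {n : ℕ} → Layers A d n → ℕ
  | _, input => 0
  | _, layer prev _ _ _ _ => depth prev + 1

/-- The number of nodes (activation units). -/
def units : {n : ℕ} → Layers A d n → ℕ
  | _, input => 0
  | _, layer prev m _ _ _ => units prev + m

/-- The number of trainable parameters: all weights and biases, and `cost a` coefficients for
every node with activation `a`. -/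
def params (cost : A → ℕ) : {n : ℕ} → Layers A d n → ℕ
  | _, input => 0
  | _, layer (n := n) prev m _ _ act => params cost prev + m * (n + 1) + ∑ i, cost (act i)

/-- Every layer has at most `k` nodes. -/
def WidthLE (k : ℕ) : {n : ℕ} → Layers A d n → Prop
  | _, input => True
  | _, layer prev m _ _ _ => WidthLE k prev ∧ m ≤ k

/-- Every node has an affine part `x ↦ aᵀ x + b` with `‖a‖₁ + |b| ≤ 1`. -/
def Normalized : {n : ℕ} → Layers A d n → Prop
  | _, input => True
  | _, layer prev _ W b _ => Normalized prev ∧ ∀ i, (∑ j, |W i j|) + |b i| ≤ 1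

/-- All weights and biases have absolute value at most `B`. -/
def ParamLE (B : ℝ) : {n : ℕ} → Layers A d n → Prop
  | _, input => True
  | _, layer prev _ W b _ => ParamLE B prev ∧ (∀ i j, |W i j| ≤ B) ∧ ∀ i, |b i| ≤ B

/-- The activation of every node satisfies `p`. -/
def ForallAct (p : A → Prop) : {n : ℕ} → Layers A d n → Prop
  | _, input => True
  | _, layer prev _ _ _ act => ForallAct p prev ∧ ∀ i, p (act i)

/-- At the input `x`, every node satisfies `p` at its label and the number to which its
activation is applied. -/
def ForallPreact (ev : A → ℝ → ℝ) (p : A → ℝ → Prop) (x : Fin d → ℝ) :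
    {n : ℕ} → Layers A d n → Prop
  | _, input => True
  | _, layer prev _ W b act => ForallPreact ev p x prev ∧
      ∀ i, p (act i) ((∑ j, W i j * eval ev x prev j) + b i)

end Layers

/-- A feedforward network with `d` real inputs and one real output: hidden layers of nodes,
followed by an affine output map `h ↦ cᵀ h + e`. -/
structure Net (A : Type) (d : ℕ) where
  {lastWidth : ℕ}
  hidden : Layers A d lastWidth
  outW : Fin lastWidth → ℝ
  outB : ℝ

namespace Net

variable {A : Type} {d : ℕ}

/-- The function computed by the network. -/
def eval (ev : A → ℝ → ℝ) (N : Net A d) (x : Fin d → ℝ) : ℝ :=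
  (∑ j, N.outW j * N.hidden.eval ev x j) + N.outB

/-- The number of layers of nodes. -/
def depth (N : Net A d) : ℕ := N.hidden.depth

/-- The number of nodes. -/
def units (N : Net A d) : ℕ := N.hidden.units

/-- The number of trainable parameters, zero or not. -/
def params (cost : A → ℕ) (N : Net A d) : ℕ := N.hidden.params cost + (N.lastWidth + 1)

/-- Every layer has at most `k` nodes. -/
def WidthLE (k : ℕ) (N : Net A d) : Prop := N.hidden.WidthLE k

/-- Every affine map `x ↦ aᵀ x + b` in the network, the output included, has
`‖a‖₁ + |b| ≤ 1`. -/
def Normalized (N : Net A d) : Prop :=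
  N.hidden.Normalized ∧ (∑ j, |N.outW j|) + |N.outB| ≤ 1

/-- All weights and biases have absolute value at most `B`. -/
def ParamLE (B : ℝ) (N : Net A d) : Prop :=
  N.hidden.ParamLE B ∧ (∀ j, |N.outW j| ≤ B) ∧ |N.outB| ≤ B

/-- The activation of every node satisfies `p`. -/
def ForallAct (p : A → Prop) (N : Net A d) : Prop := N.hidden.ForallAct p

end Net

/-- The cube `[-1,1]^d`. -/
def cube (d : ℕ) : Set (Fin d → ℝ) := {x | ∀ i, x i ∈ Set.Icc (-1 : ℝ) 1}

/-- The activation GELU in its `tanh` form. -/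
def gelu (x : ℝ) : ℝ :=
  x / 2 * (1 + Real.tanh (Real.sqrt (2 / Real.pi) * (x + 0.044715 * x ^ 3)))

/-- The activation Swish with parameter `β`. -/
def swish (β x : ℝ) : ℝ := x * Real.sigmoid (β * x)

/-- The activation SiLU. -/
def silu (x : ℝ) : ℝ := x * Real.sigmoid x

/-- A network in which every node has the same fixed activation (given at evaluation). -/
abbrev FixedNet (d : ℕ) : Type := Net Unit d

/-- The function computed by a network all of whose nodes have the activation `σ`. -/
def FixedNet.fn {d : ℕ} (σ : ℝ → ℝ) (N : FixedNet d) : (Fin d → ℝ) → ℝ :=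
  N.eval (fun _ => σ)

/-- The number of trainable parameters (weights and biases). -/
def FixedNet.numParams {d : ℕ} (N : FixedNet d) : ℕ := N.params (fun _ => 0)

/-- A rational activation: a numerator and a denominator with real coefficients. -/
structure RatAct where
  num : Polynomial ℝ
  den : Polynomial ℝ

/-- The value `P t / Q t`, which is meant where `Q t ≠ 0`. -/
def RatAct.eval (r : RatAct) (t : ℝ) : ℝ := r.num.eval t / r.den.eval t

/-- Numerator and denominator have degree at most `D`. -/
def RatAct.DegreeLE (D : ℕ) (r : RatAct) : Prop := r.num.natDegree ≤ D ∧ r.den.natDegree ≤ D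

/-- The rational function has no pole on `[-1,1]` and maps `[-1,1]` into `[-1,1]`. -/
def RatAct.SelfMap (r : RatAct) : Prop :=
  ∀ t ∈ Set.Icc (-1 : ℝ) 1, r.den.eval t ≠ 0 ∧ r.eval t ∈ Set.Icc (-1 : ℝ) 1

/-- The open region bounded by the Bernstein ellipse with foci `-1`, `1` and parameter `ρ`. -/
def bernsteinEllipse (ρ : ℝ) : Set ℂ := {z | ‖z - 1‖ + ‖z + 1‖ < ρ + ρ⁻¹}

/-- The rational function is analytic inside the Bernstein ellipse with parameter `ρ`, and
bounded there by `K`. -/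
def RatAct.BernsteinBound (ρ K : ℝ) (r : RatAct) : Prop :=
  ∀ z ∈ bernsteinEllipse ρ, Polynomial.aeval z r.den ≠ 0 ∧
    ‖Polynomial.aeval z r.num / Polynomial.aeval z r.den‖ ≤ K

/-- A network all of whose nodes have rational activations, possibly distinct. -/
abbrev RatNet (d : ℕ) : Type := Net RatAct d

/-- The function computed by a rational network. -/
def RatNet.fn {d : ℕ} (N : RatNet d) : (Fin d → ℝ) → ℝ := N.eval RatAct.eval

/-- The number of trainable parameters: weights, biases and the coefficients of the numerators
and denominators. -/
def RatNet.numParams {d : ℕ} (N : RatNet d) : ℕ :=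
  N.params (fun r => (r.num.natDegree + 1) + (r.den.natDegree + 1))

/-- For inputs in the cube no denominator in the network ever vanishes. -/
def RatNet.NoPoles {d : ℕ} (N : RatNet d) : Prop :=
  ∀ x ∈ cube d, N.hidden.ForallPreact RatAct.eval (fun r t => r.den.eval t ≠ 0) x

/-- `g` maps the cube into `[-1,1]` and is uniformly `ε`-close to `f` on the cube. -/
def ApproxOnCube {d : ℕ} (f g : (Fin d → ℝ) → ℝ) (ε : ℝ) : Prop :=
  ∀ x ∈ cube d, g x ∈ Set.Icc (-1 : ℝ) 1 ∧ |f x - g x| ≤ ε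

/-- `S_M(L) = ∑_{j < M} L ^ j`. -/
def geomS (M : ℕ) (L : ℝ) : ℝ := ∑ j ∈ Finset.range M, L ^ j

/-- `L_σ = sup {|σ'(t)| : |t| ≤ 1}`. -/
def slopeSup (σ : ℝ → ℝ) : ℝ := sSup ((fun t => |deriv σ t|) '' Set.Icc (-1 : ℝ) 1)

end

/-!
Throughout, a network is simulated node by node: each node is replaced by a short program that
approximates its activation on `[-1,1]` up to `δ` and, again, takes values in `[-1,1]`. A program is
a list of instructions on a fixed number of registers; each instruction costs two layers of bounded
width, since `s t = ((s + t)² - (s - t)²) / 4`. As the affine maps are normalized, arguments stay in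
`[-1,1]` and the error `e` of one layer becomes at most `L e + δ` in the next, so that a network of
depth `M` is reproduced up to `δ S_M(L)` (`exists_simulation`). What remains is to bound the length
of a program of accuracy `ε / S_M(L)`.

*Sigmoid activations by rational ones.* GELU, SiLU and Swish all have the form `x * sigmoid (P x)`
with a polynomial `P`, because `1 + tanh u = 2 sigmoid (2 u)`. With `N` fixed so that `|P x| / N` is
small, it suffices to compute `y = e ^ (P x / N)`, as `sigmoid (P x) = y ^ N / (1 + y ^ N)` is a
rational function of `y`; a factor in `(0, 1)` also keeps `x` in `[-1,1]` automatically. The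
logarithm is the limit of the arithmetic-geometric mean: `AGM(1, 4 e^{-l})` is `π / (2 l)` up to a
relative error of order `e^{-2 l}`. This follows from the squares of the theta constants, which the
AGM step maps from `t` to `2 t` (`theta_arith`, `theta_geom`), and from their behaviour under `t ↦ 1
/ t`, Poisson summation (`agm_log_bounds`). With Heron's iteration for the square roots, accuracy
`e^{-2^n}` takes `O(n)` steps of the AGM with `O(n)` steps each (`agmLog_accuracy`), and `n` Newton
steps invert the logarithm (`expNewton_accuracy`): `O(n³)` rational operations, with `n` of order
`log log (1 / δ)`.

*Rational activations by GELU.* A function analytic in a Bernstein ellipse has Chebyshev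
approximations with geometric convergence (`exists_chebyshev_approx`), and the Chebyshev recurrence
evaluates them with `O(log (1 / δ))` additions and multiplications. The identity is exactly `G x - G
(-x)`, and the square is the limit of `(G (h z) + G (-h z)) / (c h²)` as `h → 0`
(`exists_gelu_approx`). Since GELU nodes replace polynomial nodes only after all programs are fixed,
`h` can be taken as small as the whole polynomial network requires.

*The slope of GELU.* Clearing denominators turns `G' ≤ v` into an inequality between a linear
combination of `e ^ w`, `e ^ (-w)` and a polynomial. Up to a point `T` it follows from the
inequality at `T` by monotonicity (`geluSlope_le_of_le`), and around and beyond the maximum from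
Taylor expansions at `1.42`.

*The lower bound.* A node with activation `2 η t / (η² + t²)` jumps from `-1` to `1` on `[-η, η]`.
In a GELU network with parameters at most `B`, a layer of `m` nodes enlarges `ℓ¹` distances at most
by the factor `1.129 B m ≤ e ^ (1.129 B m)`, so the number of nodes alone bounds its slope, by `B e
^ (1.129 B units)`. With `η` of order `ε ^ (k M)` this forces the claimed number of nodes.
-/

namespace NetApprox

open Finset

/-! ### Register programs and their realization by layers of bounded width -/

/-- One layer of a network that maps `w` registers to `w` registers. -/
structure Step (A : Type) (w : ℕ) where
  W : Matrix (Fin w) (Fin w) ℝ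
  b : Fin w → ℝ
  act : Fin w → A

namespace Step

variable {A : Type} {w : ℕ} (ev : A → ℝ → ℝ) (good : A → ℝ → Prop)

/-- The number that the activation of node `p` receives. -/
def pre (st : Step A w) (s : Fin w → ℝ) (p : Fin w) : ℝ := (∑ q, st.W p q * s q) + st.b p

/-- The registers after one layer. -/
def run (st : Step A w) (s : Fin w → ℝ) : Fin w → ℝ := fun p => ev (st.act p) (st.pre s p)

/-- The registers after a list of layers. -/
def runs : List (Step A w) → (Fin w → ℝ) → Fin w → ℝ
  | [], s => s
  | st :: l, s => runs l (st.run ev s)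

/-- In a run of a list of layers, every activation receives an admissible number. -/
def Oks : List (Step A w) → (Fin w → ℝ) → Prop
  | [], _ => True
  | st :: l, s => (∀ p, good (st.act p) (st.pre s p)) ∧ Oks l (st.run ev s)

theorem runs_append (l l' : List (Step A w)) (s : Fin w → ℝ) :
    runs ev (l ++ l') s = runs ev l' (runs ev l s) := by
  induction l generalizing s with
  | nil => rfl
  | cons st l ih => exact ih _

theorem oks_append (l l' : List (Step A w)) (s : Fin w → ℝ) :
    Oks ev good (l ++ l') s ↔ Oks ev good l s ∧ Oks ev good l' (runs ev l s) := by
  induction l generalizing s with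
  | nil => simp [Oks, runs]
  | cons st l ih => simp [Oks, runs, ih, and_assoc]

end Step

/-- The labels `idA` and `sqA` stand for the identity and for squaring, and admit every number. -/
structure IdSq {A : Type} (ev : A → ℝ → ℝ) (good : A → ℝ → Prop) (idA sqA : A) : Prop where
  ev_id : ∀ t, ev idA t = t
  ev_sq : ∀ t, ev sqA t = t ^ 2
  good_id : ∀ t, good idA t
  good_sq : ∀ t, good sqA t

/-- Instructions on `r` registers: replace one register by an activation of an affine function of
all registers, or by the product of two registers. -/
inductive Instr (A : Type) (r : ℕ) where
  | upd (k : Fin r) (c : Fin r → ℝ) (b : ℝ) (act : A)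
  | mul (k i j : Fin r)

namespace Instr

variable {A : Type} {r : ℕ} (ev : A → ℝ → ℝ) (good : A → ℝ → Prop)

/-- The registers after one instruction. -/
def run : Instr A r → (Fin r → ℝ) → Fin r → ℝ
  | upd k c b act, s => Function.update s k (ev act ((∑ q, c q * s q) + b))
  | mul k i j, s => Function.update s k (s i * s j)

/-- The activation used by the instruction receives an admissible number. -/
def Ok : Instr A r → (Fin r → ℝ) → Prop
  | upd _ c b act, s => good act ((∑ q, c q * s q) + b)
  | mul _ _ _, _ => True

/-- The activation used by the instruction, if any, satisfies `P`. -/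
def ActProp (P : A → Prop) : Instr A r → Prop
  | upd _ _ _ act => P act
  | mul _ _ _ => True

/-- The registers after a list of instructions. -/
def runs : List (Instr A r) → (Fin r → ℝ) → Fin r → ℝ
  | [], s => s
  | st :: l, s => runs l (st.run ev s)

/-- In a run of a list of instructions, every activation receives an admissible number. -/
def Oks : List (Instr A r) → (Fin r → ℝ) → Prop
  | [], _ => True
  | st :: l, s => st.Ok good s ∧ Oks l (st.run ev s)

theorem runs_append (l l' : List (Instr A r)) (s : Fin r → ℝ) :
    runs ev (l ++ l') s = runs ev l' (runs ev l s) := by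
  induction l generalizing s with
  | nil => rfl
  | cons st l ih => exact ih _

theorem oks_append (l l' : List (Instr A r)) (s : Fin r → ℝ) :
    Oks ev good (l ++ l') s ↔ Oks ev good l s ∧ Oks ev good l' (runs ev l s) := by
  induction l generalizing s with
  | nil => simp [Oks, runs]
  | cons st l ih => simp [Oks, runs, ih, and_assoc]

variable (idA sqA : A)

/-- Registers are followed by two auxiliary nodes, which hold `(sᵢ + sⱼ)²` and `(sᵢ - sⱼ)²` in the
first of the two layers of a product `sᵢ sⱼ = ((sᵢ + sⱼ)² - (sᵢ - sⱼ)²) / 4`; the second layer of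
an update only copies. -/
noncomputable def compile : Instr A r → List (Step A (r + 2))
  | upd k c b act =>
    [{ W := Fin.append (fun p => Fin.append (if p = k then c else Pi.single p 1) 0) 0
       b := Fin.append (fun p => if p = k then b else 0) 0
       act := Fin.append (fun p => if p = k then act else idA) (fun _ => idA) },
     { W := Fin.append (fun p => Fin.append (Pi.single p 1) 0) 0
       b := 0
       act := fun _ => idA }]
  | mul k i j =>
    [{ W := Fin.append (fun p => Fin.append (Pi.single p 1) 0)
        ![Fin.append (Pi.single i 1 + Pi.single j 1) 0,
          Fin.append (Pi.single i 1 - Pi.single j 1) 0]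
       b := 0
       act := Fin.append (fun _ => idA) (fun _ => sqA) },
     { W := Fin.append (fun p => if p = k then Fin.append 0 ![1 / 4, -(1 / 4)]
          else Fin.append (Pi.single p 1) 0) 0
       b := 0
       act := fun _ => idA }]

/-- The list of layers that performs a list of instructions. -/
noncomputable def compiles (l : List (Instr A r)) : List (Step A (r + 2)) :=
  l.flatMap (compile idA sqA)

theorem length_compiles (l : List (Instr A r)) :
    (compiles idA sqA l).length = 2 * l.length := by
  induction l with
  | nil => rfl
  | cons I l ih =>
    have : (compile idA sqA I).length = 2 := by cases I <;> rfl
    rw [compiles, List.flatMap_cons, List.length_append, this, ← compiles, ih, List.length_cons]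
    ring

theorem compiles_act {P : A → Prop} (h1 : P idA) (h2 : P sqA) (l : List (Instr A r))
    (hl : ∀ I ∈ l, I.ActProp P) : ∀ st ∈ compiles idA sqA l, ∀ p, P (st.act p) := by
  intro st hst p
  obtain ⟨I, hI, hst⟩ := List.mem_flatMap.1 hst
  have hP := hl I hI
  cases I with
  | upd k c b act =>
    simp only [compile, List.mem_cons, List.not_mem_nil, or_false] at hst
    rcases hst with rfl | rfl
    · refine Fin.addCases (fun q => ?_) (fun q => ?_) p
      · simp only [Fin.append_left]
        split_ifs
        exacts [hP, h1]
      · simpa only [Fin.append_right] using h1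
    · exact h1
  | mul k i j =>
    simp only [compile, List.mem_cons, List.not_mem_nil, or_false] at hst
    rcases hst with rfl | rfl
    · refine Fin.addCases (fun q => ?_) (fun q => ?_) p
      · simpa only [Fin.append_left] using h1
      · simpa only [Fin.append_right] using h2
    · exact h1

variable {ev good idA sqA}

theorem compile_spec (hA : IdSq ev good idA sqA) (I : Instr A r) (s : Fin r → ℝ)
    (t : Fin 2 → ℝ) (hI : I.Ok good s) :
    (∃ t', Step.runs ev (compile idA sqA I) (Fin.append s t) = Fin.append (I.run ev s) t') ∧
      Step.Oks ev good (compile idA sqA I) (Fin.append s t) := by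
  obtain ⟨hid, hsq, gid, gsq⟩ := hA
  have key : ∀ f : Fin (r + 2) → ℝ, ∀ g : Fin r → ℝ, (∀ p, f (Fin.castAdd 2 p) = g p) →
      ∃ t', f = Fin.append g t' := by
    intro f g h
    refine ⟨fun q => f (Fin.natAdd r q), ?_⟩
    funext p
    refine Fin.addCases (fun q => ?_) (fun q => ?_) p
    · simp [h]
    · simp
  cases I with
  | upd k c b act =>
    constructor
    · apply key
      intro p
      by_cases hp : p = k
      · subst hp
        simp [compile, Step.runs, Step.run, Step.pre, Fin.sum_univ_add, hid, Instr.run,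
          Pi.single_apply]
      · simp [compile, Step.runs, Step.run, Step.pre, Fin.sum_univ_add, hid, Instr.run,
          Pi.single_apply, hp]
    · refine ⟨fun p => ?_, fun p => gid _, trivial⟩
      refine Fin.addCases (fun q => ?_) (fun q => ?_) p
      · by_cases hq : q = k
        · subst hq
          simpa [Step.pre, Fin.sum_univ_add, Ok] using hI
        · simpa [hq] using gid _
      · simpa using gid _
  | mul k i j =>
    constructor
    · apply key
      intro p
      by_cases hp : p = k
      · subst hp
        simp [compile, Step.runs, Step.run, Step.pre, Fin.sum_univ_add, hid, hsq, Instr.run,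
          Pi.single_apply, add_mul, sub_mul, Finset.sum_add_distrib]
        ring
      · simp [compile, Step.runs, Step.run, Step.pre, Fin.sum_univ_add, hid, Instr.run,
          Pi.single_apply, hp]
    · refine ⟨fun p => ?_, fun p => gid _, trivial⟩
      refine Fin.addCases (fun q => ?_) (fun q => ?_) p
      · simpa using gid _
      · simpa using gsq _

theorem compiles_spec (hA : IdSq ev good idA sqA) (l : List (Instr A r)) (s : Fin r → ℝ)
    (t : Fin 2 → ℝ) (hl : Oks ev good l s) :
    (∃ t', Step.runs ev (compiles idA sqA l) (Fin.append s t) = Fin.append (runs ev l s) t') ∧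
      Step.Oks ev good (compiles idA sqA l) (Fin.append s t) := by
  induction l generalizing s t with
  | nil => exact ⟨⟨t, rfl⟩, trivial⟩
  | cons I l ih =>
    obtain ⟨⟨t', h1⟩, h2⟩ := compile_spec hA I s t hl.1
    rw [compiles, List.flatMap_cons, ← compiles, Step.runs_append, Step.oks_append, h1]
    obtain ⟨h3, h4⟩ := ih (I.run ev s) t' hl.2
    exact ⟨h3, h2, h4⟩

end Instr

end NetApprox

namespace NetApprox

open Finset

/-! ### Simulating a network node by node -/

theorem abs_sum_mul_le {n : ℕ} (a h : Fin n → ℝ) {e : ℝ} (hh : ∀ j, |h j| ≤ e) :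
    |∑ j, a j * h j| ≤ (∑ j, |a j|) * e := by
  rw [sum_mul]
  refine (abs_sum_le_sum_abs _ _).trans (sum_le_sum fun j _ => ?_)
  rw [abs_mul]
  exact mul_le_mul_of_nonneg_left (hh j) (abs_nonneg _)

theorem abs_affine_le_one {n : ℕ} (a h : Fin n → ℝ) (b : ℝ) (ha : (∑ j, |a j|) + |b| ≤ 1)
    (hh : ∀ j, |h j| ≤ 1) : |(∑ j, a j * h j) + b| ≤ 1 := by
  have := abs_sum_mul_le a h hh
  have := abs_add_le (∑ j, a j * h j) b
  linarith

theorem abs_affine_sub_le {n : ℕ} (a h h' : Fin n → ℝ) (b : ℝ) {e : ℝ}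
    (ha : (∑ j, |a j|) + |b| ≤ 1) (he : 0 ≤ e) (hh : ∀ j, |h j - h' j| ≤ e) :
    |((∑ j, a j * h j) + b) - ((∑ j, a j * h' j) + b)| ≤ e := by
  have h1 := abs_sum_mul_le a (fun j => h j - h' j) hh
  have h2 : ((∑ j, a j * h j) + b) - ((∑ j, a j * h' j) + b) = ∑ j, a j * (h j - h' j) := by
    simp only [mul_sub, sum_sub_distrib]
    ring
  have h3 : ∑ j, |a j| ≤ 1 := by
    have := abs_nonneg b
    linarith
  rw [h2]
  exact h1.trans ((mul_le_mul_of_nonneg_right h3 he).trans (one_mul e).le)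

theorem sum_sum_ite_mul {n n' : ℕ} (ι : Fin n → Fin n') (a : Fin n → ℝ) (g : Fin n' → ℝ) :
    ∑ l, (∑ j, if ι j = l then a j else 0) * g l = ∑ j, a j * g (ι j) := by
  simp only [sum_mul, ite_mul, zero_mul]
  rw [sum_comm]
  simp

theorem geomS_succ (M : ℕ) (L : ℝ) : geomS (M + 1) L = L * geomS M L + 1 := by
  rw [geomS, geom_sum_succ, geomS]

theorem geomS_nonneg (M : ℕ) {L : ℝ} (hL : 0 ≤ L) : 0 ≤ geomS M L :=
  sum_nonneg fun _ _ => pow_nonneg hL _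

theorem one_le_geomS {M : ℕ} (hM : 1 ≤ M) {L : ℝ} (hL : 0 ≤ L) : 1 ≤ geomS M L := by
  obtain ⟨N, rfl⟩ := Nat.exists_eq_add_of_le' hM
  rw [geomS_succ]
  nlinarith [geomS_nonneg N hL]

theorem params_le {A : Type} {d w c : ℕ} (cost : A → ℕ) {n : ℕ} (H : Layers A d n)
    (hw : H.WidthLE w) (hc : H.ForallAct fun a => cost a ≤ c) :
    n ≤ max d w ∧ H.params cost ≤ H.units * (max d w + 1 + c) := by
  induction H with
  | input => simp [Layers.params]
  | layer prev m W b act ih =>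
    obtain ⟨h1, h2⟩ := ih hw.1 hc.1
    refine ⟨hw.2.trans (le_max_right _ _), ?_⟩
    have h3 : ∑ i, cost (act i) ≤ m * c := by
      refine (sum_le_sum fun i _ => hc.2 i).trans ?_
      simp
    simp only [Layers.params, Layers.units]
    nlinarith [Nat.mul_le_mul_left m (Nat.succ_le_succ h1)]

section Block

variable {A : Type} {d w m : ℕ}

/-- `m` steps, each on its own block of `w` registers, as one layer; register `p` of block `i` is
the node `finProdFinEquiv (i, p)`. -/
noncomputable def blockLayer (st : Fin m → Step A w) (H : Layers A d (m * w)) :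
    Layers A d (m * w) :=
  H.layer (m * w)
    (fun a c => if (finProdFinEquiv.symm a).1 = (finProdFinEquiv.symm c).1 then
      (st (finProdFinEquiv.symm a).1).W (finProdFinEquiv.symm a).2 (finProdFinEquiv.symm c).2
      else 0)
    (fun a => (st (finProdFinEquiv.symm a).1).b (finProdFinEquiv.symm a).2)
    (fun a => (st (finProdFinEquiv.symm a).1).act (finProdFinEquiv.symm a).2)

/-- Block layers in succession. -/
noncomputable def blockLayers : List (Fin m → Step A w) → Layers A d (m * w) →
    Layers A d (m * w)
  | [], H => H
  | st :: l, H => blockLayers l (blockLayer st H)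

theorem sum_block (i : Fin m) (f : Fin w → ℝ) (g : Fin (m * w) → ℝ) :
    ∑ c : Fin (m * w), (if i = (finProdFinEquiv.symm c).1 then f (finProdFinEquiv.symm c).2
      else 0) * g c = ∑ q, f q * g (finProdFinEquiv (i, q)) := by
  rw [← finProdFinEquiv.sum_comp, Fintype.sum_prod_type]
  simp [ite_mul]

theorem eval_blockLayers (ev : A → ℝ → ℝ) (x : Fin d → ℝ) (l : List (Fin m → Step A w))
    (H : Layers A d (m * w)) (i : Fin m) (p : Fin w) :
    (blockLayers l H).eval ev x (finProdFinEquiv (i, p)) =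
      Step.runs ev (l.map (· i)) (fun q => H.eval ev x (finProdFinEquiv (i, q))) p := by
  induction l generalizing H with
  | nil => rfl
  | cons st l ih =>
    rw [blockLayers, ih, List.map_cons, Step.runs]
    congr 1
    funext q
    simp only [blockLayer, Layers.eval, sum_block]
    simp [Step.run, Step.pre]

theorem forallPreact_blockLayers (ev : A → ℝ → ℝ) (good : A → ℝ → Prop) (x : Fin d → ℝ)
    (l : List (Fin m → Step A w)) (H : Layers A d (m * w)) (hH : H.ForallPreact ev good x)
    (hl : ∀ i, Step.Oks ev good (l.map (· i)) (fun q => H.eval ev x (finProdFinEquiv (i, q)))) :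
    (blockLayers l H).ForallPreact ev good x := by
  induction l generalizing H with
  | nil => exact hH
  | cons st l ih =>
    refine ih _ ⟨hH, fun a => ?_⟩ fun i => ?_
    · obtain ⟨⟨i, p⟩, rfl⟩ := finProdFinEquiv.surjective a
      have := (hl i).1 p
      simp only [sum_block]
      simpa [Step.pre] using this
    · have := (hl i).2
      convert this using 1
      funext q
      simp only [blockLayer, Layers.eval, sum_block]
      simp [Step.run, Step.pre]

theorem units_blockLayers (l : List (Fin m → Step A w)) (H : Layers A d (m * w)) :
    (blockLayers l H).units = H.units + l.length * (m * w) := by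
  induction l generalizing H with
  | nil => simp [blockLayers]
  | cons st l ih =>
    rw [blockLayers, ih, List.length_cons]
    simp only [blockLayer, Layers.units]
    ring

theorem widthLE_blockLayers {k : ℕ} (l : List (Fin m → Step A w)) (H : Layers A d (m * w))
    (hH : H.WidthLE k) (hk : m * w ≤ k) : (blockLayers l H).WidthLE k := by
  induction l generalizing H with
  | nil => exact hH
  | cons st l ih => exact ih _ ⟨hH, hk⟩

theorem forallAct_blockLayers {P : A → Prop} (l : List (Fin m → Step A w))
    (H : Layers A d (m * w)) (hH : H.ForallAct P) (hl : ∀ st ∈ l, ∀ i p, P ((st i).act p)) :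
    (blockLayers l H).ForallAct P := by
  induction l generalizing H with
  | nil => exact hH
  | cons st l ih =>
    exact ih _ ⟨hH, fun a => hl st (by simp) _ _⟩ fun st' h => hl st' (by simp [h])

/-- `m` lists of `T` steps as one list of `T` rows of `m` steps (`s₀` fills up shorter lists). -/
def rows (s₀ : Step A w) (T : ℕ) (g : Fin m → List (Step A w)) : List (Fin m → Step A w) :=
  (List.range T).map fun t i => (g i).getD t s₀

theorem map_rows (s₀ : Step A w) {T : ℕ} (g : Fin m → List (Step A w)) (i : Fin m)
    (h : (g i).length = T) : (rows s₀ T g).map (· i) = g i := by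
  apply List.ext_getElem
  · simp [rows, h]
  · intro t h1 h2
    simp [rows, h2]

end Block

/-- Started at `t ∈ [-1,1]` in register `0` and zeros elsewhere, the program `l` runs without
inadmissible arguments, and leaves in register `0` a number in `[-1,1]` that is `δ`-close to
`f t`. -/
def IsGadget {A : Type} {w : ℕ} [NeZero w] (ev : A → ℝ → ℝ) (good : A → ℝ → Prop) (δ : ℝ)
    (f : ℝ → ℝ) (l : List (Step A w)) : Prop :=
  ∀ t ∈ Set.Icc (-1 : ℝ) 1, Step.Oks ev good l (Pi.single 0 t) ∧
    |Step.runs ev l (Pi.single 0 t) 0| ≤ 1 ∧ |Step.runs ev l (Pi.single 0 t) 0 - f t| ≤ δ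

/-- If every activation of a normalized network maps `[-1,1]` to itself, is `L`-Lipschitz there and
has a `δ`-accurate gadget, then replacing the nodes by gadgets changes a network of depth `M` by at
most `δ (1 + L + ⋯ + L ^ (M - 1))`: if `e` bounds the error of one layer, then `L * e + δ` bounds
that of the next. -/
theorem exists_simulation {A B : Type} {d k w T : ℕ} [NeZero w] {ev : A → ℝ → ℝ}
    {good : A → ℝ → Prop} {idA : A} {P : A → Prop} (evB : B → ℝ → ℝ) {Good : B → Prop} {L δ : ℝ}
    (gad : B → List (Step A w)) (hid : ∀ t, ev idA t = t) (gid : ∀ t, good idA t)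
    (Pid : P idA) (hL : 0 ≤ L) (hδ : 0 ≤ δ)
    (hgad : ∀ a, Good a → (gad a).length = T ∧ (∀ st ∈ gad a, ∀ p, P (st.act p)) ∧
      IsGadget ev good δ (evB a) (gad a))
    (hB : ∀ a, Good a → ∀ s ∈ Set.Icc (-1 : ℝ) 1, |evB a s| ≤ 1 ∧
      ∀ t ∈ Set.Icc (-1 : ℝ) 1, |evB a s - evB a t| ≤ L * |s - t|)
    {n : ℕ} (H : Layers B d n) (hk : H.WidthLE k) (hN : H.Normalized) (hG : H.ForallAct Good) :
    ∃ (n' : ℕ) (H' : Layers A d n') (ι : Fin n → Fin n'),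
      H'.units ≤ H.depth * (k * w * (T + 1)) ∧ H'.WidthLE (k * w) ∧ H'.ForallAct P ∧
      ∀ x ∈ cube d, H'.ForallPreact ev good x ∧ ∀ j, |H'.eval ev x (ι j)| ≤ 1 ∧
        |H.eval evB x j| ≤ 1 ∧ |H.eval evB x j - H'.eval ev x (ι j)| ≤ δ * geomS H.depth L := by
  induction H with
  | input =>
    refine ⟨d, Layers.input, id, by simp [Layers.units], trivial, trivial, fun x hx => ⟨trivial,
      fun j => ⟨abs_le.2 (hx j), abs_le.2 (hx j), ?_⟩⟩⟩
    simp [Layers.eval, Layers.depth, geomS]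
  | layer prev m W b act ih =>
    obtain ⟨n', H', ι, h1, h2, h3, h4⟩ := ih hk.1 hN.1 hG.1
    set F : Layers A d (m * w) := H'.layer (m * w)
      (fun a l => if (finProdFinEquiv.symm a).2 = 0 then
        ∑ j, if ι j = l then W (finProdFinEquiv.symm a).1 j else 0 else 0)
      (fun a => if (finProdFinEquiv.symm a).2 = 0 then b (finProdFinEquiv.symm a).1 else 0)
      (fun _ => idA) with hF
    set l : List (Fin m → Step A w) := rows ⟨0, 0, fun _ => idA⟩ T fun i => gad (act i) with hl
    have hmap : ∀ i, l.map (· i) = gad (act i) := fun i =>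
      map_rows _ _ _ (hgad _ (hG.2 i)).1
    have hmw : m * w ≤ k * w := Nat.mul_le_mul_right _ hk.2
    have hFe : ∀ x (i : Fin m), (fun q => F.eval ev x (finProdFinEquiv (i, q))) =
        Pi.single 0 ((∑ j, W i j * H'.eval ev x (ι j)) + b i) := by
      intro x i
      funext q
      simp only [hF, Layers.eval, hid, Equiv.symm_apply_apply]
      by_cases hq : q = 0
      · subst hq
        simp [sum_sum_ite_mul]
      · simp [hq]
    refine ⟨m * w, blockLayers l F, fun i => finProdFinEquiv (i, 0), ?_, ?_, ?_, ?_⟩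
    · rw [units_blockLayers]
      simp only [hF, Layers.units, Layers.depth, hl, rows, List.length_map, List.length_range]
      nlinarith [Nat.mul_le_mul_left (T + 1) hmw]
    · exact widthLE_blockLayers _ _ ⟨h2, hmw⟩ hmw
    · refine forallAct_blockLayers _ _ ⟨h3, fun _ => Pid⟩ fun st hst i p => ?_
      have : st i ∈ gad (act i) := by
        rw [← hmap i]
        exact List.mem_map_of_mem hst
      exact (hgad _ (hG.2 i)).2.1 _ this p
    · intro x hx
      obtain ⟨h5, h6⟩ := h4 x hx
      have hpre : ∀ i, (∑ j, W i j * H'.eval ev x (ι j)) + b i ∈ Set.Icc (-1 : ℝ) 1 := fun i =>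
        abs_le.1 (abs_affine_le_one _ _ _ (hN.2 i) fun j => (h6 j).1)
      have hpre' : ∀ i, (∑ j, W i j * prev.eval evB x j) + b i ∈ Set.Icc (-1 : ℝ) 1 := fun i =>
        abs_le.1 (abs_affine_le_one _ _ _ (hN.2 i) fun j => (h6 j).2.1)
      constructor
      · refine forallPreact_blockLayers _ _ _ _ _ ⟨h5, fun _ => gid _⟩ fun i => ?_
        rw [hmap, hFe]
        exact ((hgad _ (hG.2 i)).2.2 _ (hpre i)).1
      · intro i
        rw [eval_blockLayers, hmap, hFe]
        obtain ⟨-, g1, g2⟩ := (hgad _ (hG.2 i)).2.2 _ (hpre i)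
        refine ⟨g1, (hB _ (hG.2 i) _ (hpre' i)).1, ?_⟩
        have hS := mul_nonneg hδ (geomS_nonneg prev.depth hL)
        have e1 := abs_affine_sub_le (W i) (fun j => prev.eval evB x j)
          (fun j => H'.eval ev x (ι j)) (b i) (hN.2 i) hS fun j => (h6 j).2.2
        have e2 := (hB _ (hG.2 i) _ (hpre' i)).2 _ (hpre i)
        have e3 := mul_le_mul_of_nonneg_left e1 hL
        simp only [Layers.eval, Layers.depth, geomS_succ]
        rw [abs_sub_comm] at g2
        refine (abs_sub_le _ (evB (act i) ((∑ j, W i j * H'.eval ev x (ι j)) + b i)) _).trans ?_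
        nlinarith

end NetApprox

namespace NetApprox

open Real

/-! ### Theta constants and the arithmetic-geometric mean -/

/-- `θ₃(e^{-πt})`. -/
noncomputable def theta3 (t : ℝ) : ℝ := ∑' n : ℤ, exp (-π * t * (n : ℝ) ^ 2)

/-- `θ₄(e^{-πt})`. -/
noncomputable def theta4 (t : ℝ) : ℝ := ∑' n : ℤ, (-1 : ℝ) ^ n * exp (-π * t * (n : ℝ) ^ 2)

/-- `θ₂(e^{-πt})`. -/
noncomputable def theta2 (t : ℝ) : ℝ := ∑' n : ℤ, exp (-π * t * ((n : ℝ) + 1 / 2) ^ 2)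

theorem summable_theta3 {t : ℝ} (ht : 0 < t) :
    Summable fun n : ℤ => exp (-π * t * (n : ℝ) ^ 2) := by
  have := summable_pow_mul_jacobiTheta₂_term_bound 0 ht 0
  refine this.congr fun n => ?_
  simp only [pow_zero, one_mul]
  congr 1
  ring

theorem summable_theta4 {t : ℝ} (ht : 0 < t) :
    Summable fun n : ℤ => (-1 : ℝ) ^ n * exp (-π * t * (n : ℝ) ^ 2) := by
  refine Summable.of_norm ((summable_theta3 ht).congr fun n => ?_)
  simp [abs_of_pos (exp_pos _)]

theorem theta3_modular {t : ℝ} (ht : 0 < t) : theta3 t ^ 2 = theta3 t⁻¹ ^ 2 / t := by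
  have h := Real.tsum_exp_neg_mul_int_sq ht
  have h1 : theta3 t = 1 / t ^ (1 / 2 : ℝ) * theta3 t⁻¹ := h
  rw [h1, mul_pow, div_pow, one_pow, ← Real.sqrt_eq_rpow, Real.sq_sqrt ht.le]
  ring

theorem theta4_modular {t : ℝ} (ht : 0 < t) : theta4 t ^ 2 = theta2 t⁻¹ ^ 2 / t := by
  have h := Complex.tsum_exp_neg_quadratic (a := (t : ℂ)) (by simpa using ht) (Complex.I / 2)
  have h1 : theta4 t = 1 / t ^ (1 / 2 : ℝ) * ∑' n : ℤ, exp (-π * t⁻¹ * ((n : ℝ) - 1 / 2) ^ 2) := by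
    apply Complex.ofReal_injective
    rw [theta4, Complex.ofReal_tsum, Complex.ofReal_mul, Complex.ofReal_tsum]
    convert h using 2
    · funext n
      rw [Complex.exp_add]
      have h2 : Complex.exp (2 * π * (Complex.I / 2) * n) = (-1) ^ n := by
        rw [← Complex.exp_pi_mul_I, ← Complex.exp_int_mul]
        congr 1
        ring
      rw [h2]
      push_cast
      ring
    · rw [Complex.ofReal_div, Complex.ofReal_cpow ht.le]
      simp
    · congr 1
      funext n
      push_cast
      congr 1
      rw [← mul_div_assoc, Complex.I_mul_I]
      ring
  have h2 : ∑' n : ℤ, exp (-π * t⁻¹ * ((n : ℝ) - 1 / 2) ^ 2) = theta2 t⁻¹ := by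
    rw [theta2, ← (Equiv.addRight (1 : ℤ)).tsum_eq]
    congr 1
    funext n
    simp only [Equiv.coe_addRight]
    push_cast
    congr 2
    ring
  rw [h1, h2, mul_pow, div_pow, one_pow, ← Real.sqrt_eq_rpow, Real.sq_sqrt ht.le]
  ring

/-- The substitution `m = u + v`, `n = u - v` in a double series supported on `m ≡ n mod 2`. -/
theorem tsum_int_rotate (f : ℤ × ℤ → ℝ) (hf : ∀ m n : ℤ, Odd (m + n) → f (m, n) = 0) :
    ∑' p : ℤ × ℤ, f (p.1 + p.2, p.1 - p.2) = ∑' p, f p := by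
  have hinj : Function.Injective fun p : ℤ × ℤ => (p.1 + p.2, p.1 - p.2) := by
    rintro ⟨a, b⟩ ⟨c, d⟩ h
    simp only [Prod.mk.injEq] at h ⊢
    omega
  refine hinj.tsum_eq fun p hp => ?_
  rcases Int.even_or_odd (p.1 + p.2) with h | h
  · obtain ⟨a, ha⟩ := h
    refine ⟨(a, p.1 - a), ?_⟩
    ext
    · simp
    · simp
      omega
  · exact absurd (hf _ _ h) hp

theorem tsum_mul_int {f g : ℤ → ℝ} (hf : Summable f) (hg : Summable g) :
    (∑' n, f n) * ∑' n, g n = ∑' p : ℤ × ℤ, f p.1 * g p.2 :=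
  tsum_mul_tsum_of_summable_norm hf.norm hg.norm

theorem summable_mul_int {f g : ℤ → ℝ} (hf : Summable f) (hg : Summable g) :
    Summable fun p : ℤ × ℤ => f p.1 * g p.2 :=
  summable_mul_of_summable_norm hf.norm hg.norm

theorem exp_rotate (t : ℝ) (u v : ℤ) :
    exp (-π * t * ((u + v : ℤ) : ℝ) ^ 2) * exp (-π * t * ((u - v : ℤ) : ℝ) ^ 2) =
      exp (-π * (2 * t) * (u : ℝ) ^ 2) * exp (-π * (2 * t) * (v : ℝ) ^ 2) := by
  rw [← exp_add, ← exp_add]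
  congr 1
  push_cast
  ring

theorem theta_arith {t : ℝ} (ht : 0 < t) :
    (theta3 t ^ 2 + theta4 t ^ 2) / 2 = theta3 (2 * t) ^ 2 := by
  have h3 := summable_theta3 ht
  have h4 := summable_theta4 ht
  have h3' := summable_theta3 (t := 2 * t) (by positivity)
  rw [sq, sq, sq, theta3, theta4, theta3, tsum_mul_int h3 h3, tsum_mul_int h4 h4,
    tsum_mul_int h3' h3', ← (summable_mul_int h3 h3).tsum_add (summable_mul_int h4 h4),
    ← tsum_div_const, ← tsum_int_rotate]
  · congr 1
    funext p
    rw [← exp_rotate]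
    have : (-1 : ℝ) ^ (p.1 + p.2) * (-1) ^ (p.1 - p.2) = 1 := by
      rw [← zpow_add₀ (by norm_num)]
      exact Even.neg_one_zpow ⟨p.1, by ring⟩
    linear_combination (exp (-π * t * ((p.1 + p.2 : ℤ) : ℝ) ^ 2) *
      exp (-π * t * ((p.1 - p.2 : ℤ) : ℝ) ^ 2)) / 2 * this
  · intro m n hmn
    have : (-1 : ℝ) ^ m * (-1) ^ n = -1 := by
      rw [← zpow_add₀ (by norm_num)]
      exact Odd.neg_one_zpow hmn
    simp only
    linear_combination (exp (-π * t * (m : ℝ) ^ 2) * exp (-π * t * (n : ℝ) ^ 2)) / 2 * this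

theorem theta_geom {t : ℝ} (ht : 0 < t) : theta3 t * theta4 t = theta4 (2 * t) ^ 2 := by
  have h3 := summable_theta3 ht
  have h4 := summable_theta4 ht
  have h4' := summable_theta4 (t := 2 * t) (by positivity)
  have e : theta3 t * theta4 t = (theta3 t * theta4 t + theta4 t * theta3 t) / 2 := by ring
  rw [e, sq, theta3, theta4, theta4, tsum_mul_int h3 h4, tsum_mul_int h4 h3,
    tsum_mul_int h4' h4', ← (summable_mul_int h3 h4).tsum_add (summable_mul_int h4 h3),
    ← tsum_div_const, ← tsum_int_rotate]
  · congr 1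
    funext p
    have e1 := exp_rotate t p.1 p.2
    have h1 : (-1 : ℝ) ^ (p.1 + p.2) = (-1) ^ p.1 * (-1) ^ p.2 := zpow_add₀ (by norm_num) _ _
    have h2 : (-1 : ℝ) ^ (p.1 - p.2) = (-1) ^ p.1 * (-1) ^ p.2 := by
      rw [← zpow_add₀ (by norm_num), show p.1 + p.2 = p.1 - p.2 + (p.2 + p.2) by ring,
        zpow_add₀ (by norm_num), Even.neg_one_zpow ⟨p.2, rfl⟩, mul_one]
    rw [h1, h2]
    linear_combination (-1 : ℝ) ^ p.1 * (-1) ^ p.2 * e1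
  · intro m n hmn
    have : (-1 : ℝ) ^ m + (-1) ^ n = 0 := by
      rcases Int.even_or_odd m with hm | hm
      · have hn : Odd n := by
          rcases Int.even_or_odd n with hn | hn
          · exact absurd hmn (Int.not_odd_iff_even.2 (hm.add hn))
          · exact hn
        rw [hm.neg_one_zpow, hn.neg_one_zpow]
        norm_num
      · have hn : Even n := by
          rcases Int.even_or_odd n with hn | hn
          · exact hn
          · exact absurd hmn (Int.not_odd_iff_even.2 (hm.add_odd hn))
        rw [hm.neg_one_zpow, hn.neg_one_zpow]
        norm_num
    simp only
    linear_combination (exp (-π * t * (m : ℝ) ^ 2) * exp (-π * t * (n : ℝ) ^ 2)) / 2 * this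

theorem one_le_theta3 {t : ℝ} (ht : 0 < t) : 1 ≤ theta3 t := by
  have := (summable_theta3 ht).le_tsum 0 fun n _ => (exp_pos _).le
  simpa [theta3] using this

theorem exp_neg_pi_mul_le {t : ℝ} (ht : 1 ≤ t) : exp (-π * t) ≤ 1 / 4 := by
  have h1 : exp (-π * t) ≤ exp (-3) := exp_le_exp.2 (by nlinarith [pi_gt_three])
  have h2 : exp (-3) ≤ 1 / 4 := by
    rw [exp_neg, inv_le_comm₀ (exp_pos _) (by norm_num)]
    have := add_one_le_exp (3 : ℝ)
    norm_num
    linarith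
  linarith

theorem theta3_le {t : ℝ} (ht : 1 ≤ t) : theta3 t ≤ 1 + 3 * exp (-π * t) := by
  have ht0 : 0 < t := by linarith
  have hs := summable_theta3 ht0
  have hr0 : 0 < exp (-π * t) := exp_pos _
  have hr := exp_neg_pi_mul_le ht
  have hn : HasSum (fun n : ℕ => exp (-π * t) ^ (n + 1)) (exp (-π * t) * (1 - exp (-π * t))⁻¹) := by
    simp only [pow_succ']
    exact (hasSum_geometric_of_lt_one hr0.le (by linarith)).mul_left _
  have hle : ∀ n : ℕ, exp (-π * t * ((n : ℝ) + 1) ^ 2) ≤ exp (-π * t) ^ (n + 1) := by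
    intro n
    rw [← exp_nat_mul]
    apply exp_le_exp.2
    push_cast
    have h0 : (0 : ℝ) ≤ n := n.cast_nonneg
    nlinarith [mul_pos pi_pos ht0, mul_nonneg (mul_pos pi_pos ht0).le (mul_nonneg h0 h0),
      mul_nonneg (mul_pos pi_pos ht0).le h0]
  have hN : Summable fun n : ℕ => exp (-π * t * ((n : ℝ) + 1) ^ 2) :=
    hn.summable.of_nonneg_of_le (fun n => (exp_pos _).le) hle
  have hsum : theta3 t = 1 + 2 * ∑' n : ℕ, exp (-π * t * ((n : ℝ) + 1) ^ 2) := by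
    have := tsum_int_eq_zero_add_two_mul_tsum_pnat (f := fun n : ℤ => exp (-π * t * (n : ℝ) ^ 2))
      (fun n => by simp) hs
    rw [theta3, this, tsum_pnat_eq_tsum_succ (f := fun n : ℕ => exp (-π * t * ((n : ℤ) : ℝ) ^ 2))]
    simp
  have h3 : ∑' n : ℕ, exp (-π * t * ((n : ℝ) + 1) ^ 2) ≤
      exp (-π * t) * (1 - exp (-π * t))⁻¹ := by
    rw [← hn.tsum_eq]
    exact hN.tsum_le_tsum hle hn.summable
  have h4 : (1 - exp (-π * t))⁻¹ ≤ 3 / 2 := by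
    rw [inv_le_comm₀ (by linarith) (by norm_num)]
    linarith
  rw [hsum]
  nlinarith

theorem theta2_bounds {t : ℝ} (ht : 1 ≤ t) :
    2 * exp (-π * t / 4) ≤ theta2 t ∧
      theta2 t ≤ 2 * exp (-π * t / 4) * (1 + 3 * exp (-π * t)) := by
  have ht0 : 0 < t := by linarith
  have hr0 : 0 < exp (-π * t) := exp_pos _
  have hr := exp_neg_pi_mul_le ht
  have hn : HasSum (fun n : ℕ => exp (-π * t / 4) * exp (-π * t) ^ n)
      (exp (-π * t / 4) * (1 - exp (-π * t))⁻¹) :=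
    (hasSum_geometric_of_lt_one hr0.le (by linarith)).mul_left _
  have hle : ∀ n : ℕ, exp (-π * t * ((n : ℝ) + 1 / 2) ^ 2) ≤
      exp (-π * t / 4) * exp (-π * t) ^ n := by
    intro n
    rw [← exp_nat_mul, ← exp_add]
    apply exp_le_exp.2
    have h0 : (0 : ℝ) ≤ n := n.cast_nonneg
    nlinarith [mul_pos pi_pos ht0, mul_nonneg (mul_pos pi_pos ht0).le (mul_nonneg h0 h0),
      mul_nonneg (mul_pos pi_pos ht0).le h0]
  have hN : Summable fun n : ℕ => exp (-π * t * ((n : ℝ) + 1 / 2) ^ 2) :=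
    hn.summable.of_nonneg_of_le (fun n => (exp_pos _).le) hle
  have hsum : theta2 t = 2 * ∑' n : ℕ, exp (-π * t * ((n : ℝ) + 1 / 2) ^ 2) := by
    have h := HasSum.of_nat_of_neg_add_one (f := fun n : ℤ => exp (-π * t * ((n : ℝ) + 1 / 2) ^ 2))
      (by simpa using hN.hasSum) (m' := ∑' n : ℕ, exp (-π * t * ((n : ℝ) + 1 / 2) ^ 2)) (by
        refine hN.hasSum.congr_fun fun n => ?_
        push_cast
        congr 1
        ring)
    rw [theta2, h.tsum_eq]
    simp
    ring
  have h3 : ∑' n : ℕ, exp (-π * t * ((n : ℝ) + 1 / 2) ^ 2) ≤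
      exp (-π * t / 4) * (1 - exp (-π * t))⁻¹ := by
    rw [← hn.tsum_eq]
    exact hN.tsum_le_tsum hle hn.summable
  have h5 : exp (-π * t / 4) ≤ ∑' n : ℕ, exp (-π * t * ((n : ℝ) + 1 / 2) ^ 2) := by
    have := hN.le_tsum 0 fun n _ => (exp_pos _).le
    refine le_trans (le_of_eq ?_) this
    congr 1
    norm_num
    ring
  have h4 : (1 - exp (-π * t))⁻¹ ≤ 1 + 3 * exp (-π * t) := by
    rw [inv_le_iff_one_le_mul₀ (by linarith)]
    nlinarith
  have h6 : 0 < exp (-π * t / 4) := exp_pos _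
  rw [hsum]
  constructor
  · linarith
  · nlinarith [mul_le_mul_of_nonneg_left h4 h6.le]

end NetApprox

namespace NetApprox

open Real

/-- One step of the arithmetic-geometric mean iteration. -/
noncomputable def agmStep (p : ℝ × ℝ) : ℝ × ℝ := ((p.1 + p.2) / 2, √(p.1 * p.2))

/-- `N` steps of the arithmetic-geometric mean iteration. -/
noncomputable def agm : ℕ → ℝ × ℝ → ℝ × ℝ
  | 0, p => p
  | N + 1, p => agmStep (agm N p)

theorem agm_nonneg (N : ℕ) {p : ℝ × ℝ} (h1 : 0 ≤ p.1) (h2 : 0 ≤ p.2) :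
    0 ≤ (agm N p).1 ∧ 0 ≤ (agm N p).2 := by
  induction N with
  | zero => exact ⟨h1, h2⟩
  | succ N ih => exact ⟨div_nonneg (add_nonneg ih.1 ih.2) zero_le_two, sqrt_nonneg _⟩

theorem agm_pos (N : ℕ) {p : ℝ × ℝ} (h1 : 0 < p.1) (h2 : 0 < p.2) :
    0 < (agm N p).1 ∧ 0 < (agm N p).2 := by
  induction N with
  | zero => exact ⟨h1, h2⟩
  | succ N ih => exact ⟨half_pos (add_pos ih.1 ih.2), sqrt_pos.2 (mul_pos ih.1 ih.2)⟩

theorem agm_mono (N : ℕ) {p q : ℝ × ℝ} (h1 : 0 ≤ p.1) (h2 : 0 ≤ p.2) (hpq : p ≤ q) :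
    agm N p ≤ agm N q := by
  induction N with
  | zero => exact hpq
  | succ N ih =>
    obtain ⟨n1, n2⟩ := agm_nonneg N h1 h2
    refine ⟨?_, ?_⟩
    · exact div_le_div_of_nonneg_right (add_le_add ih.1 ih.2) zero_le_two
    · exact sqrt_le_sqrt (mul_le_mul ih.1 ih.2 n2 (n1.trans ih.1))

theorem agm_smul (N : ℕ) {c : ℝ} (hc : 0 ≤ c) (p : ℝ × ℝ) :
    agm N (c * p.1, c * p.2) = (c * (agm N p).1, c * (agm N p).2) := by
  induction N with
  | zero => rfl
  | succ N ih =>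
    rw [agm, ih, agm]
    simp only [agmStep, Prod.mk.injEq]
    constructor
    · ring
    · rw [show c * (agm N p).1 * (c * (agm N p).2) = c ^ 2 * ((agm N p).1 * (agm N p).2) by ring,
        sqrt_mul (sq_nonneg c), sqrt_sq hc]

theorem agm_theta (N : ℕ) {t : ℝ} (ht : 0 < t) :
    agm N (theta3 t ^ 2, theta4 t ^ 2) = (theta3 (2 ^ N * t) ^ 2, theta4 (2 ^ N * t) ^ 2) := by
  induction N with
  | zero => simp [agm]
  | succ N ih =>
    have hN : 0 < 2 ^ N * t := by positivity
    rw [agm, ih, agmStep, theta_arith hN, ← mul_pow, theta_geom hN, sqrt_sq (sq_nonneg _),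
      pow_succ' (2 : ℝ) N]
    simp only [mul_assoc]

/-- Steps of Heron's iteration for `√v`, started at `z`. -/
noncomputable def heron (v : ℝ) : ℕ → ℝ → ℝ
  | 0, z => z
  | j + 1, z => (heron v j z + v / heron v j z) / 2

theorem heron_step {s e : ℝ} (hs : 0 < s) (he : -1 < e) :
    (s * (1 + e) + s ^ 2 / (s * (1 + e))) / 2 = s * (1 + e ^ 2 / (2 * (1 + e))) := by
  have : 1 + e ≠ 0 := by linarith
  field_simp
  ring

theorem heron_bounds {v z : ℝ} (hv : 0 < v) (h1 : √v / 2 ≤ z) (h2 : z ≤ 2 * √v) (j : ℕ) :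
    √v ≤ heron v (j + 1) z ∧ heron v (j + 1) z ≤ √v * (1 + (1 / 2) ^ 2 ^ (j + 1)) := by
  have hs : 0 < √v := sqrt_pos.2 hv
  have hvs : v = √v ^ 2 := (sq_sqrt hv.le).symm
  have key : ∀ (e : ℝ) i, -1 < e → heron v i z = √v * (1 + e) →
      heron v (i + 1) z = √v * (1 + e ^ 2 / (2 * (1 + e))) := by
    intro e i he h
    rw [heron, h, ← heron_step hs he, ← hvs]
  suffices ∃ e, 0 ≤ e ∧ e ≤ (1 / 2) ^ 2 ^ (j + 1) ∧ heron v (j + 1) z = √v * (1 + e) by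
    obtain ⟨e, e0, e1, e2⟩ := this
    rw [e2]
    constructor <;> nlinarith
  induction j with
  | zero =>
    obtain ⟨e, he⟩ : ∃ e, z = √v * (1 + e) := ⟨z / √v - 1, by field_simp; ring⟩
    have e1 : -(1 / 2) ≤ e := by
      by_contra! h
      nlinarith
    have e2 : e ≤ 1 := by
      by_contra! h
      nlinarith
    refine ⟨e ^ 2 / (2 * (1 + e)), ?_, ?_, key e 0 (by linarith) he⟩
    · have : 0 < 1 + e := by linarith
      positivity
    · rw [div_le_iff₀ (by linarith)]
      norm_num
      nlinarith
  | succ j ih =>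
    obtain ⟨e, e0, e1, e2⟩ := ih
    refine ⟨e ^ 2 / (2 * (1 + e)), by positivity, ?_, key e _ (by linarith) e2⟩
    calc e ^ 2 / (2 * (1 + e)) ≤ e ^ 2 := div_le_self (sq_nonneg e) (by linarith)
      _ ≤ ((1 / 2) ^ 2 ^ (j + 1)) ^ 2 := pow_le_pow_left₀ e0 e1 2
      _ = (1 / 2) ^ 2 ^ (j + 1 + 1) := by rw [← pow_mul, ← pow_succ]

theorem heron_pos {v z : ℝ} (hv : 0 < v) (hz : 0 < z) (j : ℕ) : 0 < heron v j z := by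
  induction j with
  | zero => exact hz
  | succ j ih =>
    rw [heron]
    positivity

/-- The arithmetic-geometric mean iteration in which the square roots are replaced by `j` steps of
Heron's iteration; step `i` starts it at the constant `g i`. -/
noncomputable def agmHeron (j : ℕ) (g : ℕ → ℝ) (p : ℝ × ℝ) : ℕ → ℝ × ℝ
  | 0 => p
  | i + 1 => (((agmHeron j g p i).1 + (agmHeron j g p i).2) / 2,
      heron ((agmHeron j g p i).1 * (agmHeron j g p i).2) j (g i))

/-- Starting values for the square roots in the iteration from `(1, c)`: the exact roots. They
serve as well for `(1, c y)` with `y ∈ [2/3, 3/2]`, by homogeneity and monotonicity. -/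
noncomputable def rootGuess (c : ℝ) (i : ℕ) : ℝ := √((agm i (1, c)).1 * (agm i (1, c)).2)

theorem rootGuess_pos {c : ℝ} (hc : 0 < c) (i : ℕ) : 0 < rootGuess c i := by
  obtain ⟨h1, h2⟩ := agm_pos i (p := (1, c)) one_pos hc
  exact sqrt_pos.2 (mul_pos h1 h2)

theorem agmHeron_bounds {c y η : ℝ} {j N : ℕ} (hc : 0 < c) (hy : 2 / 3 ≤ y) (hy' : y ≤ 3 / 2)
    (hη : η = (1 / 2) ^ 2 ^ (j + 1)) (hN : (1 + η) ^ N ≤ 4 / 3) (i : ℕ) (hi : i ≤ N) :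
    (agm i (1, c * y)).1 ≤ (agmHeron (j + 1) (rootGuess c) (1, c * y) i).1 ∧
    (agm i (1, c * y)).2 ≤ (agmHeron (j + 1) (rootGuess c) (1, c * y) i).2 ∧
    (agmHeron (j + 1) (rootGuess c) (1, c * y) i).1 ≤ (1 + η) ^ i * (agm i (1, c * y)).1 ∧
    (agmHeron (j + 1) (rootGuess c) (1, c * y) i).2 ≤ (1 + η) ^ i * (agm i (1, c * y)).2 := by
  have hη0 : 0 ≤ η := by
    rw [hη]
    positivity
  induction i with
  | zero => simp [agm, agmHeron]
  | succ i ih =>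
    obtain ⟨h1, h2, h3, h4⟩ := ih (by omega)
    obtain ⟨p1, p2⟩ := agm_pos i (p := (1, c * y)) one_pos (by positivity)
    obtain ⟨q1, q2⟩ := agm_pos i (p := (1, c)) one_pos hc
    have l1 : agm i (2 / 3 * 1, 2 / 3 * c) ≤ agm i (1, c * y) :=
      agm_mono i (by norm_num) (by simp only; positivity) ⟨by norm_num, by simp only; nlinarith⟩
    have l2 : agm i (1, c * y) ≤ agm i (3 / 2 * 1, 3 / 2 * c) :=
      agm_mono i (by norm_num) (by simp only; positivity) ⟨by norm_num, by simp only; nlinarith⟩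
    rw [agm_smul i (by norm_num) (1, c)] at l1 l2
    obtain ⟨l1a, l1b⟩ := l1
    obtain ⟨l2a, l2b⟩ := l2
    simp only at l1a l1b l2a l2b
    have hpow : (1 + η) ^ i ≤ 4 / 3 :=
      (pow_le_pow_right₀ (by linarith) (by omega)).trans hN
    have hpow1 : 1 ≤ (1 + η) ^ i := one_le_pow₀ (by linarith)
    set a := (agmHeron (j + 1) (rootGuess c) (1, c * y) i).1 with ha
    set b := (agmHeron (j + 1) (rootGuess c) (1, c * y) i).2 with hb
    set E := agm i (1, c * y) with hE
    set F := agm i (1, c) with hF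
    have ha0 : 0 < a := p1.trans_le h1
    have hb0 : 0 < b := p2.trans_le h2
    have hg : rootGuess c i = √(F.1 * F.2) := rfl
    have r1 : √(E.1 * E.2) ≤ √(a * b) := sqrt_le_sqrt (mul_le_mul h1 h2 p2.le ha0.le)
    have r2 : √(a * b) ≤ (1 + η) ^ i * √(E.1 * E.2) := by
      rw [sqrt_le_left (by positivity), mul_pow, sq_sqrt (by positivity)]
      calc a * b ≤ ((1 + η) ^ i * E.1) * ((1 + η) ^ i * E.2) :=
            mul_le_mul h3 h4 hb0.le (by positivity)
        _ = _ := by ring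
    have r3 : 2 / 3 * rootGuess c i ≤ √(E.1 * E.2) := by
      apply le_sqrt_of_sq_le
      rw [mul_pow, hg, sq_sqrt (by positivity)]
      calc (2 / 3 : ℝ) ^ 2 * (F.1 * F.2) = (2 / 3 * F.1) * (2 / 3 * F.2) := by ring
        _ ≤ _ := mul_le_mul l1a l1b (by positivity) p1.le
    have r4 : √(E.1 * E.2) ≤ 3 / 2 * rootGuess c i := by
      rw [sqrt_le_left (by rw [hg]; positivity), mul_pow, hg, sq_sqrt (by positivity)]
      calc E.1 * E.2 ≤ (3 / 2 * F.1) * (3 / 2 * F.2) :=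
            mul_le_mul l2a l2b p2.le (by positivity)
        _ = _ := by ring
    have hg0 := rootGuess_pos hc i
    obtain ⟨k1, k2⟩ := heron_bounds (z := rootGuess c i) (mul_pos ha0 hb0) (by nlinarith)
      (by nlinarith) j
    rw [← hη] at k2
    refine ⟨?_, ?_, ?_, ?_⟩
    · change (E.1 + E.2) / 2 ≤ (a + b) / 2
      linarith
    · exact r1.trans k1
    · change (a + b) / 2 ≤ (1 + η) ^ (i + 1) * ((E.1 + E.2) / 2)
      rw [pow_succ]
      nlinarith [mul_nonneg (mul_nonneg (zero_le_one.trans hpow1) hη0) (add_pos p1 p2).le]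
    · change heron (a * b) (j + 1) (rootGuess c i) ≤ (1 + η) ^ (i + 1) * √(E.1 * E.2)
      calc _ ≤ √(a * b) * (1 + η) := k2
        _ ≤ (1 + η) ^ i * √(E.1 * E.2) * (1 + η) :=
          mul_le_mul_of_nonneg_right r2 (by linarith)
        _ = _ := by ring

/-- The arithmetic-geometric mean of `1` and `4 e^{-ℓ}` is close to `π / (2 ℓ)`: for
`q = e^{-2ℓ}`, both entries are close to those of the pair `(θ₃(q)², θ₂(q)²)`, on which the
iteration is known explicitly by the modular transformation of the theta constants. -/
theorem agm_log_bounds {l : ℝ} (hl : 2 ≤ l) (N : ℕ) (hN : 2 * l ≤ π * 2 ^ N) :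
    π / (2 * l) ≤ (1 + 3 * exp (-2 * l)) ^ 2 * (agm N (1, 4 * exp (-l))).1 ∧
      (agm N (1, 4 * exp (-l))).1 ≤
        π / (2 * l) * (1 + 3 * exp (-π ^ 2 * 2 ^ N / (2 * l))) ^ 2 := by
  have hpi := pi_pos
  have hl0 : 0 < l := by linarith
  set t : ℝ := π / (2 * l) with ht
  have ht0 : 0 < t := by positivity
  have hti : t⁻¹ = 2 * l / π := by rw [ht, inv_div]
  have ht1 : 1 ≤ t⁻¹ := by
    rw [hti, le_div_iff₀ hpi]
    linarith [pi_le_four]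
  have hexp : -π * t⁻¹ = -2 * l := by
    rw [hti]
    field_simp
  have htn : 0 < t⁻¹ := by positivity
  have a1 := one_le_theta3 htn
  have a2 := theta3_le ht1
  obtain ⟨b1, b2⟩ := theta2_bounds ht1
  rw [hexp] at a2 b1 b2
  set κ := 3 * exp (-2 * l) with hκ
  have hκ0 : 0 < κ := by positivity
  have hsq : exp (-2 * l / 4) ^ 2 = exp (-l) := by
    rw [← exp_nat_mul]
    congr 1
    push_cast
    ring
  have he := exp_pos (-2 * l / 4)
  have hagm : agm N (theta3 t⁻¹ ^ 2, theta2 t⁻¹ ^ 2) =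
      (t * theta3 (2 ^ N * t) ^ 2, t * theta4 (2 ^ N * t) ^ 2) := by
    have h := agm_smul N ht0.le (theta3 t ^ 2, theta4 t ^ 2)
    rw [agm_theta N ht0] at h
    rw [← h]
    simp only
    rw [theta3_modular ht0, theta4_modular ht0]
    congr 2
    · field_simp
    · field_simp
  have hT : 1 ≤ 2 ^ N * t := by
    rw [ht, ← mul_div_assoc, le_div_iff₀ (by positivity)]
    linarith
  have c1 := one_le_theta3 (zero_lt_one.trans_le hT)
  have c2 := theta3_le hT
  have hexp2 : -π * (2 ^ N * t) = -π ^ 2 * 2 ^ N / (2 * l) := by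
    rw [ht]
    ring
  rw [hexp2] at c2
  have m1 : agm N (1, 4 * exp (-l)) ≤ agm N (theta3 t⁻¹ ^ 2, theta2 t⁻¹ ^ 2) := by
    refine agm_mono N zero_le_one (by simp only; positivity) ⟨?_, ?_⟩
    · simp only
      nlinarith
    · simp only
      nlinarith
  have m2 : agm N (theta3 t⁻¹ ^ 2, theta2 t⁻¹ ^ 2) ≤
      agm N ((1 + κ) ^ 2 * 1, (1 + κ) ^ 2 * (4 * exp (-l))) := by
    refine agm_mono N (sq_nonneg _) (sq_nonneg _) ⟨?_, ?_⟩
    · simp only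
      nlinarith
    · simp only
      rw [← hsq]
      calc theta2 t⁻¹ ^ 2 ≤ (2 * exp (-2 * l / 4) * (1 + κ)) ^ 2 :=
            pow_le_pow_left₀ (by linarith) b2 2
        _ = _ := by ring
  rw [agm_smul N (sq_nonneg _) (1, 4 * exp (-l)), hagm] at m2
  rw [hagm] at m1
  refine ⟨le_trans ?_ m2.1, m1.1.trans ?_⟩
  · simp only
    nlinarith [mul_le_mul_of_nonneg_left c1 ht0.le, sq_nonneg (theta3 (2 ^ N * t) - 1)]
  · simp only
    exact mul_le_mul_of_nonneg_left (pow_le_pow_left₀ (by linarith) c2 2) ht0.le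

end NetApprox

namespace NetApprox

open Real

/-! ### Logarithm and exponential by nested iterations -/

/-- The constant `4 e^{-2^{n+1}}` that multiplies the argument of the logarithm, to bring it into
the range where the arithmetic-geometric mean is governed by the logarithm. -/
noncomputable def agmScale (n : ℕ) : ℝ := 4 * exp (-2 ^ (n + 1))

/-- The approximate logarithm `2^{n+1} - π / (2 AGM(1, 4 e^{-2^{n+1}} y))`. -/
noncomputable def agmLog (n : ℕ) (y : ℝ) : ℝ :=
  2 ^ (n + 1) - π / 2 *
    (agmHeron (n + 3) (rootGuess (agmScale n)) (1, agmScale n * y) (2 * n + 3)).1⁻¹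

theorem abs_log_le {y : ℝ} (hy : 2 / 3 ≤ y) (hy' : y ≤ 3 / 2) : |log y| ≤ 1 / 2 := by
  have h1 := log_le_sub_one_of_pos (show 0 < y by linarith)
  have h2 := one_sub_inv_le_log_of_pos (show 0 < y by linarith)
  have h3 : y⁻¹ ≤ 3 / 2 := by
    rw [inv_le_comm₀ (by linarith) (by norm_num)]
    linarith
  rw [abs_le]
  constructor <;> linarith

theorem exp_neg_two_pow_le {n : ℕ} (hn : 3 ≤ n) : exp (-2 ^ n) ≤ 1 / 1000 := by
  have h1 : (8 : ℝ) ≤ 2 ^ n := by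
    calc (8 : ℝ) = 2 ^ 3 := by norm_num
      _ ≤ 2 ^ n := pow_le_pow_right₀ (by norm_num) hn
  have h2 : exp (-2 ^ n) ≤ exp (-8) := exp_le_exp.2 (by linarith)
  have h3 : exp (-8) = (exp 1 ^ 8)⁻¹ := by
    rw [exp_neg, ← exp_nat_mul]
    norm_num
  have h4 : (1000 : ℝ) ≤ exp 1 ^ 8 := by
    calc (1000 : ℝ) ≤ 2.7 ^ 8 := by norm_num
      _ ≤ exp 1 ^ 8 := pow_le_pow_left₀ (by norm_num) (by linarith [exp_one_gt_d9]) 8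
  rw [h3] at h2
  refine h2.trans ?_
  rw [inv_le_comm₀ (by positivity) (by norm_num)]
  simpa using h4

/-- The `2 n + 3` inexact square roots together cost a relative error of order `e^{-2^{n+2}}`. -/
theorem heron_defect_le {n : ℕ} (hn : 3 ≤ n) :
    (1 + (1 / 2 : ℝ) ^ 2 ^ (n + 3)) ^ (2 * n + 3) ≤ 1 + 8 * exp (-2 ^ n) ^ 4 := by
  set X : ℝ := 2 ^ n with hX
  have hX8 : 8 ≤ X := by
    calc (8 : ℝ) = 2 ^ 3 := by norm_num
      _ ≤ X := pow_le_pow_right₀ (by norm_num) hn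
  set q := exp (-X) with hq
  have hq0 : 0 < q := exp_pos _
  have hq1 : q ≤ 1 / 1000 := exp_neg_two_pow_le hn
  have hqX : X * q ≤ 1 := by
    rw [hq, exp_neg]
    rw [mul_inv_le_iff₀ (exp_pos _)]
    linarith [add_one_le_exp X]
  have hq5 : exp (-(5 * X)) = q ^ 5 := by
    rw [hq, ← exp_nat_mul]
    congr 1
    push_cast
    ring
  have hq4' : 0 < q ^ 4 := by positivity
  have hq4s : q ^ 4 ≤ 1 / 1000 := by
    calc q ^ 4 ≤ q := pow_le_of_le_one hq0.le (by linarith) (by norm_num)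
      _ ≤ _ := hq1
  set η : ℝ := (1 / 2) ^ 2 ^ (n + 3) with hη
  have hη0 : 0 < η := by positivity
  have hη5 : η ≤ q ^ 5 := by
    have h1 : η = exp (-(8 * X * log 2)) := by
      rw [hη, one_div, inv_pow, exp_neg, ← exp_log (show (0 : ℝ) < 2 ^ 2 ^ (n + 3) by positivity),
        log_pow]
      congr 3
      push_cast
      rw [hX]
      ring
    rw [h1, ← hq5]
    apply exp_le_exp.2
    nlinarith [log_two_gt_d9]
  have hNX : ((2 * n + 3 : ℕ) : ℝ) ≤ 4 * X := by
    have : n + 1 ≤ 2 ^ n := Nat.lt_two_pow_self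
    have h2 : ((n + 1 : ℕ) : ℝ) ≤ X := by
      rw [hX]
      exact_mod_cast this
    push_cast at h2 ⊢
    linarith
  have hNη : ((2 * n + 3 : ℕ) : ℝ) * η ≤ 4 * q ^ 4 := by
    calc ((2 * n + 3 : ℕ) : ℝ) * η ≤ (4 * X) * q ^ 5 := by gcongr
      _ = 4 * q ^ 4 * (X * q) := by ring
      _ ≤ 4 * q ^ 4 * 1 := by gcongr
      _ = _ := mul_one _
  have hpow : (1 + η) ^ (2 * n + 3) ≤ 1 + 8 * q ^ 4 := by
    have h1 : (1 + η) ^ (2 * n + 3) ≤ exp (((2 * n + 3 : ℕ) : ℝ) * η) := by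
      rw [exp_nat_mul]
      exact pow_le_pow_left₀ (by linarith) (by linarith [add_one_le_exp η]) _
    have h0 : 0 ≤ ((2 * n + 3 : ℕ) : ℝ) * η := by positivity
    have h2 := (abs_le.1 (abs_exp_sub_one_le (x := ((2 * n + 3 : ℕ) : ℝ) * η)
      (by rw [abs_of_nonneg h0]; linarith))).2
    rw [abs_of_nonneg h0] at h2
    linarith
  exact hpow

theorem inv_rel_bounds {A E l κ κ' p U : ℝ} (hA : 0 < A) (hE0 : 0 < E) (hl0 : 0 < l)
    (hp : 0 ≤ p) (b1 : E ≤ A) (b3 : A ≤ p * E) (c1 : π / (2 * l) ≤ (1 + κ) ^ 2 * E)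
    (c2 : E ≤ π / (2 * l) * (1 + κ') ^ 2) (u1 : (1 + κ) ^ 2 ≤ U) (u3 : (1 + κ') ^ 2 * p ≤ U) :
    π / 2 * A⁻¹ ≤ l * U ∧ l ≤ π / 2 * A⁻¹ * U := by
  have hU : 0 ≤ U := (sq_nonneg _).trans u1
  have hpi := pi_pos
  set r := π / 2 * A⁻¹ with hr
  have hrl : π / (2 * l) = r * A / l := by
    rw [hr]
    field_simp
  have hr0 : 0 < r := by positivity
  rw [hrl] at c1 c2
  constructor
  · have h1 : r * A / l ≤ U * A := c1.trans (mul_le_mul u1 b1 hE0.le hU)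
    rw [div_le_iff₀ hl0] at h1
    have h2 : r * A ≤ l * U * A := by linarith
    exact le_of_mul_le_mul_right h2 hA
  · have h1 : A ≤ r * A / l * U := by
      calc A ≤ p * E := b3
        _ ≤ p * (r * A / l * (1 + κ') ^ 2) := by gcongr
        _ = r * A / l * ((1 + κ') ^ 2 * p) := by ring
        _ ≤ _ := by gcongr
    rw [div_mul_eq_mul_div, le_div_iff₀ hl0] at h1
    have h2 : l * A ≤ r * U * A := by linarith
    exact le_of_mul_le_mul_right h2 hA

theorem one_add_sq_le {κ e a b : ℝ} (hκ0 : 0 ≤ κ) (hκ : κ ≤ a * e) (he : 0 ≤ e)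
    (he' : e ≤ 1 / 1000) (hab : 2 * a + a ^ 2 / 1000 ≤ b) : (1 + κ) ^ 2 ≤ 1 + b * e := by
  have h1 : κ ^ 2 ≤ (a * e) ^ 2 := pow_le_pow_left₀ hκ0 hκ 2
  have h2 : a ^ 2 * e * e ≤ a ^ 2 * e * (1 / 1000) := by gcongr
  have h3 := mul_le_mul_of_nonneg_right hab he
  linarith

theorem abs_sub_le_of_rel {X q l r : ℝ} (hX8 : 8 ≤ X) (hq0 : 0 ≤ q) (hq1 : q ≤ 1 / 1000)
    (hqX : X * q ≤ 1) (hl2 : l ≤ 3 * X)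
    (r1 : r ≤ l * (1 + 20 * q ^ 4)) (r2 : l ≤ r * (1 + 20 * q ^ 4)) : |l - r| ≤ q := by
  have hfin : 80 * X * q ^ 4 ≤ q := by
    have h3 : q ^ 2 ≤ 1 / 1000 := by
      rw [sq]
      nlinarith
    have h1 : 80 * X * q ^ 4 = 80 * q ^ 2 * (X * q) * q := by ring
    rw [h1]
    have h2 : 80 * q ^ 2 * (X * q) ≤ 1 := by
      calc 80 * q ^ 2 * (X * q) ≤ 80 * (1 / 1000) * 1 := by gcongr
        _ ≤ 1 := by norm_num
    nlinarith
  have hq4 : 0 ≤ q ^ 4 := by positivity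
  have hq4s : q ^ 4 ≤ 1 / 1000 := (pow_le_of_le_one hq0 (by linarith) (by norm_num)).trans hq1
  have hr : r ≤ 4 * X := by
    have : l * q ^ 4 ≤ 3 * X * (1 / 1000) := mul_le_mul hl2 hq4s hq4 (by linarith)
    linarith
  have h1 : l * q ^ 4 ≤ 3 * X * q ^ 4 := mul_le_mul_of_nonneg_right hl2 hq4
  have h2 : r * q ^ 4 ≤ 4 * X * q ^ 4 := mul_le_mul_of_nonneg_right hr hq4
  have h3 : 0 ≤ X * q ^ 4 := by positivity
  rw [abs_le]
  constructor <;> linarith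

/-- Accuracy of the iteration with `2 n + 3` steps and `n + 3` steps for each square root. -/
theorem agmLog_accuracy {n : ℕ} (hn : 3 ≤ n) {y : ℝ} (hy : 2 / 3 ≤ y) (hy' : y ≤ 3 / 2) :
    0 < (agmHeron (n + 3) (rootGuess (agmScale n)) (1, agmScale n * y) (2 * n + 3)).1 ∧
    |agmLog n y - log y| ≤ exp (-2 ^ n) ∧
    ∀ i ≤ 2 * n + 3,
      0 < (agmHeron (n + 3) (rootGuess (agmScale n)) (1, agmScale n * y) i).1 ∧
      0 < (agmHeron (n + 3) (rootGuess (agmScale n)) (1, agmScale n * y) i).2 := by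
  have hc : 0 < agmScale n := mul_pos four_pos (exp_pos _)
  have hy0 : 0 < y := by linarith
  have hlog := abs_le.1 (abs_log_le hy hy')
  set X : ℝ := 2 ^ n with hX
  have hX8 : 8 ≤ X := by
    calc (8 : ℝ) = 2 ^ 3 := by norm_num
      _ ≤ X := pow_le_pow_right₀ (by norm_num) hn
  set q := exp (-X) with hq
  have hq0 : 0 < q := exp_pos _
  have hq1 : q ≤ 1 / 1000 := exp_neg_two_pow_le hn
  have hqX : X * q ≤ 1 := by
    rw [hq, exp_neg]
    rw [mul_inv_le_iff₀ (exp_pos _)]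
    linarith [add_one_le_exp X]
  have hq4 : exp (-(4 * X)) = q ^ 4 := by
    rw [hq, ← exp_nat_mul]
    congr 1
    push_cast
    ring
  have hq4' : 0 < q ^ 4 := by positivity
  have hq4s : q ^ 4 ≤ 1 / 1000 := by
    calc q ^ 4 ≤ q := pow_le_of_le_one hq0.le (by linarith) (by norm_num)
      _ ≤ _ := hq1
  set η : ℝ := (1 / 2) ^ 2 ^ (n + 3) with hη
  have hη0 : 0 < η := by positivity
  have hpow : (1 + η) ^ (2 * n + 3) ≤ 1 + 8 * q ^ 4 := heron_defect_le hn
  have hbounds := agmHeron_bounds (j := n + 2) hc hy hy' hη (hpow.trans (by linarith))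
  have hpos : ∀ i ≤ 2 * n + 3,
      0 < (agmHeron (n + 3) (rootGuess (agmScale n)) (1, agmScale n * y) i).1 ∧
      0 < (agmHeron (n + 3) (rootGuess (agmScale n)) (1, agmScale n * y) i).2 := by
    intro i hi
    obtain ⟨p1, p2⟩ := agm_pos i (p := (1, agmScale n * y)) one_pos (by positivity)
    obtain ⟨h1, h2, -⟩ := hbounds i hi
    exact ⟨p1.trans_le h1, p2.trans_le h2⟩
  refine ⟨(hpos _ le_rfl).1, ?_, hpos⟩
  obtain ⟨b1, -, b3, -⟩ := hbounds _ le_rfl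
  have hA := (hpos _ le_rfl).1
  rw [agmLog]
  set A := (agmHeron (n + 3) (rootGuess (agmScale n)) (1, agmScale n * y) (2 * n + 3)).1 with hAdef
  set l : ℝ := 2 ^ (n + 1) - log y with hl
  have h2X : (2 : ℝ) ^ (n + 1) = 2 * X := by rw [hX, pow_succ]; ring
  rw [h2X] at hl ⊢
  have hl1 : 2 * X - 1 / 2 ≤ l := by linarith
  have hl2 : l ≤ 3 * X := by linarith
  have hscale : agmScale n * y = 4 * exp (-l) := by
    rw [agmScale, h2X, hl, show -(2 * X - log y) = -(2 * X) + log y by ring, exp_add, exp_log hy0]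
    ring
  have h2N : (2 : ℝ) ^ (2 * n + 3) = 8 * X ^ 2 := by
    rw [hX]
    ring
  obtain ⟨c1, c2⟩ := agm_log_bounds (l := l) (by linarith) (2 * n + 3) (by
    rw [h2N]
    nlinarith [pi_gt_three])
  rw [← hscale] at c1 c2
  rw [h2N] at c2
  have hκ : 3 * exp (-2 * l) ≤ 9 * q ^ 4 := by
    have : exp (-2 * l) ≤ exp 1 * exp (-(4 * X)) := by
      rw [← exp_add]
      exact exp_le_exp.2 (by linarith)
    rw [hq4] at this
    have h1 : exp 1 * q ^ 4 ≤ 3 * q ^ 4 :=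
      mul_le_mul_of_nonneg_right (by linarith [exp_one_lt_d9]) hq4'.le
    linarith
  have hκ' : 3 * exp (-π ^ 2 * (8 * X ^ 2) / (2 * l)) ≤ 3 * q ^ 4 := by
    rw [← hq4]
    refine mul_le_mul_of_nonneg_left (exp_le_exp.2 ?_) (by norm_num)
    rw [div_le_iff₀ (by linarith)]
    have h9 : 9 ≤ π ^ 2 := by nlinarith [pi_gt_three]
    have h10 : 9 * X ^ 2 ≤ π ^ 2 * X ^ 2 := mul_le_mul_of_nonneg_right h9 (sq_nonneg X)
    have h11 : X * l ≤ X * (3 * X) := mul_le_mul_of_nonneg_left hl2 (by linarith)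
    have h12 : 0 ≤ X ^ 2 := sq_nonneg X
    linarith
  set κ := 3 * exp (-2 * l) with hκd
  set κ' := 3 * exp (-π ^ 2 * (8 * X ^ 2) / (2 * l)) with hκd'
  have hκ0 : 0 < κ := by positivity
  have hκ0' : 0 < κ' := by positivity
  set E := (agm (2 * n + 3) (1, agmScale n * y)).1 with hE
  have hE0 : 0 < E := (agm_pos (2 * n + 3) (p := (1, agmScale n * y)) one_pos (by positivity)).1
  have hl0 : 0 < l := by linarith
  have hp0 : 0 ≤ (1 + η) ^ (2 * n + 3) := by positivity
  have u1 : (1 + κ) ^ 2 ≤ 1 + 20 * q ^ 4 :=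
    one_add_sq_le hκ0.le hκ hq4'.le hq4s (by norm_num)
  have u2 : (1 + κ') ^ 2 ≤ 1 + 7 * q ^ 4 :=
    one_add_sq_le hκ0'.le hκ' hq4'.le hq4s (by norm_num)
  have u3 : (1 + κ') ^ 2 * (1 + η) ^ (2 * n + 3) ≤ 1 + 20 * q ^ 4 := by
    calc _ ≤ (1 + 7 * q ^ 4) * (1 + 8 * q ^ 4) := by gcongr
      _ = 1 + (15 + 56 * q ^ 4) * q ^ 4 := by ring
      _ ≤ _ := by gcongr; linarith
  obtain ⟨r1, r2⟩ := inv_rel_bounds hA hE0 hl0 hp0 b1 b3 c1 c2 u1 u3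
  have e1 : 2 * X - π / 2 * A⁻¹ - log y = l - π / 2 * A⁻¹ := by rw [hl]; ring
  rw [e1]
  exact abs_sub_le_of_rel hX8 hq0.le hq1 hqX hl2 r1 r2

/-- Newton's iteration `y ↦ y (1 + x - log y)` for `e ^ x`, with the approximate logarithm. -/
noncomputable def expNewton (n : ℕ) (x : ℝ) : ℕ → ℝ
  | 0 => 1
  | m + 1 => expNewton n x m * (1 + x - agmLog n (expNewton n x m))

theorem abs_log_one_add_sub_le {z : ℝ} (hz : |z| ≤ 1 / 2) : |log (1 + z) - z| ≤ 2 * z ^ 2 := by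
  obtain ⟨h1, h2⟩ := abs_le.1 hz
  have h0 : 0 < 1 + z := by linarith
  have h3 := log_le_sub_one_of_pos h0
  have h4 := one_sub_inv_le_log_of_pos h0
  have h5 : (1 + z)⁻¹ ≤ 1 - z + 2 * z ^ 2 := by
    rw [inv_le_iff_one_le_mul₀ h0]
    nlinarith [mul_nonneg (sq_nonneg z) (show 0 ≤ 1 + 2 * z by linarith)]
  rw [abs_le]
  constructor <;> nlinarith [sq_nonneg z]

theorem expNewton_aux {n : ℕ} (hn : 3 ≤ n) {x : ℝ} (hx : |x| ≤ 1 / 16) (m : ℕ) :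
    2 / 3 ≤ expNewton n x m ∧ expNewton n x m ≤ 3 / 2 ∧
      |x - log (expNewton n x m)| ≤ 3 * exp (-2 ^ n) + 1 / 2 * (1 / 8) ^ 2 ^ m := by
  set η := exp (-2 ^ n) with hη
  have hη0 : 0 < η := exp_pos _
  have hη1 : η ≤ 1 / 1000 := exp_neg_two_pow_le hn
  -- the bound on the error of the logarithm keeps the iterate in `[2/3, 3/2]`
  have range : ∀ y : ℝ, 0 < y → |x - log y| ≤ 3 * η + 1 / 16 → 2 / 3 ≤ y ∧ y ≤ 3 / 2 := by
    intro y hy h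
    obtain ⟨h1, h2⟩ := abs_le.1 h
    obtain ⟨h3, h4⟩ := abs_le.1 hx
    have h5 := add_one_le_exp (log y)
    have h6 := add_one_le_exp (-log y)
    rw [exp_neg, exp_log hy] at h6
    rw [exp_log hy] at h5
    constructor
    · linarith
    · have h7 : 2 / 3 ≤ y⁻¹ := by linarith
      rw [le_inv_comm₀ (by norm_num) hy] at h7
      linarith
  have hu : ∀ m : ℕ, 1 / 2 * (1 / 8 : ℝ) ^ 2 ^ m ≤ 1 / 16 := by
    intro m
    have : (1 / 8 : ℝ) ^ 2 ^ m ≤ 1 / 8 :=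
      pow_le_of_le_one (by norm_num) (by norm_num) (by positivity)
    linarith
  suffices 0 < expNewton n x m ∧
      |x - log (expNewton n x m)| ≤ 3 * η + 1 / 2 * (1 / 8) ^ 2 ^ m by
    obtain ⟨h1, h2⟩ := range _ this.1 (this.2.trans (by linarith [hu m]))
    exact ⟨h1, h2, this.2⟩
  induction m with
  | zero =>
    simp only [expNewton, log_one, sub_zero, pow_zero, pow_one]
    exact ⟨one_pos, by linarith⟩
  | succ m ih =>
    obtain ⟨hy0, hy⟩ := ih
    obtain ⟨h1, h2⟩ := range _ hy0 (hy.trans (by linarith [hu m]))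
    have hlog := (agmLog_accuracy hn h1 h2).2.1
    rw [← hη] at hlog
    rw [expNewton]
    set y := expNewton n x m with hyd
    set u : ℝ := 1 / 2 * (1 / 8) ^ 2 ^ m with hud
    have hu0 : 0 < u := by positivity
    have hu1 : u ≤ 1 / 16 := hu m
    have hus : 1 / 2 * (1 / 8 : ℝ) ^ 2 ^ (m + 1) = 2 * u ^ 2 := by
      rw [hud, pow_succ 2 m, pow_mul]
      ring
    set z := x - agmLog n y with hz
    have hz1 : |z| ≤ 4 * η + u := by
      have : z = (x - log y) - (agmLog n y - log y) := by rw [hz]; ring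
      rw [this]
      refine (abs_sub _ _).trans ?_
      linarith
    have hzz : |z| ≤ 1 / 2 := by linarith
    have hpos : 0 < 1 + z := by linarith [(abs_le.1 hzz).1]
    have hL := abs_log_one_add_sub_le hzz
    have e1 : 1 + x - agmLog n y = 1 + z := by rw [hz]; ring
    rw [e1]
    refine ⟨mul_pos hy0 hpos, ?_⟩
    rw [log_mul hy0.ne' hpos.ne', hus]
    have e2 : x - (log y + log (1 + z)) = (agmLog n y - log y) - (log (1 + z) - z) := by
      rw [hz]
      ring
    rw [e2]
    refine (abs_sub _ _).trans ?_
    have hz2 : z ^ 2 ≤ (4 * η + u) ^ 2 := by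
      rw [← sq_abs]
      exact pow_le_pow_left₀ (abs_nonneg _) hz1 2
    nlinarith

theorem expNewton_accuracy {n : ℕ} (hn : 3 ≤ n) {x : ℝ} (hx : |x| ≤ 1 / 16) :
    |x - log (expNewton n x n)| ≤ 4 * exp (-2 ^ n) := by
  refine (expNewton_aux hn hx n).2.2.trans ?_
  have h1 : (1 / 8 : ℝ) ^ 2 ^ n ≤ exp (-2 ^ n) := by
    have h2 : exp (-2 ^ n) = exp (-1) ^ 2 ^ n := by
      rw [← exp_nat_mul]
      congr 1
      push_cast
      ring
    rw [h2]
    refine pow_le_pow_left₀ (by norm_num) ?_ _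
    rw [exp_neg, le_inv_comm₀ (by norm_num) (exp_pos _)]
    linarith [exp_one_lt_d9]
  linarith [exp_pos (-2 ^ n)]

end NetApprox

namespace NetApprox

open Real

/-! ### Rational gadgets for the sigmoid activations -/

theorem isGadget_of_instrs {A : Type} {r : ℕ} [NeZero r] {ev : A → ℝ → ℝ} {good : A → ℝ → Prop}
    {idA sqA : A} (hA : IdSq ev good idA sqA) {δ : ℝ} {f : ℝ → ℝ} {l : List (Instr A r)}
    (hl : ∀ t ∈ Set.Icc (-1 : ℝ) 1, Instr.Oks ev good l (Pi.single 0 t) ∧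
      |Instr.runs ev l (Pi.single 0 t) 0| ≤ 1 ∧ |Instr.runs ev l (Pi.single 0 t) 0 - f t| ≤ δ) :
    IsGadget ev good δ f (Instr.compiles idA sqA l) := by
  intro t ht
  have h0 : (0 : Fin (r + 2)) = Fin.castAdd 2 (0 : Fin r) := Fin.ext (Fin.val_zero r).symm
  have hstart : (Pi.single 0 t : Fin (r + 2) → ℝ) = Fin.append (Pi.single (0 : Fin r) t) 0 := by
    funext p
    refine Fin.addCases (fun q => ?_) (fun q => ?_) p
    · rw [Fin.append_left, Pi.single_apply, Pi.single_apply]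
      exact if_congr (by rw [h0, Fin.castAdd_inj]) rfl rfl
    · rw [Fin.append_right, Pi.single_apply, if_neg]
      · rfl
      · rw [Fin.ext_iff, Fin.val_natAdd]
        have := NeZero.pos r
        change ¬ r + (q : ℕ) = 0
        omega
  obtain ⟨h1, h2⟩ := hl t ht
  obtain ⟨⟨t', h3⟩, h4⟩ := Instr.compiles_spec hA l _ 0 h1
  rw [hstart, h3, h0, Fin.append_left]
  exact ⟨h4, h2⟩

namespace RatProg

open Polynomial

/-- The polynomial activation `p`. -/
noncomputable def polyAct (p : ℝ[X]) : RatAct := ⟨p, 1⟩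

/-- The activation `t ↦ 1 / t`. -/
noncomputable def invAct : RatAct := ⟨1, X⟩

/-- The activation `t ↦ t ^ N / (1 + t ^ N)`, which turns `e ^ (u / N)` into the sigmoid of `u`. -/
noncomputable def powSigAct (N : ℕ) : RatAct := ⟨X ^ N, 1 + X ^ N⟩

/-- The argument `t` is not a pole of the activation. -/
def NoPole (r : RatAct) (t : ℝ) : Prop := r.den.eval t ≠ 0

@[simp] theorem eval_polyAct (p : ℝ[X]) (t : ℝ) : (polyAct p).eval t = p.eval t := by
  simp [polyAct, RatAct.eval]

@[simp] theorem noPole_polyAct (p : ℝ[X]) (t : ℝ) : NoPole (polyAct p) t := by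
  simp [polyAct, NoPole]

@[simp] theorem eval_invAct (t : ℝ) : invAct.eval t = t⁻¹ := by
  simp [invAct, RatAct.eval]

@[simp] theorem noPole_invAct (t : ℝ) : NoPole invAct t ↔ t ≠ 0 := by
  simp [invAct, NoPole]

theorem idSq : IdSq RatAct.eval NoPole (polyAct X) (polyAct (X ^ 2)) :=
  ⟨by simp, by simp, by simp, by simp⟩

/-- Register `7` is scratch space; one step of Heron's iteration in register `6` for the square
root of register `5`. -/
noncomputable def heronProg : List (Instr RatAct 8) :=
  [.upd 7 (Pi.single 6 1) 0 invAct, .mul 7 7 5,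
    .upd 6 (Pi.single 6 (1 / 2) + Pi.single 7 (1 / 2)) 0 (polyAct X)]

theorem heronProg_spec (s : Fin 8 → ℝ) (h : s 6 ≠ 0) :
    Instr.Oks RatAct.eval NoPole heronProg s ∧
    Instr.runs RatAct.eval heronProg s 6 = (s 6 + s 5 / s 6) / 2 ∧
    ∀ p, p ≠ 6 → p ≠ 7 → Instr.runs RatAct.eval heronProg s p = s p := by
  refine ⟨?_, ?_, fun p h6 h7 => ?_⟩
  · simp [heronProg, Instr.Oks, Instr.Ok, Pi.single_apply, h]
  · simp [heronProg, Instr.runs, Instr.run, Pi.single_apply, add_mul, Finset.sum_add_distrib]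
    field_simp
  · simp [heronProg, Instr.runs, Instr.run, h6, h7]

/-- `j` steps of Heron's iteration. -/
noncomputable def heronProgs : ℕ → List (Instr RatAct 8)
  | 0 => []
  | j + 1 => heronProgs j ++ heronProg

theorem heronProgs_spec (s : Fin 8 → ℝ) (h5 : 0 < s 5) (h6 : 0 < s 6) (j : ℕ) :
    Instr.Oks RatAct.eval NoPole (heronProgs j) s ∧
    Instr.runs RatAct.eval (heronProgs j) s 6 = heron (s 5) j (s 6) ∧
    ∀ p, p ≠ 6 → p ≠ 7 → Instr.runs RatAct.eval (heronProgs j) s p = s p := by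
  induction j with
  | zero => exact ⟨trivial, rfl, fun _ _ _ => rfl⟩
  | succ j ih =>
    obtain ⟨h1, h2, h3⟩ := ih
    obtain ⟨k1, k2, k3⟩ := heronProg_spec (Instr.runs RatAct.eval (heronProgs j) s) (by
      rw [h2]
      exact (heron_pos h5 h6 j).ne')
    rw [heronProgs, Instr.oks_append, Instr.runs_append]
    refine ⟨⟨h1, k1⟩, ?_, fun p p6 p7 => ?_⟩
    · rw [k2, h2, h3 5 (by decide) (by decide), heron]
    · rw [k3 p p6 p7, h3 p p6 p7]

/-- One step of the arithmetic-geometric mean iteration in registers `3` and `4`, where the square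
root is computed by `j` steps of Heron's iteration from the constant `g`. -/
noncomputable def agmProg (j : ℕ) (g : ℝ) : List (Instr RatAct 8) :=
  [.mul 5 3 4, .upd 6 0 g (polyAct X)] ++ heronProgs j ++
    [.upd 3 (Pi.single 3 (1 / 2) + Pi.single 4 (1 / 2)) 0 (polyAct X),
      .upd 4 (Pi.single 6 1) 0 (polyAct X)]

theorem agmProg_spec (j : ℕ) {g : ℝ} (hg : 0 < g) (s : Fin 8 → ℝ) (h3 : 0 < s 3) (h4 : 0 < s 4) :
    Instr.Oks RatAct.eval NoPole (agmProg j g) s ∧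
    Instr.runs RatAct.eval (agmProg j g) s 3 = (s 3 + s 4) / 2 ∧
    Instr.runs RatAct.eval (agmProg j g) s 4 = heron (s 3 * s 4) j g ∧
    ∀ p < 3, Instr.runs RatAct.eval (agmProg j g) s p = s p := by
  set s' := Instr.runs RatAct.eval
    ([.mul 5 3 4, .upd 6 0 g (polyAct X)] : List (Instr RatAct 8)) s with hs'
  have e5 : s' 5 = s 3 * s 4 := by simp [hs', Instr.runs, Instr.run]
  have e6 : s' 6 = g := by simp [hs', Instr.runs, Instr.run]
  have ep : ∀ p, p ≠ 5 → p ≠ 6 → s' p = s p := by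
    intro p h5 h6
    simp [hs', Instr.runs, Instr.run, h5, h6]
  obtain ⟨k1, k2, k3⟩ := heronProgs_spec s' (by rw [e5]; positivity) (by rwa [e6]) j
  rw [e5, e6] at k2
  simp only [agmProg, Instr.oks_append, Instr.runs_append]
  rw [← hs']
  set s'' := Instr.runs RatAct.eval (heronProgs j) s'
  have e3 : s'' 3 = s 3 := by rw [k3 3 (by decide) (by decide), ep 3 (by decide) (by decide)]
  have e4 : s'' 4 = s 4 := by rw [k3 4 (by decide) (by decide), ep 4 (by decide) (by decide)]
  refine ⟨⟨⟨?_, k1⟩, ?_⟩, ?_, ?_, fun p hp => ?_⟩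
  · simp [Instr.Oks, Instr.Ok]
  · simp [Instr.Oks, Instr.Ok]
  · simp [Instr.runs, Instr.run, Pi.single_apply, add_mul, Finset.sum_add_distrib, e3, e4]
    ring
  · simp [Instr.runs, Instr.run, Pi.single_apply, k2]
  · have h0 : p ≠ 3 ∧ p ≠ 4 ∧ p ≠ 5 ∧ p ≠ 6 ∧ p ≠ 7 := by
      revert hp
      revert p
      decide
    obtain ⟨p3, p4, p5, p6, p7⟩ := h0
    simp [Instr.runs, Instr.run, p3, p4, k3 p p6 p7, ep p p5 p6]

/-- `N` steps of the arithmetic-geometric mean iteration. -/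
noncomputable def agmProgs (j : ℕ) (g : ℕ → ℝ) : ℕ → List (Instr RatAct 8)
  | 0 => []
  | i + 1 => agmProgs j g i ++ agmProg j (g i)

theorem agmProgs_spec (j : ℕ) {g : ℕ → ℝ} (hg : ∀ i, 0 < g i) (s : Fin 8 → ℝ) {N : ℕ}
    (hpos : ∀ i ≤ N, 0 < (agmHeron j g (s 3, s 4) i).1 ∧ 0 < (agmHeron j g (s 3, s 4) i).2)
    (i : ℕ) (hi : i ≤ N) :
    Instr.Oks RatAct.eval NoPole (agmProgs j g i) s ∧
    Instr.runs RatAct.eval (agmProgs j g i) s 3 = (agmHeron j g (s 3, s 4) i).1 ∧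
    Instr.runs RatAct.eval (agmProgs j g i) s 4 = (agmHeron j g (s 3, s 4) i).2 ∧
    ∀ p < 3, Instr.runs RatAct.eval (agmProgs j g i) s p = s p := by
  induction i with
  | zero => exact ⟨trivial, rfl, rfl, fun _ _ => rfl⟩
  | succ i ih =>
    obtain ⟨h1, h2, h3, h4⟩ := ih (by omega)
    obtain ⟨p1, p2⟩ := hpos i (by omega)
    obtain ⟨k1, k2, k3, k4⟩ := agmProg_spec j (hg i) (Instr.runs RatAct.eval (agmProgs j g i) s)
      (by rwa [h2]) (by rwa [h3])
    rw [agmProgs, Instr.oks_append, Instr.runs_append]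
    refine ⟨⟨h1, k1⟩, ?_, ?_, fun p hp => ?_⟩
    · rw [k2, h2, h3, agmHeron]
    · rw [k3, h2, h3, agmHeron]
    · rw [k4 p hp, h4 p hp]

/-- One step of Newton's iteration for the exponential of register `1` in register `2`. -/
noncomputable def newtonProg (n : ℕ) : List (Instr RatAct 8) :=
  [.upd 3 0 1 (polyAct X), .upd 4 (Pi.single 2 (agmScale n)) 0 (polyAct X)] ++
    agmProgs (n + 3) (rootGuess (agmScale n)) (2 * n + 3) ++
    [.upd 7 (Pi.single 3 1) 0 invAct,
      .upd 7 (Pi.single 1 1 + Pi.single 7 (π / 2)) (1 - 2 ^ (n + 1)) (polyAct X), .mul 2 2 7]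

theorem newtonProg_spec {n : ℕ} (hn : 3 ≤ n) (s : Fin 8 → ℝ) (h : 2 / 3 ≤ s 2)
    (h' : s 2 ≤ 3 / 2) :
    Instr.Oks RatAct.eval NoPole (newtonProg n) s ∧
    Instr.runs RatAct.eval (newtonProg n) s 0 = s 0 ∧
    Instr.runs RatAct.eval (newtonProg n) s 1 = s 1 ∧
    Instr.runs RatAct.eval (newtonProg n) s 2 = s 2 * (1 + s 1 - agmLog n (s 2)) := by
  set s' := Instr.runs RatAct.eval ([.upd 3 0 1 (polyAct X),
    .upd 4 (Pi.single 2 (agmScale n)) 0 (polyAct X)] : List (Instr RatAct 8)) s with hs'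
  have e3 : s' 3 = 1 := by simp [hs', Instr.runs, Instr.run]
  have e4 : s' 4 = agmScale n * s 2 := by simp [hs', Instr.runs, Instr.run, Pi.single_apply]
  have ep : ∀ p < 3, s' p = s p := by
    intro p hp
    have h0 : p ≠ 3 ∧ p ≠ 4 := by
      revert hp
      revert p
      decide
    simp [hs', Instr.runs, Instr.run, h0.1, h0.2]
  obtain ⟨hA, -, hpos⟩ := agmLog_accuracy hn h h'
  have hsc : 0 < agmScale n := mul_pos four_pos (exp_pos _)
  obtain ⟨k1, k2, -, k4⟩ := agmProgs_spec (n + 3) (rootGuess_pos hsc) s' (N := 2 * n + 3)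
    (by rwa [e3, e4]) (2 * n + 3) le_rfl
  rw [e3, e4] at k2
  simp only [newtonProg, Instr.oks_append, Instr.runs_append]
  rw [← hs']
  set s'' := Instr.runs RatAct.eval (agmProgs (n + 3) (rootGuess (agmScale n)) (2 * n + 3)) s'
  refine ⟨⟨⟨?_, k1⟩, ?_⟩, ?_, ?_, ?_⟩
  · simp [Instr.Oks, Instr.Ok]
  · simp [Instr.Oks, Instr.Ok, Pi.single_apply, k2, hA.ne']
  · simp [Instr.runs, Instr.run, k4 0 (by decide), ep 0 (by decide)]
  · simp [Instr.runs, Instr.run, k4 1 (by decide), ep 1 (by decide)]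
  · simp [Instr.runs, Instr.run, Pi.single_apply, add_mul, Finset.sum_add_distrib,
      k4 1 (by decide), ep 1 (by decide), k4 2 (by decide), ep 2 (by decide), k2, agmLog]
    left
    ring

/-- `m` steps of Newton's iteration. -/
noncomputable def newtonProgs (n : ℕ) : ℕ → List (Instr RatAct 8)
  | 0 => []
  | m + 1 => newtonProgs n m ++ newtonProg n

theorem newtonProgs_spec {n : ℕ} (hn : 3 ≤ n) (s : Fin 8 → ℝ) (h1 : |s 1| ≤ 1 / 16)
    (h2 : s 2 = 1) (m : ℕ) :
    Instr.Oks RatAct.eval NoPole (newtonProgs n m) s ∧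
    Instr.runs RatAct.eval (newtonProgs n m) s 0 = s 0 ∧
    Instr.runs RatAct.eval (newtonProgs n m) s 1 = s 1 ∧
    Instr.runs RatAct.eval (newtonProgs n m) s 2 = expNewton n (s 1) m := by
  induction m with
  | zero => exact ⟨trivial, rfl, rfl, h2⟩
  | succ m ih =>
    obtain ⟨i1, i2, i3, i4⟩ := ih
    obtain ⟨r1, r2, -⟩ := expNewton_aux hn h1 m
    obtain ⟨k1, k2, k3, k4⟩ := newtonProg_spec hn (Instr.runs RatAct.eval (newtonProgs n m) s)
      (by rwa [i4]) (by rwa [i4])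
    rw [newtonProgs, Instr.oks_append, Instr.runs_append]
    refine ⟨⟨i1, k1⟩, k2.trans i2, k3.trans i3, ?_⟩
    rw [k4, i3, i4, expNewton]

/-- The program for `x ↦ x * sigmoid (P x)`, by way of the exponential of `P x / N`. -/
noncomputable def sigmoidProg (P : ℝ[X]) (N n : ℕ) : List (Instr RatAct 8) :=
  [.upd 1 (Pi.single 0 1) 0 (polyAct (C (N : ℝ)⁻¹ * P)), .upd 2 0 1 (polyAct X)] ++
    newtonProgs n n ++ [.upd 7 (Pi.single 2 1) 0 (powSigAct N), .mul 0 0 7]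

theorem sigmoidProg_spec (P : ℝ[X]) (N : ℕ) {n : ℕ} (hn : 3 ≤ n) (s : Fin 8 → ℝ)
    (h : |P.eval (s 0) / N| ≤ 1 / 16) :
    Instr.Oks RatAct.eval NoPole (sigmoidProg P N n) s ∧
    Instr.runs RatAct.eval (sigmoidProg P N n) s 0 =
      s 0 * sigmoid (N * log (expNewton n (P.eval (s 0) / N) n)) := by
  set s' := Instr.runs RatAct.eval ([.upd 1 (Pi.single 0 1) 0 (polyAct (C (N : ℝ)⁻¹ * P)),
    .upd 2 0 1 (polyAct X)] : List (Instr RatAct 8)) s with hs'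
  have e0 : s' 0 = s 0 := by simp [hs', Instr.runs, Instr.run]
  have e1 : s' 1 = P.eval (s 0) / N := by
    simp [hs', Instr.runs, Instr.run, Pi.single_apply]
    ring
  have e2 : s' 2 = 1 := by simp [hs', Instr.runs, Instr.run]
  obtain ⟨k1, k2, -, k4⟩ := newtonProgs_spec hn s' (by rwa [e1]) e2 n
  obtain ⟨r1, -, -⟩ := expNewton_aux hn h n
  rw [e1] at k4
  rw [e0] at k2
  simp only [sigmoidProg, Instr.oks_append, Instr.runs_append]
  rw [← hs']
  set s'' := Instr.runs RatAct.eval (newtonProgs n n) s'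
  set y := expNewton n (P.eval (s 0) / N) n
  have hy : 0 < y := by linarith
  have hN : 0 < 1 + y ^ N := by positivity
  refine ⟨⟨⟨?_, k1⟩, ?_⟩, ?_⟩
  · simp [Instr.Oks, Instr.Ok]
  · simp [Instr.Oks, Instr.Ok, Pi.single_apply, NoPole, powSigAct, k4, hN.ne']
  · have hsig : sigmoid (N * log y) = y ^ N / (1 + y ^ N) := by
      rw [sigmoid_def, ← mul_neg, exp_nat_mul, exp_neg, exp_log hy, inv_pow]
      field_simp
      ring
    rw [hsig]
    simp [Instr.runs, Instr.run, Pi.single_apply, k2, k4, powSigAct, RatAct.eval]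

theorem length_heronProgs (j : ℕ) : (heronProgs j).length = 3 * j := by
  induction j with
  | zero => rfl
  | succ j ih =>
    rw [heronProgs, List.length_append, ih]
    rfl

theorem length_agmProgs (j : ℕ) (g : ℕ → ℝ) (i : ℕ) :
    (agmProgs j g i).length = i * (3 * j + 4) := by
  induction i with
  | zero => simp [agmProgs]
  | succ i ih =>
    rw [agmProgs, List.length_append, ih]
    simp only [agmProg, List.length_append, List.length_cons, List.length_nil, length_heronProgs]
    ring

theorem length_newtonProgs (n m : ℕ) :
    (newtonProgs n m).length = m * (5 + (2 * n + 3) * (3 * (n + 3) + 4)) := by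
  induction m with
  | zero => simp [newtonProgs]
  | succ i ih =>
    rw [newtonProgs, List.length_append, ih]
    simp only [newtonProg, List.length_append, List.length_cons, List.length_nil, length_agmProgs]
    ring

theorem length_sigmoidProg (P : ℝ[X]) (N : ℕ) {n : ℕ} (hn : 3 ≤ n) :
    (sigmoidProg P N n).length = 4 + n * (5 + (2 * n + 3) * (3 * (n + 3) + 4)) ∧
      4 + n * (5 + (2 * n + 3) * (3 * (n + 3) + 4)) ≤ 26 * n ^ 3 := by
  constructor
  · simp only [sigmoidProg, List.length_append, List.length_cons, List.length_nil,
      length_newtonProgs]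
    ring
  · obtain ⟨m, rfl⟩ := Nat.exists_eq_add_of_le hn
    ring_nf
    nlinarith [Nat.zero_le (m ^ 3), Nat.zero_le (m ^ 2)]

theorem forall_mem_append {α : Type} {p : α → Prop} {l l' : List α} (h : ∀ a ∈ l, p a)
    (h' : ∀ a ∈ l', p a) : ∀ a ∈ l ++ l', p a := by
  intro a ha
  rcases List.mem_append.1 ha with h1 | h1
  exacts [h a h1, h' a h1]

theorem degree_sigmoidProg (P : ℝ[X]) (N n D : ℕ) (h1 : 1 ≤ D) (hP : P.natDegree ≤ D)
    (hN : N ≤ D) : ∀ I ∈ sigmoidProg P N n, I.ActProp (RatAct.DegreeLE D) := by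
  have hid : (polyAct X).DegreeLE D := by
    simpa [polyAct, RatAct.DegreeLE] using h1
  have hinv : invAct.DegreeLE D := by
    simpa [invAct, RatAct.DegreeLE] using h1
  have hpow : (powSigAct N).DegreeLE D := by
    refine ⟨by simpa [powSigAct] using hN, ?_⟩
    refine (natDegree_add_le _ _).trans ?_
    simpa [powSigAct] using hN
  have hpol : (polyAct (C (N : ℝ)⁻¹ * P)).DegreeLE D :=
    ⟨(natDegree_C_mul_le _ _).trans hP, by simp [polyAct]⟩
  have hher : ∀ j, ∀ I ∈ heronProgs j, I.ActProp (RatAct.DegreeLE D) := by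
    intro j
    induction j with
    | zero => simp [heronProgs]
    | succ j ih => exact forall_mem_append ih (by simp [heronProg, Instr.ActProp, hid, hinv])
  have hagm : ∀ j g i, ∀ I ∈ agmProgs j g i, I.ActProp (RatAct.DegreeLE D) := by
    intro j g i
    induction i with
    | zero => simp [agmProgs]
    | succ i ih =>
      exact forall_mem_append ih (forall_mem_append (forall_mem_append
        (by simp [Instr.ActProp, hid]) (hher j)) (by simp [Instr.ActProp, hid]))
  have hnew : ∀ m, ∀ I ∈ newtonProgs n m, I.ActProp (RatAct.DegreeLE D) := by
    intro m
    induction m with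
    | zero => simp [newtonProgs]
    | succ i ih =>
      exact forall_mem_append ih (forall_mem_append (forall_mem_append
        (by simp [Instr.ActProp, hid]) (hagm _ _ _)) (by simp [Instr.ActProp, hid, hinv]))
  exact forall_mem_append (forall_mem_append (by simp [Instr.ActProp, hid, hpol]) (hnew n))
    (by simp [Instr.ActProp, hpow])

theorem abs_sigmoid_sub_le (a b : ℝ) : |sigmoid a - sigmoid b| ≤ |a - b| := by
  have h := Convex.norm_image_sub_le_of_norm_deriv_le (f := sigmoid) (C := 1) (s := Set.univ)
    (fun x _ => differentiable_sigmoid x) (fun x _ => by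
      have h0 := sigmoid_nonneg x
      have h1 := sigmoid_le_one x
      rw [deriv_sigmoid, norm_eq_abs, abs_of_nonneg (mul_nonneg h0 (by linarith))]
      nlinarith) convex_univ (Set.mem_univ b) (Set.mem_univ a)
  simpa using h

/-- Gadgets for `x ↦ x * sigmoid (P x)` of length `O(n³)`, bounded degree and accuracy
`O(e^{-2^n})`. The product form bounds the values by `1`: the computed number is exactly
`x * sigmoid (u)` with an approximation `u` of `P x`. -/
theorem isGadget_sigmoidProg (P : ℝ[X]) {N : ℕ} (hN : 1 ≤ N)
    (hP : ∀ t ∈ Set.Icc (-1 : ℝ) 1, |P.eval t| ≤ N / 16) {n : ℕ} (hn : 3 ≤ n) :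
    IsGadget RatAct.eval NoPole (4 * N * exp (-2 ^ n)) (fun t => t * sigmoid (P.eval t))
      (Instr.compiles (polyAct X) (polyAct (X ^ 2)) (sigmoidProg P N n)) := by
  refine isGadget_of_instrs idSq fun t ht => ?_
  have hN0 : (0 : ℝ) < N := by exact_mod_cast hN
  have h0 : (Pi.single 0 t : Fin 8 → ℝ) 0 = t := by simp
  have h1 : |P.eval t / N| ≤ 1 / 16 := by
    rw [abs_div, abs_of_pos hN0, div_le_iff₀ hN0]
    linarith [hP t ht]
  obtain ⟨k1, k2⟩ := sigmoidProg_spec P N hn (Pi.single 0 t) (by rwa [h0])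
  rw [h0] at k2
  have ht' : |t| ≤ 1 := abs_le.2 ht
  refine ⟨k1, ?_, ?_⟩
  · rw [k2, abs_mul, abs_of_nonneg (sigmoid_nonneg _)]
    exact mul_le_one₀ ht' (sigmoid_nonneg _) (sigmoid_le_one _)
  · rw [k2, ← mul_sub, abs_mul]
    have h2 := abs_sigmoid_sub_le (N * log (expNewton n (P.eval t / N) n)) (P.eval t)
    have h3 := expNewton_accuracy hn h1
    have h4 : N * log (expNewton n (P.eval t / N) n) - P.eval t =
        -(N * (P.eval t / N - log (expNewton n (P.eval t / N) n))) := by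
      field_simp
      ring
    rw [h4, abs_neg, abs_mul, abs_of_pos hN0] at h2
    have h5 := mul_le_mul_of_nonneg_left h3 hN0.le
    have h6 := mul_le_mul ht' h2 (abs_nonneg _) zero_le_one
    linarith

end RatProg

end NetApprox

namespace NetApprox

open Real

/-- The simulation of `exists_simulation` for a whole network with its output map. -/
theorem exists_simulation_net {A B : Type} {d k w T : ℕ} [NeZero w] {ev : A → ℝ → ℝ}
    {good : A → ℝ → Prop} {idA : A} {P : A → Prop} (evB : B → ℝ → ℝ) {Good : B → Prop} {L δ : ℝ}
    (gad : B → List (Step A w)) (hid : ∀ t, ev idA t = t) (gid : ∀ t, good idA t)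
    (Pid : P idA) (hL : 0 ≤ L) (hδ : 0 ≤ δ)
    (hgad : ∀ a, Good a → (gad a).length = T ∧ (∀ st ∈ gad a, ∀ p, P (st.act p)) ∧
      IsGadget ev good δ (evB a) (gad a))
    (hB : ∀ a, Good a → ∀ s ∈ Set.Icc (-1 : ℝ) 1, |evB a s| ≤ 1 ∧
      ∀ t ∈ Set.Icc (-1 : ℝ) 1, |evB a s - evB a t| ≤ L * |s - t|)
    (N : Net B d) (hk : N.WidthLE k) (hN : N.Normalized) (hG : N.ForallAct Good) :
    ∃ R : Net A d, R.units ≤ N.depth * (k * w * (T + 1)) ∧ R.WidthLE (k * w) ∧ R.ForallAct P ∧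
      ∀ x ∈ cube d, R.hidden.ForallPreact ev good x ∧ |R.eval ev x| ≤ 1 ∧
        |N.eval evB x - R.eval ev x| ≤ δ * geomS N.depth L := by
  obtain ⟨n', H', ι, h1, h2, h3, h4⟩ :=
    exists_simulation evB gad hid gid Pid hL hδ hgad hB N.hidden hk hN.1 hG
  refine ⟨⟨H', fun l => ∑ j, if ι j = l then N.outW j else 0, N.outB⟩, h1, h2, h3,
    fun x hx => ?_⟩
  obtain ⟨h5, h6⟩ := h4 x hx
  simp only [Net.eval, sum_sum_ite_mul]
  exact ⟨h5, abs_affine_le_one _ _ _ hN.2 fun j => (h6 j).1,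
    abs_affine_sub_le _ _ _ _ hN.2 (mul_nonneg hδ (geomS_nonneg _ hL)) fun j => (h6 j).2.2⟩

/-- Parameters of a network of width at most `k w` in terms of its size. -/
theorem net_params_le {A : Type} {d k w c : ℕ} (cost : A → ℕ) (R : Net A d) (hk : 1 ≤ k)
    (hw : 1 ≤ w) (hR : R.WidthLE (k * w)) (hc : R.ForallAct fun a => cost a ≤ c) :
    R.params cost ≤ (w + 1 + c) * (d + k) * (R.units + 1) := by
  obtain ⟨h1, h2⟩ := params_le cost R.hidden hR hc
  have h3 : max d (k * w) + 1 + c ≤ (w + 1 + c) * (d + k) := by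
    have h4 : max d (k * w) ≤ w * (d + k) := by
      apply max_le
      · nlinarith
      · nlinarith
    nlinarith
  have h5 : R.hidden.units * (max d (k * w) + 1 + c) ≤
      R.hidden.units * ((w + 1 + c) * (d + k)) := Nat.mul_le_mul_left _ h3
  have h6 : R.lastWidth + 1 ≤ (w + 1 + c) * (d + k) := by omega
  simp only [Net.params, Net.units]
  linarith

/-! ### Sigmoid networks by rational networks -/

theorem gelu_eq (x : ℝ) :
    gelu x = x * sigmoid (2 * (√(2 / π) * (x + 0.044715 * x ^ 3))) := by
  rw [gelu]
  generalize √(2 / π) * (x + 0.044715 * x ^ 3) = u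
  rw [sigmoid_def, tanh_eq_sinh_div_cosh, sinh_eq, cosh_eq, exp_neg (2 * u), two_mul, exp_add,
    exp_neg]
  have := exp_pos u
  field_simp
  ring

open Polynomial in
theorem exists_poly_of_activation {σ : ℝ → ℝ} (hσ : σ = gelu ∨ σ = silu ∨ ∃ β, σ = swish β) :
    ∃ P : ℝ[X], σ = fun t => t * sigmoid (P.eval t) := by
  rcases hσ with rfl | rfl | ⟨β, rfl⟩
  · refine ⟨C (2 * √(2 / π)) * (X + C 0.044715 * X ^ 3), ?_⟩
    funext t
    rw [gelu_eq]
    simp [mul_assoc]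
  · exact ⟨X, by funext t; simp [silu]⟩
  · exact ⟨C β * X, by funext t; simp [swish]⟩

theorem slopeSup_spec {σ : ℝ → ℝ} (hσ : ContDiff ℝ 1 σ) :
    0 ≤ slopeSup σ ∧ ∀ s ∈ Set.Icc (-1 : ℝ) 1, ∀ t ∈ Set.Icc (-1 : ℝ) 1,
      |σ s - σ t| ≤ slopeSup σ * |s - t| := by
  have hbdd : BddAbove ((fun t => |deriv σ t|) '' Set.Icc (-1 : ℝ) 1) :=
    (isCompact_Icc.image (hσ.continuous_deriv le_rfl).abs).bddAbove
  have hle : ∀ t ∈ Set.Icc (-1 : ℝ) 1, |deriv σ t| ≤ slopeSup σ := fun t ht =>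
    le_csSup hbdd ⟨t, ht, rfl⟩
  refine ⟨(abs_nonneg _).trans (hle 0 (by norm_num)), fun s hs t ht => ?_⟩
  exact Convex.norm_image_sub_le_of_norm_deriv_le (fun x _ => (hσ.differentiable one_ne_zero) x)
    (fun x hx => hle x hx) (convex_Icc _ _) ht hs

/-- Doubly exponential accuracy: `2 ^ n` exceeds `l` plus a constant for some `n = O(log l)`. -/
theorem exists_two_pow_ge (c : ℝ) : ∃ C : ℝ, 0 < C ∧ ∀ l : ℝ, ∃ n : ℕ, 3 ≤ n ∧
    l + c ≤ 2 ^ n ∧ (n : ℝ) ≤ C * max 1 (log l) := by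
  obtain ⟨c₀, hc₀⟩ := exists_nat_ge c
  refine ⟨c₀ + 6, by positivity, fun l => ?_⟩
  set m := max 1 l with hm
  have hm1 : 1 ≤ m := le_max_left _ _
  have hml : l ≤ m := le_max_right _ _
  set Λ := max 1 (log l) with hΛ
  have hΛ1 : 1 ≤ Λ := le_max_left _ _
  have hlm : log m ≤ Λ := by
    rcases le_total 1 l with h | h
    · rw [hm, max_eq_right h]
      exact le_max_right _ _
    · rw [hm, max_eq_left h, log_one]
      linarith
  have hl2 := log_two_gt_d9
  set e := ⌈log m / log 2⌉₊ with he
  have h1 : m ≤ 2 ^ e := by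
    have h3 : log m ≤ e * log 2 := by
      rw [← div_le_iff₀ (by linarith)]
      exact Nat.le_ceil _
    rw [← log_pow] at h3
    exact (log_le_log_iff (by linarith) (by positivity)).1 h3
  have h2 : (e : ℝ) ≤ 2 * Λ + 1 := by
    have h3 : log m / log 2 ≤ 2 * Λ := by
      rw [div_le_iff₀ (by linarith)]
      nlinarith
    have h4 := Nat.ceil_lt_add_one (div_nonneg (log_nonneg hm1) (by linarith : 0 ≤ log 2))
    linarith
  have h5 : (c₀ : ℝ) ≤ 2 ^ c₀ := by exact_mod_cast (Nat.lt_two_pow_self (n := c₀)).le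
  have h6 : (1 : ℝ) ≤ 2 ^ c₀ := one_le_pow₀ (by norm_num)
  refine ⟨3 + c₀ + e, by omega, ?_, ?_⟩
  · rw [pow_add, pow_add]
    nlinarith
  · push_cast
    have : (0 : ℝ) ≤ c₀ := c₀.cast_nonneg
    nlinarith

open RatProg Polynomial in
theorem sigmoid_net_by_rational_net {σ : ℝ → ℝ}
    (hσ : σ = gelu ∨ σ = silu ∨ ∃ β : ℝ, σ = swish β) :
      ∃ (D : ℕ) (C : ℝ), 0 < C ∧
        ∀ (d k M : ℕ) (ε : ℝ), 1 ≤ k → 1 ≤ M → 0 < ε → ε < 1 →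
        ∀ f : FixedNet d, f.depth = M → f.WidthLE k → f.Normalized →
        ∃ R : RatNet d, R.NoPoles ∧ R.ForallAct (RatAct.DegreeLE D) ∧
          ApproxOnCube (FixedNet.fn σ f) (RatNet.fn R) ε ∧
          (R.units : ℝ) ≤
            C * (k * M * (max 1 (Real.log (Real.log (geomS M (slopeSup σ) / ε)))) ^ 3) ∧
          (RatNet.numParams R : ℝ) ≤
            C * (d + k) *
              (k * M * (max 1 (Real.log (Real.log (geomS M (slopeSup σ) / ε)))) ^ 3) := by
  obtain ⟨P, hP⟩ := exists_poly_of_activation hσ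
  obtain ⟨B, hB⟩ := isCompact_Icc.exists_bound_of_continuousOn
    (f := fun t : ℝ => P.eval t) (s := Set.Icc (-1 : ℝ) 1) P.continuous.continuousOn
  obtain ⟨N, hN⟩ := exists_nat_ge (max 1 (16 * B))
  have hN1 : 1 ≤ N := by exact_mod_cast (le_max_left _ _).trans hN
  have hNB : ∀ t ∈ Set.Icc (-1 : ℝ) 1, |P.eval t| ≤ N / 16 := by
    intro t ht
    have h1 : |P.eval t| ≤ B := hB t ht
    have h2 : 16 * B ≤ N := (le_max_right _ _).trans hN
    linarith
  have hN0 : (0 : ℝ) < N := by exact_mod_cast hN1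
  obtain ⟨hL0, hLip⟩ := slopeSup_spec (σ := σ) (by
    rw [hP]
    exact contDiff_id.mul ((contDiff_sigmoid.of_le le_top).comp (by
      simpa using P.contDiff_aeval (𝕜 := ℝ) 1)))
  set L := slopeSup σ with hL
  obtain ⟨C, hC, hCn⟩ := exists_two_pow_ge (log (4 * N))
  set D := max 2 (max P.natDegree N) with hD
  refine ⟨D, (10 + 1 + (2 * D + 2)) * (530 * C ^ 3 + 1), by positivity,
    fun d k M ε hk hM hε hε1 f hf hw hnorm => ?_⟩
  set S := geomS M L with hS
  have hS1 : 1 ≤ S := one_le_geomS hM hL0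
  obtain ⟨n, hn3, hn, hnC⟩ := hCn (log (S / ε))
  set Λ := max 1 (log (log (S / ε))) with hΛ
  have hΛ1 : 1 ≤ Λ := le_max_left _ _
  have hacc : 4 * N * exp (-2 ^ n) * S ≤ ε := by
    have h1 : exp (-2 ^ n) ≤ exp (-(log (S / ε) + log (4 * N))) := exp_le_exp.2 (by linarith)
    rw [exp_neg (_ + _), exp_add, exp_log (by positivity), exp_log (by positivity)] at h1
    calc 4 * N * exp (-2 ^ n) * S ≤ 4 * N * (S / ε * (4 * N))⁻¹ * S := by gcongr
      _ = ε := by field_simp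
  set l := Instr.compiles (polyAct X) (polyAct (X ^ 2)) (sigmoidProg P N n) with hl
  have hlen : l.length + 1 ≤ 53 * n ^ 3 := by
    obtain ⟨h1, h2⟩ := length_sigmoidProg P N hn3
    rw [hl, Instr.length_compiles, h1]
    have : 1 ≤ n ^ 3 := Nat.one_le_pow _ _ (by omega)
    omega
  have hval : ∀ s ∈ Set.Icc (-1 : ℝ) 1, |σ s| ≤ 1 := by
    intro s hs
    rw [hP, abs_mul, abs_of_nonneg (sigmoid_nonneg _)]
    exact mul_le_one₀ (abs_le.2 hs) (sigmoid_nonneg _) (sigmoid_le_one _)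
  obtain ⟨R, h1, h2, h3, h4⟩ := exists_simulation_net (A := RatAct) (w := 10) (T := l.length)
    (ev := RatAct.eval) (good := NoPole) (idA := polyAct X) (P := RatAct.DegreeLE D)
    (fun _ : Unit => σ) (Good := fun _ => True) (L := L) (δ := 4 * N * exp (-2 ^ n))
    (fun _ => l) (by simp) (by simp) (by simp [polyAct, RatAct.DegreeLE, hD]) hL0 (by positivity)
    (fun _ _ => ⟨rfl, Instr.compiles_act _ _ (by simp [polyAct, RatAct.DegreeLE, hD])
      (by simp [polyAct, RatAct.DegreeLE, hD]) _ (degree_sigmoidProg P N n D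
        (one_le_two.trans (le_max_left _ _)) ((le_max_left _ _).trans (le_max_right _ _))
        ((le_max_right _ _).trans (le_max_right _ _))), by
          rw [hP]
          exact isGadget_sigmoidProg P hN1 hNB hn3⟩)
    (fun _ _ s hs => ⟨hval s hs, fun t ht => hLip s hs t ht⟩) f hw hnorm (by
      have : ∀ {m : ℕ} (H : Layers Unit d m), H.ForallAct fun _ => True := by
        intro m H
        induction H with
        | input => trivial
        | layer prev m W b act ih => exact ⟨ih, fun _ => trivial⟩
      exact this _)
  have hunits : (R.units : ℝ) ≤ 530 * C ^ 3 * (k * M * Λ ^ 3) := by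
    have h5 : R.units ≤ M * (k * 10 * (53 * n ^ 3)) := by
      rw [hf] at h1
      exact h1.trans (by gcongr)
    calc (R.units : ℝ) ≤ ((M * (k * 10 * (53 * n ^ 3)) : ℕ) : ℝ) := by exact_mod_cast h5
      _ = 530 * (k * M) * (n : ℝ) ^ 3 := by push_cast; ring
      _ ≤ 530 * (k * M) * (C * Λ) ^ 3 := by gcongr
      _ = _ := by ring
  have hkM : 1 ≤ (k : ℝ) * M * Λ ^ 3 := by
    have h5 : (1 : ℝ) ≤ k := by exact_mod_cast hk
    have h6 : (1 : ℝ) ≤ M := by exact_mod_cast hM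
    exact one_le_mul_of_one_le_of_one_le (one_le_mul_of_one_le_of_one_le h5 h6)
      (one_le_pow₀ hΛ1)
  have hD0 : (1 : ℝ) ≤ 10 + 1 + (2 * D + 2) := by
    have : (0 : ℝ) ≤ D := D.cast_nonneg
    linarith
  have hC3 : 0 ≤ C ^ 3 := by positivity
  refine ⟨R, fun x hx => (h4 x hx).1, h3, fun x hx => ⟨abs_le.1 (h4 x hx).2.1, ?_⟩, ?_, ?_⟩
  · have := (h4 x hx).2.2
    rw [hf] at this
    exact this.trans hacc
  · refine hunits.trans (mul_le_mul_of_nonneg_right ?_ (by linarith))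
    nlinarith
  · have h5 := net_params_le (c := 2 * D + 2)
      (fun r : RatAct => (r.num.natDegree + 1) + (r.den.natDegree + 1)) R hk (by norm_num) h2 (by
      have : ∀ {m : ℕ} (H : Layers RatAct d m), H.ForallAct (RatAct.DegreeLE D) →
          H.ForallAct fun r => (r.num.natDegree + 1) + (r.den.natDegree + 1) ≤ 2 * D + 2 := by
        intro m H
        induction H with
        | input => exact fun _ => trivial
        | layer prev m W b act ih =>
          intro h
          refine ⟨ih h.1, fun i => ?_⟩
          have := h.2 i
          simp only [RatAct.DegreeLE] at this
          omega
      exact this _ h3)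
    have h6 : (RatNet.numParams R : ℝ) ≤ (10 + 1 + (2 * D + 2)) * (d + k) * (R.units + 1) := by
      exact_mod_cast h5
    refine h6.trans ?_
    have h7 : (R.units : ℝ) + 1 ≤ (530 * C ^ 3 + 1) * (k * M * Λ ^ 3) := by linarith
    calc _ ≤ (10 + 1 + (2 * (D : ℝ) + 2)) * (d + k) * ((530 * C ^ 3 + 1) * (k * M * Λ ^ 3)) := by
          gcongr
      _ = _ := by ring

end NetApprox

namespace NetApprox

open Real

/-! ### Chebyshev expansion of functions analytic in a Bernstein ellipse -/

theorem joukowski_mem_bernsteinEllipse {ρ : ℝ} {w : ℂ} (h1 : ρ⁻¹ < ‖w‖) (h2 : ‖w‖ < ρ)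
    (hρ : 1 < ρ) : (w + w⁻¹) / 2 ∈ bernsteinEllipse ρ := by
  have hρ0 : 0 < ρ := by linarith
  have hw0 : 0 < ‖w‖ := (inv_pos.2 hρ0).trans h1
  have hw : w ≠ 0 := norm_pos_iff.1 hw0
  have e1 : (w + w⁻¹) / 2 - 1 = (w - 1) ^ 2 / (2 * w) := by
    field_simp
    ring
  have e2 : (w + w⁻¹) / 2 + 1 = (w + 1) ^ 2 / (2 * w) := by
    field_simp
    ring
  have e3 : ‖w - 1‖ ^ 2 + ‖w + 1‖ ^ 2 = 2 * ‖w‖ ^ 2 + 2 := by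
    have := parallelogram_law_with_norm ℝ w 1
    rw [norm_one] at this
    nlinarith
  have e4 : ‖w‖ + ‖w‖⁻¹ < ρ + ρ⁻¹ := by
    have h3 : 1 < ‖w‖ * ρ := by
      rw [inv_lt_iff_one_lt_mul₀ hρ0] at h1
      linarith
    have h4 : ρ + ρ⁻¹ - (‖w‖ + ‖w‖⁻¹) = (ρ - ‖w‖) * (‖w‖ * ρ - 1) / (‖w‖ * ρ) := by
      field_simp
      ring
    have h5 : 0 < (ρ - ‖w‖) * (‖w‖ * ρ - 1) / (‖w‖ * ρ) :=
      div_pos (mul_pos (by linarith) (by linarith)) (by positivity)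
    linarith
  rw [bernsteinEllipse, Set.mem_ofPred_eq, e1, e2, norm_div, norm_div, norm_pow, norm_pow,
    norm_mul, Complex.norm_ofNat, ← add_div, e3]
  refine lt_of_eq_of_lt ?_ e4
  field_simp

/-- The function `r ((w + w⁻¹) / 2)`, which is analytic in an annulus. -/
noncomputable def annulusFun (r : RatAct) (w : ℂ) : ℂ :=
  Polynomial.aeval ((w + w⁻¹) / 2) r.num / Polynomial.aeval ((w + w⁻¹) / 2) r.den

theorem annulusFun_spec {r : RatAct} {ρ K : ℝ} (hρ : 1 < ρ) (hr : r.BernsteinBound ρ K) {w : ℂ}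
    (h1 : ρ⁻¹ < ‖w‖) (h2 : ‖w‖ < ρ) :
    w ≠ 0 ∧ DifferentiableAt ℂ (annulusFun r) w ∧ ‖annulusFun r w‖ ≤ K := by
  have hw0 : 0 < ‖w‖ := (inv_pos.2 (by linarith)).trans h1
  have hw : w ≠ 0 := norm_pos_iff.1 hw0
  obtain ⟨h3, h4⟩ := hr _ (joukowski_mem_bernsteinEllipse h1 h2 hρ)
  refine ⟨hw, ?_, h4⟩
  have hz : DifferentiableAt ℂ (fun w : ℂ => (w + w⁻¹) / 2) w :=
    (differentiableAt_id.add (differentiableAt_inv hw)).div_const 2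
  have hp : ∀ p : Polynomial ℝ, DifferentiableAt ℂ
      (fun w : ℂ => Polynomial.aeval ((w + w⁻¹) / 2) p) w := fun p =>
    DifferentiableAt.comp (g := fun z : ℂ => Polynomial.aeval z p) w
      (p.differentiable_aeval (𝕜 := ℂ) _) hz
  exact (hp _).div (hp _) h3

/-- Moving the contour inside the annulus. -/
theorem norm_circleIntegral_le {r : RatAct} {ρ K : ℝ} (hρ : 1 < ρ) (hr : r.BernsteinBound ρ K)
    {s : ℝ} (hs : ρ⁻¹ < s) (hs' : s < ρ) (n : ℤ) :
    ‖∮ w in C(0, 1), w⁻¹ • (w ^ (-n) * annulusFun r w)‖ ≤ 2 * π * (K * s ^ (-n)) := by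
  have hρ0 : 0 < ρ := by linarith
  have hs0 : 0 < s := (inv_pos.2 hρ0).trans hs
  have hρi : ρ⁻¹ < 1 := inv_lt_one_of_one_lt₀ hρ
  have hdiff : ∀ w : ℂ, ρ⁻¹ < ‖w‖ → ‖w‖ < ρ →
      DifferentiableAt ℂ (fun w => w ^ (-n) * annulusFun r w) w := by
    intro w h1 h2
    obtain ⟨h3, h4, -⟩ := annulusFun_spec hρ hr h1 h2
    exact (differentiableAt_zpow.2 (Or.inl h3)).mul h4
  have hmove : ∀ a b : ℝ, ρ⁻¹ < a → a ≤ b → b < ρ →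
      (∮ w in C(0, b), w⁻¹ • (w ^ (-n) * annulusFun r w)) =
        ∮ w in C(0, a), w⁻¹ • (w ^ (-n) * annulusFun r w) := by
    intro a b ha hab hb
    have := Complex.circleIntegral_sub_center_inv_smul_eq_of_differentiable_on_annulus_off_countable
      (c := 0) (r := a) (R := b) (f := fun w => w ^ (-n) * annulusFun r w)
      ((inv_pos.2 hρ0).trans ha) hab (s := ∅) Set.countable_empty (fun w hw => by
        simp only [Set.mem_sdiff, Metric.mem_closedBall, Metric.mem_ball, dist_zero_right,
          not_lt] at hw
        exact (hdiff w (by linarith) (by linarith)).continuousAt.continuousWithinAt) (fun w hw => by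
        simp only [Set.mem_sdiff, Metric.mem_closedBall, Metric.mem_ball, dist_zero_right,
          not_le] at hw
        exact hdiff w (by linarith [hw.1.2]) (by linarith [hw.1.1]))
    simpa only [sub_zero] using this
  have heq : (∮ w in C(0, 1), w⁻¹ • (w ^ (-n) * annulusFun r w)) =
      ∮ w in C(0, s), w⁻¹ • (w ^ (-n) * annulusFun r w) := by
    rcases le_total s 1 with h | h
    · exact hmove s 1 hs h hρ
    · exact (hmove 1 s hρi h hs').symm
  rw [heq]
  have hb := circleIntegral.norm_integral_le_of_norm_le_const (c := 0) (R := s)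
    (f := fun w => w⁻¹ • (w ^ (-n) * annulusFun r w)) (C := s⁻¹ * (s ^ (-n) * K)) hs0.le
    (fun w hw => by
      rw [mem_sphere_zero_iff_norm] at hw
      obtain ⟨h3, -, h5⟩ := annulusFun_spec (w := w) hρ hr (by rwa [hw]) (by rwa [hw])
      rw [norm_smul, norm_inv, norm_mul, norm_zpow, hw]
      gcongr)
  refine hb.trans (le_of_eq ?_)
  field_simp

/-- The function `θ ↦ r (cos θ)` on the circle `ℝ / 2πℤ`. -/
noncomputable def circleFun (r : RatAct) (x : AddCircle (2 * π)) : ℂ :=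
  annulusFun r (AddCircle.toCircle x)

theorem toCircle_coe (θ : ℝ) :
    ((AddCircle.toCircle (θ : AddCircle (2 * π)) : Circle) : ℂ) = Complex.exp (θ * Complex.I) := by
  rw [AddCircle.toCircle_apply_mk, Circle.coe_exp]
  congr 2
  push_cast
  field_simp

theorem circleFun_coe (r : RatAct) (θ : ℝ) :
    circleFun r (θ : AddCircle (2 * π)) = (r.eval (cos θ) : ℝ) := by
  have h : (Complex.exp (θ * Complex.I) + (Complex.exp (θ * Complex.I))⁻¹) / 2 =
      ((cos θ : ℝ) : ℂ) := by
    rw [← Complex.exp_neg, Complex.ofReal_cos, Complex.cos, neg_mul]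
  rw [circleFun, toCircle_coe, annulusFun, h, RatAct.eval, Complex.ofReal_div]
  congr 1 <;> exact (Polynomial.aeval_algebraMap_apply ℂ (cos θ) _).trans (by simp)

instance fact_two_pi_pos : Fact (0 < 2 * π) := ⟨two_pi_pos⟩

theorem continuous_circleFun {r : RatAct} {ρ K : ℝ} (hρ : 1 < ρ) (hr : r.BernsteinBound ρ K) :
    Continuous (circleFun r) := by
  rw [continuous_iff_continuousAt]
  intro x
  have hn : ‖((AddCircle.toCircle x : Circle) : ℂ)‖ = 1 := Circle.norm_coe _
  obtain ⟨-, h, -⟩ := annulusFun_spec (w := ((AddCircle.toCircle x : Circle) : ℂ)) hρ hr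
    (by rw [hn]; exact inv_lt_one_of_one_lt₀ hρ) (by rwa [hn])
  exact h.continuousAt.comp
    (f := fun x : AddCircle (2 * π) => ((AddCircle.toCircle x : Circle) : ℂ))
    (continuous_subtype_val.comp AddCircle.continuous_toCircle).continuousAt

theorem norm_fourierCoeff_le {r : RatAct} {ρ K : ℝ} (hρ : 1 < ρ) (hr : r.BernsteinBound ρ K)
    {s : ℝ} (hs : ρ⁻¹ < s) (hs' : s < ρ) (n : ℤ) :
    ‖fourierCoeff (circleFun r) n‖ ≤ K * s ^ (-n) := by
  have h1 : (∮ w in C(0, 1), w⁻¹ • (w ^ (-n) * annulusFun r w)) =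
      Complex.I * ∫ θ in (0 : ℝ)..2 * π, fourier (-n) (θ : AddCircle (2 * π)) •
        circleFun r (θ : AddCircle (2 * π)) := by
    rw [circleIntegral, ← intervalIntegral.integral_const_mul]
    refine intervalIntegral.integral_congr fun θ _ => ?_
    rw [deriv_circleMap, circleFun, toCircle_coe, fourier_coe_apply]
    have e : circleMap 0 1 θ = Complex.exp (θ * Complex.I) := by simp [circleMap]
    have hne := Complex.exp_ne_zero (θ * Complex.I)
    rw [e, ← Complex.exp_int_mul]
    have e2 : 2 * (π : ℂ) * Complex.I * ((-n : ℤ) : ℂ) * θ / ((2 * π : ℝ) : ℂ) =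
        ((-n : ℤ) : ℂ) * (θ * Complex.I) := by
      push_cast
      field_simp
    rw [e2]
    simp only [smul_eq_mul]
    field_simp
  have h2 := norm_circleIntegral_le hρ hr hs hs' n
  rw [h1, norm_mul, Complex.norm_I, one_mul] at h2
  rw [fourierCoeff_eq_intervalIntegral (circleFun r) n 0, norm_smul, zero_add, norm_eq_abs,
    abs_of_pos (by positivity)]
  calc 1 / (2 * π) * _ ≤ 1 / (2 * π) * (2 * π * (K * s ^ (-n))) := by gcongr
    _ = _ := by field_simp

/-- A function that is analytic and bounded in a Bernstein ellipse is approximated on `[-1,1]` by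
the partial sums of its Chebyshev series at a geometric rate; the Chebyshev polynomials are
written as `cos (j arccos t)`. -/
theorem exists_chebyshev_approx {ρ : ℝ} (K : ℝ) (hρ : 1 < ρ) :
    ∃ q C : ℝ, 0 < q ∧ q < 1 ∧ 0 < C ∧ ∀ r : RatAct, r.BernsteinBound ρ K →
      ∃ a : ℕ → ℝ, ∀ m : ℕ, ∀ t ∈ Set.Icc (-1 : ℝ) 1,
        |r.eval t - ∑ j ∈ Finset.range m, a j * cos (j * arccos t)| ≤ C * q ^ m := by
  obtain ⟨R, hR1, hRρ⟩ := exists_between hρ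
  have hR0 : 0 < R := by linarith
  set q := R⁻¹ with hq
  have hq0 : 0 < q := inv_pos.2 hR0
  have hq1 : q < 1 := inv_lt_one_of_one_lt₀ hR1
  have hρq : ρ⁻¹ < q := inv_strictAnti₀ hR0 hRρ
  refine ⟨q, 2 * |K| / (1 - q) + 1, hq0, hq1, ?_, fun r hr => ?_⟩
  · have : 0 < 1 - q := by linarith
    positivity
  set f : C(AddCircle (2 * π), ℂ) := ⟨circleFun r, continuous_circleFun hρ hr⟩ with hf
  set c : ℤ → ℂ := fourierCoeff (circleFun r) with hc
  have hdec1 : ∀ n : ℕ, ‖c n‖ ≤ |K| * q ^ n := by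
    intro n
    have := norm_fourierCoeff_le hρ hr (s := R) (by linarith) hRρ n
    rw [zpow_neg, zpow_natCast, ← inv_pow] at this
    exact this.trans (by gcongr; exact le_abs_self K)
  have hdec2 : ∀ n : ℕ, ‖c (-n)‖ ≤ |K| * q ^ n := by
    intro n
    have := norm_fourierCoeff_le hρ hr (s := q) hρq (by linarith) (-n)
    rw [neg_neg, zpow_natCast] at this
    exact this.trans (by gcongr; exact le_abs_self K)
  have hgeo : Summable fun n : ℕ => |K| * q ^ n :=
    (summable_geometric_of_lt_one hq0.le hq1).mul_left _
  have hsum : Summable c :=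
    Summable.of_nat_of_neg (Summable.of_norm_bounded hgeo hdec1)
      (Summable.of_norm_bounded hgeo hdec2)
  have hF : ∀ θ : ℝ, HasSum (fun n : ℤ => (c n).re * cos (n * θ)) (r.eval (cos θ)) := by
    intro θ
    have h1 := has_pointwise_sum_fourier_series_of_summable (f := f) hsum (θ : AddCircle (2 * π))
    have h2 := has_pointwise_sum_fourier_series_of_summable (f := f) hsum
      ((-θ : ℝ) : AddCircle (2 * π))
    have h3 := (h1.add h2).div_const 2
    simp only [hf, ContinuousMap.coe_mk, circleFun_coe, cos_neg] at h3
    have h4 := Complex.hasSum_re h3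
    convert h4 using 1
    · funext n
      have e : ∀ x : ℝ, (fourier n (x : AddCircle (2 * π)) : ℂ) =
          Complex.exp ((n * x : ℝ) * Complex.I) := by
        intro x
        rw [fourier_coe_apply]
        congr 1
        push_cast
        field_simp
      have e2 : (c n • (fourier n (θ : AddCircle (2 * π)) : ℂ) +
          c n • (fourier n ((-θ : ℝ) : AddCircle (2 * π)) : ℂ)) / 2 =
          c n * ((cos (n * θ) : ℝ) : ℂ) := by
        rw [e, e, Complex.ofReal_cos, Complex.cos]
        simp only [smul_eq_mul]
        push_cast
        rw [mul_neg, neg_mul]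
        ring
      change _ = ((c n • (fourier n (θ : AddCircle (2 * π)) : ℂ) +
          c n • (fourier n ((-θ : ℝ) : AddCircle (2 * π)) : ℂ)) / 2).re
      rw [e2, Complex.re_mul_ofReal]
    · rw [← two_mul, mul_div_cancel_left₀ _ two_ne_zero, Complex.ofReal_re]
  refine ⟨fun j => if j = 0 then (c 0).re else (c j).re + (c (-j)).re, fun m t ht => ?_⟩
  have hcos : cos (arccos t) = t := cos_arccos ht.1 ht.2
  set θ := arccos t with hθ
  have hN : HasSum (fun j : ℕ => (if j = 0 then (c 0).re else (c j).re + (c (-j)).re) *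
      cos (j * θ)) (r.eval t) := by
    have h1 := (hF θ).nat_add_neg
    have h2 := h1.sub (hasSum_ite_eq (0 : ℕ) (c 0).re)
    rw [hcos] at h2
    have h3 : r.eval t + (c 0).re * cos ((0 : ℤ) * θ) - (c 0).re = r.eval t := by simp
    rw [h3] at h2
    refine h2.congr_fun fun j => ?_
    by_cases hj : j = 0
    · simp [hj]
    · simp [hj]
      ring
  have hbound := norm_sub_le_of_geometric_bound_of_hasSum hq1 (C := 2 * |K|) (fun j => by
    have h1 : |if j = 0 then (c 0).re else (c j).re + (c (-j)).re| ≤ 2 * |K| * q ^ j := by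
      split_ifs with hj
      · have h2 := (Complex.abs_re_le_norm _).trans (hdec1 j)
        subst hj
        simp only [pow_zero, mul_one, Nat.cast_zero] at h2 ⊢
        linarith [abs_nonneg K]
      · refine (abs_add_le _ _).trans ?_
        have h2 := (Complex.abs_re_le_norm _).trans (hdec1 j)
        have h3 := (Complex.abs_re_le_norm _).trans (hdec2 j)
        linarith
    rw [norm_mul]
    exact (mul_le_of_le_one_right (norm_nonneg _) (abs_cos_le_one _)).trans h1) hN m
  rw [← dist_eq_norm, dist_comm, dist_eq_norm, norm_eq_abs] at hbound
  refine hbound.trans ?_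
  have h1 : 2 * |K| * q ^ m / (1 - q) = 2 * |K| / (1 - q) * q ^ m := by ring
  rw [h1, add_mul]
  have : 0 < 1 * q ^ m := by positivity
  linarith

end NetApprox

namespace NetApprox

open Real

/-! ### Polynomial gadgets for rational activations -/

/-- Labels for the activations of polynomial networks: `false` is the identity, `true` squares. -/
def polyEv : Bool → ℝ → ℝ
  | false, t => t
  | true, t => t ^ 2

theorem polyEv_idSq : IdSq polyEv (fun _ _ => True) false true :=
  ⟨fun _ => rfl, fun _ => rfl, fun _ => trivial, fun _ => trivial⟩

theorem instr_oks_true {A : Type} {r : ℕ} (ev : A → ℝ → ℝ) (l : List (Instr A r))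
    (s : Fin r → ℝ) : Instr.Oks ev (fun _ _ => True) l s := by
  induction l generalizing s with
  | nil => trivial
  | cons I l ih => exact ⟨by cases I <;> trivial, ih _⟩

/-- Summation of a Chebyshev series: for `x = cos θ` in register `0`, the loop with index `j` finds
`cos (j θ)`, `cos ((j + 1) θ)` and the partial sum in the registers `1`, `2`, `3`. -/
noncomputable def chebLoop (a : ℕ → ℝ) : ℕ → List (Instr Bool 5)
  | 0 => [.upd 1 0 1 false, .upd 2 (Pi.single 0 1) 0 false]
  | j + 1 => chebLoop a j ++ [.upd 3 (Pi.single 3 1 + Pi.single 1 (a j)) 0 false, .mul 4 0 2,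
      .upd 4 (Pi.single 4 2 - Pi.single 1 1) 0 false, .upd 1 (Pi.single 2 1) 0 false,
      .upd 2 (Pi.single 4 1) 0 false]

theorem chebLoop_spec (a : ℕ → ℝ) (s : Fin 5 → ℝ) (θ : ℝ) (h0 : s 0 = cos θ) (h3 : s 3 = 0)
    (j : ℕ) :
    Instr.runs polyEv (chebLoop a j) s 0 = cos θ ∧
    Instr.runs polyEv (chebLoop a j) s 1 = cos (j * θ) ∧
    Instr.runs polyEv (chebLoop a j) s 2 = cos ((j + 1) * θ) ∧
    Instr.runs polyEv (chebLoop a j) s 3 = ∑ i ∈ Finset.range j, a i * cos (i * θ) := by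
  induction j with
  | zero => simp [chebLoop, Instr.runs, Instr.run, Pi.single_apply, h0, h3, polyEv]
  | succ j ih =>
    obtain ⟨i0, i1, i2, i3⟩ := ih
    simp only [chebLoop, Instr.runs_append]
    set s' := Instr.runs polyEv (chebLoop a j) s
    have hrec : cos θ * cos ((j + 1) * θ) * 2 - cos (j * θ) = cos ((j + 1 + 1) * θ) := by
      rw [show (j + 1 + 1 : ℝ) * θ = (j + 1) * θ + θ by ring,
        show (j : ℝ) * θ = (j + 1) * θ - θ by ring, cos_add, cos_sub]
      ring
    refine ⟨?_, ?_, ?_, ?_⟩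
    · simp [Instr.runs, Instr.run, i0]
    · simp [Instr.runs, Instr.run, Pi.single_apply, i2, polyEv]
    · simp [Instr.runs, Instr.run, Pi.single_apply, sub_mul, i0, i1, i2, polyEv]
      linarith
    · simp [Instr.runs, Instr.run, Pi.single_apply, add_mul, Finset.sum_add_distrib, i1, i3,
        polyEv, Finset.sum_range_succ]

/-- The Chebyshev sum, multiplied by `κ`. -/
noncomputable def chebProg (a : ℕ → ℝ) (m : ℕ) (κ : ℝ) : List (Instr Bool 5) :=
  chebLoop a m ++ [.upd 0 (Pi.single 3 κ) 0 false]

theorem length_chebProg (a : ℕ → ℝ) (m : ℕ) (κ : ℝ) : (chebProg a m κ).length = 5 * m + 3 := by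
  have h : (chebLoop a m).length = 5 * m + 2 := by
    induction m with
    | zero => rfl
    | succ m ih =>
      simp only [chebLoop, List.length_append, ih, List.length_cons, List.length_nil]
      ring
  simp [chebProg, h]

/-- Division of the Chebyshev sum by `1 + δ` brings its values back to `[-1,1]`. -/
theorem isGadget_chebProg {f : ℝ → ℝ} {a : ℕ → ℝ} {m : ℕ} {δ : ℝ} (hδ : 0 ≤ δ)
    (hf : ∀ t ∈ Set.Icc (-1 : ℝ) 1, |f t| ≤ 1)
    (h : ∀ t ∈ Set.Icc (-1 : ℝ) 1,
      |f t - ∑ j ∈ Finset.range m, a j * cos (j * arccos t)| ≤ δ) :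
    IsGadget polyEv (fun _ _ => True) (2 * δ) f
      (Instr.compiles false true (chebProg a m (1 + δ)⁻¹)) := by
  refine isGadget_of_instrs polyEv_idSq fun t ht => ⟨instr_oks_true _ _ _, ?_⟩
  obtain ⟨-, -, -, h3⟩ := chebLoop_spec a (Pi.single 0 t) (arccos t)
    (by simp [cos_arccos ht.1 ht.2]) (by simp) m
  have hrun : Instr.runs polyEv (chebProg a m (1 + δ)⁻¹) (Pi.single 0 t) 0 =
      (1 + δ)⁻¹ * ∑ j ∈ Finset.range m, a j * cos (j * arccos t) := by
    rw [chebProg, Instr.runs_append]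
    simp only [Instr.runs, Instr.run]
    simp [Pi.single_apply, h3, polyEv]
  rw [hrun]
  have h1 := h t ht
  have h2 := hf t ht
  set p := ∑ j ∈ Finset.range m, a j * cos (j * arccos t)
  have hp : |p| ≤ 1 + δ := by
    have := abs_sub_abs_le_abs_sub p (f t)
    rw [abs_sub_comm] at this
    linarith
  have hδ1 : 0 < 1 + δ := by linarith
  constructor
  · rw [abs_mul, abs_inv, abs_of_pos hδ1, inv_mul_le_iff₀ hδ1]
    linarith
  · have e : (1 + δ)⁻¹ * p - f t = -(δ * ((1 + δ)⁻¹ * p)) - (f t - p) := by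
      field_simp
      ring
    rw [e]
    refine (abs_sub _ _).trans ?_
    rw [abs_neg, abs_mul, abs_mul, abs_inv, abs_of_pos hδ1, abs_of_nonneg hδ]
    have h4 : (1 + δ)⁻¹ * |p| ≤ 1 := by
      rw [inv_mul_le_iff₀ hδ1]
      linarith
    nlinarith

/-! ### Polynomial networks as limits of GELU networks -/

theorem gelu_sub_gelu_neg (x : ℝ) : gelu x - gelu (-x) = x := by
  have : √(2 / π) * (-x + 0.044715 * (-x) ^ 3) = -(√(2 / π) * (x + 0.044715 * x ^ 3)) := by ring
  rw [gelu, gelu, this, tanh_neg]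
  ring

theorem gelu_add_gelu_neg (x : ℝ) :
    gelu x + gelu (-x) = x * tanh (√(2 / π) * (x + 0.044715 * x ^ 3)) := by
  have : √(2 / π) * (-x + 0.044715 * (-x) ^ 3) = -(√(2 / π) * (x + 0.044715 * x ^ 3)) := by ring
  rw [gelu, gelu, this, tanh_neg]
  ring

theorem hasDerivAt_tanh (x : ℝ) : HasDerivAt tanh (1 - tanh x ^ 2) x := by
  have h : tanh = fun x => sinh x / cosh x := by
    funext y
    exact tanh_eq_sinh_div_cosh y
  have hc := (cosh_pos x).ne'
  have := (hasDerivAt_sinh x).div (hasDerivAt_cosh x) hc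
  rw [h]
  refine this.congr_deriv ?_
  simp only
  field_simp

/-- Two GELU nodes compute the identity exactly, `G x - G (-x) = x`, and approximate the square on
bounded sets: `G (h x) + G (-h x)` is `√(2/π) h² x²` up to terms of higher order in `h`. -/
theorem exists_gelu_approx (a : Bool) (B : ℝ) {η : ℝ} (hη : 0 < η) :
    ∃ h c₀ c₁ : ℝ, ∀ z, |z| ≤ B →
      |c₀ * gelu (h * z) + c₁ * gelu (-(h * z)) - polyEv a z| ≤ η := by
  cases a with
  | false =>
    refine ⟨1, 1, -1, fun z _ => ?_⟩
    have : 1 * gelu (1 * z) + -1 * gelu (-(1 * z)) - polyEv false z = 0 := by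
      have := gelu_sub_gelu_neg z
      simp only [polyEv, one_mul]
      linarith
    rw [this, abs_zero]
    exact hη.le
  | true =>
    set c := √(2 / π) with hc
    have hc0 : 0 < c := sqrt_pos.2 (by positivity)
    set b := max B 1 with hb
    have hb1 : 1 ≤ b := le_max_right _ _
    set b' := b + b ^ 3 with hb'
    have hb'0 : 0 < b' := by positivity
    have hder := (hasDerivAt_tanh 0).isLittleO
    have hev := hder.def (c := η / (2 * b * b')) (by positivity)
    simp only [tanh_zero, sub_zero, smul_eq_mul, ne_eq, OfNat.ofNat_ne_zero, not_false_eq_true,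
      zero_pow, mul_one, norm_eq_abs] at hev
    obtain ⟨δ, hδ, hball⟩ := Metric.eventually_nhds_iff.1 hev
    set h := min 1 (min (δ / (2 * c * b')) (η / (2 * b ^ 4))) with hh
    have hh0 : 0 < h := by positivity
    have hh1 : h ≤ 1 := min_le_left _ _
    have hh2 : h * (2 * c * b') ≤ δ := by
      rw [← le_div_iff₀ (by positivity)]
      exact (min_le_right _ _).trans (min_le_left _ _)
    have hh3 : h * (2 * b ^ 4) ≤ η := by
      rw [← le_div_iff₀ (by positivity)]
      exact (min_le_right _ _).trans (min_le_right _ _)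
    refine ⟨h, 1 / (c * h ^ 2), 1 / (c * h ^ 2), fun z hz => ?_⟩
    have hzb : |z| ≤ b := hz.trans (le_max_left _ _)
    set u := c * (h * z + 0.044715 * (h * z) ^ 3) with hu
    have hz3 : |z| ^ 3 ≤ b ^ 3 := pow_le_pow_left₀ (abs_nonneg _) hzb 3
    have hu1 : |u| ≤ c * h * b' := by
      have e : u = c * h * (z + 0.044715 * h ^ 2 * z ^ 3) := by rw [hu]; ring
      rw [e, abs_mul, abs_of_pos (mul_pos hc0 hh0)]
      refine mul_le_mul_of_nonneg_left ((abs_add_le _ _).trans ?_) (by positivity)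
      rw [abs_mul, abs_pow, abs_of_nonneg (by positivity : 0 ≤ 0.044715 * h ^ 2)]
      have : 0.044715 * h ^ 2 * |z| ^ 3 ≤ 1 * b ^ 3 := by
        refine mul_le_mul ?_ hz3 (by positivity) zero_le_one
        nlinarith
      linarith
    have htanh : |tanh u - u| ≤ η / (2 * b * b') * |u| := by
      refine hball ?_
      rw [dist_zero_right, norm_eq_abs]
      have : 0 < c * h * b' := by positivity
      linarith
    have e1 : 1 / (c * h ^ 2) * gelu (h * z) + 1 / (c * h ^ 2) * gelu (-(h * z)) -
        polyEv true z = z * ((tanh u - u) / (c * h)) + 0.044715 * h ^ 2 * z ^ 4 := by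
      have h1 : 1 / (c * h ^ 2) * gelu (h * z) + 1 / (c * h ^ 2) * gelu (-(h * z)) =
          1 / (c * h ^ 2) * (gelu (h * z) + gelu (-(h * z))) := by ring
      rw [h1, gelu_add_gelu_neg, ← hc, ← hu, polyEv]
      have h2 : u / (c * h) = z + 0.044715 * h ^ 2 * z ^ 3 := by
        rw [hu]
        field_simp
      have h3 : (tanh u - u) / (c * h) = tanh u / (c * h) - u / (c * h) := sub_div _ _ _
      rw [h3, h2]
      field_simp
      ring
    rw [e1]
    refine (abs_add_le _ _).trans ?_
    have t1 : |z * ((tanh u - u) / (c * h))| ≤ η / 2 := by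
      rw [abs_mul, abs_div, abs_of_pos (mul_pos hc0 hh0)]
      calc |z| * (|tanh u - u| / (c * h)) ≤
            b * (η / (2 * b * b') * (c * h * b') / (c * h)) := by
            gcongr
            exact htanh.trans (by gcongr)
        _ = η / 2 := by field_simp
    have t2 : |0.044715 * h ^ 2 * z ^ 4| ≤ η / 2 := by
      rw [abs_mul, abs_pow, abs_of_nonneg (by positivity : 0 ≤ 0.044715 * h ^ 2)]
      calc 0.044715 * h ^ 2 * |z| ^ 4 ≤ h * b ^ 4 := by
            gcongr
            nlinarith
        _ ≤ η / 2 := by linarith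
    linarith

theorem exists_eval_bound {d n : ℕ} (H : Layers Bool d n) :
    ∃ B : ℝ, 0 ≤ B ∧ ∀ x ∈ cube d, ∀ i, |H.eval polyEv x i| ≤ B := by
  have hcont : ∀ {n : ℕ} (H : Layers Bool d n), Continuous fun x => H.eval polyEv x := by
    intro n H
    induction H with
    | input => exact continuous_id
    | layer prev m W b act ih =>
      refine continuous_pi fun i => ?_
      have h1 : Continuous fun x => (∑ j, W i j * prev.eval polyEv x j) + b i :=
        (continuous_finsetSum _ fun j _ =>
          continuous_const.mul ((continuous_apply j).comp ih)).add continuous_const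
      simp only [Layers.eval]
      cases act i with
      | false => exact h1
      | true => exact h1.pow 2
  have hcube : IsCompact (cube d) := by
    have : cube d = Set.univ.pi fun _ => Set.Icc (-1 : ℝ) 1 := by
      ext x
      simp only [cube, Set.mem_univ_pi]
      rfl
    rw [this]
    exact isCompact_univ_pi fun _ => isCompact_Icc
  obtain ⟨B, hB⟩ := hcube.exists_bound_of_continuousOn (hcont H).continuousOn
  refine ⟨max B 0, le_max_right _ _, fun x hx i => ?_⟩
  exact (norm_le_pi_norm (H.eval polyEv x) i).trans ((hB x hx).trans (le_max_left _ _))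

theorem abs_polyEv_sub_le (a : Bool) {s t B : ℝ} (hB : 1 ≤ B) (hs : |s| ≤ B) (ht : |t| ≤ B) :
    |polyEv a s - polyEv a t| ≤ 2 * B * |s - t| := by
  cases a with
  | false =>
    simp only [polyEv]
    nlinarith [abs_nonneg (s - t)]
  | true =>
    simp only [polyEv]
    have h1 : s ^ 2 - t ^ 2 = (s + t) * (s - t) := by ring
    rw [h1, abs_mul]
    refine mul_le_mul_of_nonneg_right ((abs_add_le _ _).trans ?_) (abs_nonneg _)
    linarith

/-- Each layer of a polynomial network is, on the cube and up to any error, a linear image of a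
layer of twice as many GELU nodes. -/
theorem exists_gelu_layers {d k n : ℕ} (H : Layers Bool d n) (hk : H.WidthLE k) {η : ℝ}
    (hη : 0 < η) :
    ∃ (n' : ℕ) (H' : Layers Unit d n') (Rd : Fin n → Fin n' → ℝ), H'.units = H.units * 2 ∧
      H'.WidthLE (k * 2) ∧ ∀ x ∈ cube d, ∀ i,
        |(∑ l, Rd i l * H'.eval (fun _ => gelu) x l) - H.eval polyEv x i| ≤ η := by
  induction H generalizing η with
  | input =>
    refine ⟨d, Layers.input, fun i => Pi.single i 1, rfl, trivial, fun x _ i => ?_⟩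
    simp [Layers.eval, Pi.single_apply, hη.le]
  | layer prev m W b act ih =>
    obtain ⟨B, hB0, hB⟩ := exists_eval_bound prev
    set w := ∑ i, ∑ j, |W i j| with hw
    have hw0 : 0 ≤ w := Finset.sum_nonneg fun i _ => Finset.sum_nonneg fun j _ => abs_nonneg _
    have hwi : ∀ i, ∑ j, |W i j| ≤ w := fun i =>
      Finset.single_le_sum (f := fun i => ∑ j, |W i j|)
        (fun i _ => Finset.sum_nonneg fun j _ => abs_nonneg _) (Finset.mem_univ i)
    set v := ∑ i, |b i| with hv
    have hvi : ∀ i, |b i| ≤ v := fun i =>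
      Finset.single_le_sum (f := fun i => |b i|) (fun i _ => abs_nonneg _) (Finset.mem_univ i)
    have hv0 : 0 ≤ v := Finset.sum_nonneg fun i _ => abs_nonneg _
    -- `Z` bounds the exact and the approximate arguments of the activations
    set Z := w * B + v + 1 with hZ
    have hZ1 : 1 ≤ Z := by
      have := mul_nonneg hw0 hB0
      linarith
    set ε := min (η / 2) 1 / ((w + 1) * (2 * Z)) with hε
    have hε0 : 0 < ε := by positivity
    have hεe : (w + 1) * (2 * Z) * ε = min (η / 2) 1 := by
      rw [hε]
      field_simp
    have hwε : w * ε ≤ (w + 1) * (2 * Z) * ε :=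
      mul_le_mul_of_nonneg_right (by nlinarith) hε0.le
    obtain ⟨n', H', Rd, h1, h2, h3⟩ := ih hk.1 hε0
    choose h c₀ c₁ hc using fun i => exists_gelu_approx (act i) Z (half_pos hη)
    have hpre : ∀ x i, (∑ l, (∑ j, W i j * Rd j l) * H'.eval (fun _ => gelu) x l) =
        ∑ j, W i j * ∑ l, Rd j l * H'.eval (fun _ => gelu) x l := by
      intro x i
      simp only [Finset.sum_mul, Finset.mul_sum]
      rw [Finset.sum_comm]
      simp only [mul_assoc]
    refine ⟨m * 2, H'.layer (m * 2)
      (fun a l => ![1, -1] (finProdFinEquiv.symm a).2 * h (finProdFinEquiv.symm a).1 *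
        ∑ j, W (finProdFinEquiv.symm a).1 j * Rd j l)
      (fun a => ![1, -1] (finProdFinEquiv.symm a).2 * h (finProdFinEquiv.symm a).1 *
        b (finProdFinEquiv.symm a).1) (fun _ => ()),
      fun i a => if i = (finProdFinEquiv.symm a).1 then
        ![c₀ i, c₁ i] (finProdFinEquiv.symm a).2 else 0, ?_, ⟨h2, ?_⟩, fun x hx i => ?_⟩
    · simp only [Layers.units, h1]
      ring
    · exact Nat.mul_le_mul_right _ hk.2
    · rw [sum_block i ![c₀ i, c₁ i]]
      simp only [Layers.eval, Equiv.symm_apply_apply, Fin.sum_univ_two, mul_assoc,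
        ← Finset.mul_sum]
      simp only [← mul_assoc, Matrix.cons_val_zero, Matrix.cons_val_one, one_mul]
      rw [hpre]
      set z' := (∑ j, W i j * ∑ l, Rd j l * H'.eval (fun _ => gelu) x l) + b i with hz'
      set z := (∑ j, W i j * prev.eval polyEv x j) + b i with hz
      have hzz : |z' - z| ≤ w * ε := by
        have e : z' - z = ∑ j, W i j * ((∑ l, Rd j l * H'.eval (fun _ => gelu) x l) -
            prev.eval polyEv x j) := by
          rw [hz', hz]
          simp only [mul_sub, Finset.sum_sub_distrib]
          ring
        rw [e]
        exact (abs_sum_mul_le _ _ (h3 x hx)).trans (mul_le_mul_of_nonneg_right (hwi i) hε0.le)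
      have hzB : |z| ≤ Z - 1 := by
        refine (abs_add_le _ _).trans ?_
        have h4 := abs_sum_mul_le (W i) (fun j => prev.eval polyEv x j) (hB x hx)
        have h5 := mul_le_mul_of_nonneg_right (hwi i) hB0
        linarith [hvi i]
      have hz'B : |z'| ≤ Z := by
        have h4 := abs_sub_abs_le_abs_sub z' z
        have h5 : min (η / 2) 1 ≤ 1 := min_le_right _ _
        linarith
      have h6 := hc i z' hz'B
      have h7 := abs_polyEv_sub_le (act i) hZ1 hz'B (hzB.trans (by linarith))
      have h8 : 2 * Z * |z' - z| ≤ η / 2 := by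
        calc 2 * Z * |z' - z| ≤ 2 * Z * (w * ε) := by gcongr
          _ ≤ (w + 1) * (2 * Z) * ε := by nlinarith [mul_pos (by linarith : 0 < 2 * Z) hε0]
          _ = min (η / 2) 1 := hεe
          _ ≤ η / 2 := min_le_left _ _
      have e1 : h i * (∑ j, W i j * ∑ l, Rd j l * H'.eval (fun _ => gelu) x l) + h i * b i =
          h i * z' := by
        rw [hz']
        ring
      have e2 : -1 * h i * (∑ j, W i j * ∑ l, Rd j l * H'.eval (fun _ => gelu) x l) +
          -1 * h i * b i = -(h i * z') := by
        rw [hz']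
        ring
      rw [e1, e2]
      refine (abs_sub_le _ (polyEv (act i) z') _).trans ?_
      linarith

theorem exists_gelu_net {d k : ℕ} (N : Net Bool d) (hk : N.WidthLE k) {η : ℝ} (hη : 0 < η) :
    ∃ f : FixedNet d, f.units = N.units * 2 ∧ f.WidthLE (k * 2) ∧
      ∀ x ∈ cube d, |FixedNet.fn gelu f x - N.eval polyEv x| ≤ η := by
  set c := ∑ j, |N.outW j| with hc
  have hc0 : 0 ≤ c := Finset.sum_nonneg fun j _ => abs_nonneg _
  obtain ⟨n', H', Rd, h1, h2, h3⟩ := exists_gelu_layers N.hidden hk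
    (η := η / (c + 1)) (by positivity)
  refine ⟨⟨H', fun l => ∑ j, N.outW j * Rd j l, N.outB⟩, h1, h2, fun x hx => ?_⟩
  have e : FixedNet.fn gelu ⟨H', fun l => ∑ j, N.outW j * Rd j l, N.outB⟩ x - N.eval polyEv x =
      ∑ j, N.outW j * ((∑ l, Rd j l * H'.eval (fun _ => gelu) x l) -
        N.hidden.eval polyEv x j) := by
    simp only [FixedNet.fn, Net.eval, mul_sub, Finset.sum_sub_distrib, Finset.sum_mul,
      Finset.mul_sum]
    rw [Finset.sum_comm]
    simp only [mul_assoc]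
    ring
  rw [e]
  refine (abs_sum_mul_le _ _ (h3 x hx)).trans ?_
  rw [← mul_div_assoc, div_le_iff₀ (by positivity)]
  nlinarith

/-! ### Rational networks by GELU networks -/

/-- Geometric accuracy: `C₀ q ^ m` is below `1 / y` for some `m = O(log y)`. -/
theorem exists_geometric_le {q C₀ : ℝ} (hq0 : 0 < q) (hq1 : q < 1) (hC₀ : 0 < C₀) :
    ∃ C : ℝ, 0 < C ∧ ∀ y : ℝ, 0 < y → ∃ m : ℕ, C₀ * q ^ m * y ≤ 1 ∧
      (m : ℝ) ≤ C * max 1 (log y) := by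
  have hlq : 0 < -log q := by linarith [log_neg hq0 hq1]
  refine ⟨(|log C₀| + 1) / (-log q) + 1, by positivity, fun y hy => ?_⟩
  set Λ := max 1 (log y) with hΛ
  have hΛ1 : 1 ≤ Λ := le_max_left _ _
  have hΛy : log y ≤ Λ := le_max_right _ _
  refine ⟨⌈(|log C₀| * Λ + Λ) / (-log q)⌉₊, ?_, ?_⟩
  · set m := ⌈(|log C₀| * Λ + Λ) / (-log q)⌉₊
    have h1 : (|log C₀| * Λ + Λ) / (-log q) ≤ m := Nat.le_ceil _
    rw [div_le_iff₀ hlq] at h1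
    have h2 : log (C₀ * q ^ m * y) ≤ 0 := by
      rw [log_mul (by positivity) hy.ne', log_mul hC₀.ne' (by positivity), log_pow]
      have h3 := le_abs_self (log C₀)
      have h4 : |log C₀| ≤ |log C₀| * Λ := le_mul_of_one_le_right (abs_nonneg _) hΛ1
      linarith
    by_contra! h
    exact absurd (log_pos h) (by linarith)
  · have h1 := Nat.ceil_lt_add_one (a := (|log C₀| * Λ + Λ) / (-log q)) (by positivity)
    have h2 : (|log C₀| * Λ + Λ) / (-log q) = (|log C₀| + 1) / (-log q) * Λ := by ring
    rw [h2] at h1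
    rw [h2, add_mul, one_mul]
    linarith

theorem rational_net_by_gelu_net {ρ : ℝ} (K : ℝ) (hρ : 1 < ρ) :
      ∃ C : ℝ, 0 < C ∧
        ∀ (d k M : ℕ) (L ε : ℝ), 1 ≤ k → 1 ≤ M → 0 < ε → ε < 1 → 0 ≤ L →
        ∀ R : RatNet d, R.depth = M → R.WidthLE k → R.Normalized →
          R.ForallAct (fun r => r.SelfMap ∧ r.BernsteinBound ρ K ∧
            ∀ s ∈ Set.Icc (-1 : ℝ) 1, ∀ t ∈ Set.Icc (-1 : ℝ) 1,
              |r.eval s - r.eval t| ≤ L * |s - t|) →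
        ∃ f : FixedNet d,
          ApproxOnCube (RatNet.fn R) (FixedNet.fn gelu f) ε ∧
          (f.units : ℝ) ≤ C * (k * M * (max 1 (Real.log (geomS M L / ε))) ^ 2) ∧
          (FixedNet.numParams f : ℝ) ≤
            C * (d + k) * (k * M * (max 1 (Real.log (geomS M L / ε))) ^ 2) := by
  obtain ⟨q, C₀, hq0, hq1, hC₀, hcheb⟩ := exists_chebyshev_approx K hρ
  obtain ⟨C, hC, hgeo⟩ := exists_geometric_le hq0 hq1 (C₀ := 8 * C₀) (by positivity)
  choose! a ha using hcheb
  refine ⟨15 * (14 * (10 * C + 7) + 1), by positivity,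
    fun d k M L ε hk hM hε hε1 hL R hRd hRw hRn hRa => ?_⟩
  set S := geomS M L with hS
  have hS1 : 1 ≤ S := one_le_geomS hM hL
  obtain ⟨m, hm, hmC⟩ := hgeo (S / ε) (by positivity)
  set Λ := max 1 (log (S / ε)) with hΛ
  have hΛ1 : 1 ≤ Λ := le_max_left _ _
  set δ := C₀ * q ^ m with hδ
  have hδ0 : 0 < δ := by positivity
  have hδS : 2 * δ * S ≤ ε / 4 := by
    rw [← mul_div_assoc, div_le_one hε] at hm
    linarith
  obtain ⟨N, h1, h2, -, h4⟩ := exists_simulation_net (A := Bool) (w := 7)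
    (T := 2 * (5 * m + 3)) (k := k) (L := L) (δ := 2 * δ)
    (ev := polyEv) (good := fun _ _ => True) (idA := false) (P := fun _ => True) RatAct.eval
    (fun r => Instr.compiles false true (chebProg (a r) m (1 + δ)⁻¹))
    (fun _ => rfl) (fun _ => trivial) trivial hL (by positivity)
    (fun r hr => ⟨by rw [Instr.length_compiles, length_chebProg], fun _ _ _ => trivial,
      isGadget_chebProg hδ0.le (fun t ht => abs_le.2 (hr.1 t ht).2)
        fun t ht => ha r hr.2.1 m t ht⟩)
    (fun r hr s hs => ⟨abs_le.2 (hr.1 s hs).2, hr.2.2 s hs⟩) R hRw hRn hRa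
  -- the factor `1 - ε / 4` leaves room for the error of the GELU nodes
  obtain ⟨f, f1, f2, f3⟩ := exists_gelu_net
    ⟨N.hidden, fun j => (1 - ε / 4) * N.outW j, (1 - ε / 4) * N.outB⟩ h2
    (η := ε / 4) (by positivity)
  have hscale : ∀ x, Net.eval polyEv ⟨N.hidden, fun j => (1 - ε / 4) * N.outW j,
      (1 - ε / 4) * N.outB⟩ x = (1 - ε / 4) * N.eval polyEv x := by
    intro x
    simp only [Net.eval, mul_add, Finset.mul_sum, mul_assoc]
  have hΛ2 : Λ ≤ Λ ^ 2 := by nlinarith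
  have hk' : (1 : ℝ) ≤ k := by exact_mod_cast hk
  have hM' : (1 : ℝ) ≤ M := by exact_mod_cast hM
  have hkM : 1 ≤ (k : ℝ) * M := one_le_mul_of_one_le_of_one_le hk' hM'
  have hunits : (f.units : ℝ) ≤ 14 * (10 * C + 7) * (k * M * Λ ^ 2) := by
    have h5 : f.units ≤ M * (k * 7 * (2 * (5 * m + 3) + 1)) * 2 := by
      rw [f1]
      rw [hRd] at h1
      exact Nat.mul_le_mul_right _ h1
    calc (f.units : ℝ) ≤ ((M * (k * 7 * (2 * (5 * m + 3) + 1)) * 2 : ℕ) : ℝ) := by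
          exact_mod_cast h5
      _ = 14 * (k * M) * (10 * m + 7) := by push_cast; ring
      _ ≤ 14 * (k * M) * (10 * (C * Λ) + 7 * Λ) := by
        gcongr
        linarith
      _ = 14 * (10 * C + 7) * (k * M * Λ) := by ring
      _ ≤ _ := by gcongr
  have hX : 1 ≤ (k : ℝ) * M * Λ ^ 2 :=
    one_le_mul_of_one_le_of_one_le hkM (one_le_pow₀ hΛ1)
  refine ⟨f, fun x hx => ?_, ?_, ?_⟩
  · obtain ⟨-, h5, h6⟩ := h4 x hx
    have h7 := f3 x hx
    rw [hscale] at h7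
    rw [hRd] at h6
    have h8 : |RatNet.fn R x - N.eval polyEv x| ≤ ε / 4 := h6.trans hδS
    obtain ⟨a1, a2⟩ := abs_le.1 h5
    obtain ⟨b1, b2⟩ := abs_le.1 h7
    obtain ⟨c1, c2⟩ := abs_le.1 h8
    refine ⟨⟨?_, ?_⟩, abs_le.2 ⟨?_, ?_⟩⟩ <;> nlinarith
  · refine hunits.trans (mul_le_mul_of_nonneg_right ?_ (by linarith))
    nlinarith
  · have h5 := net_params_le (w := 14) (c := 0) (fun _ : Unit => 0) f hk (by norm_num)
      (by rw [show k * 14 = k * 7 * 2 by ring]; exact f2) (by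
      have : ∀ {m : ℕ} (H : Layers Unit d m), H.ForallAct fun _ => 0 ≤ 0 := by
        intro m H
        induction H with
        | input => trivial
        | layer prev m W b act ih => exact ⟨ih, fun _ => le_rfl⟩
      exact this _)
    have h6 : (FixedNet.numParams f : ℝ) ≤ (14 + 1 + 0) * (d + k) * (f.units + 1) := by
      exact_mod_cast h5
    refine h6.trans ?_
    calc ((14 : ℝ) + 1 + 0) * (d + k) * (f.units + 1)
        ≤ (14 + 1 + 0) * (d + k) * (14 * (10 * C + 7) * (k * M * Λ ^ 2) +
          1 * (k * M * Λ ^ 2)) := by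
          gcongr
          linarith
      _ = _ := by ring

end NetApprox

namespace NetApprox

open Real

/-! ### The slope of GELU -/

/-- The derivative of GELU: with the argument `w` of the sigmoid in `G t = t * sigmoid w`, it is
`s + t w' s (1 - s)` for `s = sigmoid w`. -/
noncomputable def geluSlope (t : ℝ) : ℝ :=
  sigmoid (2 * √(2 / π) * (t + 0.044715 * t ^ 3)) +
    2 * √(2 / π) * (t + 0.134145 * t ^ 3) *
      (sigmoid (2 * √(2 / π) * (t + 0.044715 * t ^ 3)) *
        (1 - sigmoid (2 * √(2 / π) * (t + 0.044715 * t ^ 3))))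

theorem hasDerivAt_gelu (t : ℝ) : HasDerivAt gelu (geluSlope t) t := by
  have h : gelu = fun t => t * sigmoid (2 * √(2 / π) * (t + 0.044715 * t ^ 3)) := by
    funext x
    rw [gelu_eq, mul_assoc]
  have h1 : HasDerivAt (fun t : ℝ => 2 * √(2 / π) * (t + 0.044715 * t ^ 3))
      (2 * √(2 / π) * (1 + 0.044715 * (3 * t ^ 2))) t := by
    have h2 := (hasDerivAt_pow 3 t).const_mul (0.044715 : ℝ)
    have h3 := ((hasDerivAt_id t).add h2).const_mul (2 * √(2 / π))
    refine h3.congr_deriv ?_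
    norm_num
  rw [h]
  refine ((hasDerivAt_id t).mul ((hasDerivAt_sigmoid _).comp t h1)).congr_deriv ?_
  simp only [id, geluSlope, Function.comp]
  ring

theorem geluSlope_neg (t : ℝ) : geluSlope (-t) = 1 - geluSlope t := by
  have e : 2 * √(2 / π) * (-t + 0.044715 * (-t) ^ 3) =
      -(2 * √(2 / π) * (t + 0.044715 * t ^ 3)) := by ring
  rw [geluSlope, e, sigmoid_neg, geluSlope]
  ring

theorem geluSlope_nonneg {t : ℝ} (ht : 0 ≤ t) : 0 ≤ geluSlope t := by
  have h := fun x => sigmoid_nonneg x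
  have h' := fun x => sub_nonneg.2 (sigmoid_le_one x)
  have := mul_nonneg (h (2 * √(2 / π) * (t + 0.044715 * t ^ 3)))
    (h' (2 * √(2 / π) * (t + 0.044715 * t ^ 3)))
  rw [geluSlope]
  have h3 := h (2 * √(2 / π) * (t + 0.044715 * t ^ 3))
  positivity

/-- Clearing the denominators in `s + B s (1 - s) ≤ v`, with `s = 1 / (1 + e ^ (-w))`. -/
theorem sigmoid_add_le_iff (w B v : ℝ) :
    sigmoid w + B * (sigmoid w * (1 - sigmoid w)) ≤ v ↔
      B ≤ (v - 1) * exp w + v * exp (-w) + (2 * v - 1) := by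
  have hE := exp_pos w
  rw [sigmoid_def, exp_neg]
  have e : (1 + (exp w)⁻¹)⁻¹ + B * ((1 + (exp w)⁻¹)⁻¹ * (1 - (1 + (exp w)⁻¹)⁻¹)) - v =
      exp w / (1 + exp w) ^ 2 * (B - ((v - 1) * exp w + v * (exp w)⁻¹ + (2 * v - 1))) := by
    field_simp
    ring
  have hpos : 0 < exp w / (1 + exp w) ^ 2 := by positivity
  rw [← sub_nonpos, e, mul_nonpos_iff_pos_imp_nonpos]
  constructor
  · intro h
    linarith [h.1 hpos]
  · intro h
    exact ⟨fun _ => by linarith, fun _ => hpos.le⟩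

/-- The function of `w` in `sigmoid_add_le_iff`, minus `w`, decreases as long as its derivative is
negative at the right end point. -/
theorem exp_combination_anti {v w w₁ : ℝ} (hv : 1 ≤ v) (hw : w ≤ w₁)
    (h : (v - 1) * exp w₁ ≤ 1 + v * exp (-w₁)) :
    (v - 1) * exp w₁ + v * exp (-w₁) - w₁ ≤ (v - 1) * exp w + v * exp (-w) - w := by
  have h1 : exp w₁ * (1 + (w - w₁)) ≤ exp w := by
    have := mul_le_mul_of_nonneg_left (add_one_le_exp (w - w₁)) (exp_pos w₁).le
    rw [← exp_add, add_sub_cancel] at this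
    linarith
  have h2 : exp (-w₁) * (1 + (w₁ - w)) ≤ exp (-w) := by
    have := mul_le_mul_of_nonneg_left (add_one_le_exp (w₁ - w)) (exp_pos (-w₁)).le
    rw [← exp_add, show -w₁ + (w₁ - w) = -w by ring] at this
    linarith
  have h3 := mul_le_mul_of_nonneg_left h1 (sub_nonneg.2 hv)
  have h4 := mul_le_mul_of_nonneg_left h2 (zero_le_one.trans hv)
  nlinarith [mul_nonneg (sub_nonneg.2 hw) (sub_nonneg.2 h)]

theorem two_mul_sqrt_bounds :
    1.59576912 ≤ 2 * √(2 / π) ∧ 2 * √(2 / π) ≤ 1.59576913 := by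
  have h1 := pi_gt_d20
  have h2 := pi_lt_d20
  have hpi := pi_pos
  constructor
  · have : (0.79788456 : ℝ) ≤ √(2 / π) := by
      apply le_sqrt_of_sq_le
      rw [le_div_iff₀ hpi]
      nlinarith
    linarith
  · have : √(2 / π) ≤ (0.797884565 : ℝ) := by
      rw [sqrt_le_left (by norm_num), div_le_iff₀ hpi]
      nlinarith
    linarith

/-- Bounds for `e ^ (m + x)`, `0 ≤ x ≤ 1`, from those of `e` and the Taylor polynomial. -/
theorem exp_nat_add_bounds (m : ℕ) {x : ℝ} (h0 : 0 ≤ x) (h1 : x ≤ 1) :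
    2.7182818283 ^ m * (∑ i ∈ Finset.range 9, x ^ i / i.factorial) ≤ exp (m + x) ∧
    exp (m + x) ≤ 2.7182818286 ^ m *
      ((∑ i ∈ Finset.range 9, x ^ i / i.factorial) + x ^ 9 * (9 + 1) / (Nat.factorial 9 * 9)) := by
  have e : exp (m + x) = exp 1 ^ m * exp x := by
    rw [exp_add, ← exp_nat_mul, mul_one]
  have hs : 0 ≤ ∑ i ∈ Finset.range 9, x ^ i / i.factorial :=
    Finset.sum_nonneg fun i _ => by positivity
  have u := exp_bound' h0 h1 (n := 9) (by norm_num)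
  rw [e]
  constructor
  · refine mul_le_mul (pow_le_pow_left₀ (by norm_num) exp_one_gt_d9.le _)
      (sum_le_exp_of_nonneg h0 9) hs (by positivity)
  · refine mul_le_mul (pow_le_pow_left₀ (exp_pos _).le exp_one_lt_d9.le _) ?_ (exp_pos _).le
      (by positivity)
    exact_mod_cast u

end NetApprox

namespace NetApprox

open Real

theorem geluSlope_le_iff (t v : ℝ) :
    geluSlope t ≤ v ↔ 2 * √(2 / π) * (t + 0.134145 * t ^ 3) ≤
      (v - 1) * exp (2 * √(2 / π) * (t + 0.044715 * t ^ 3)) +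
        v * exp (-(2 * √(2 / π) * (t + 0.044715 * t ^ 3))) + (2 * v - 1) := by
  rw [geluSlope, sigmoid_add_le_iff]

/-- A bound for the slope at `T` holds on `[0, T]`, as long as `exp_combination_anti` applies. -/
theorem geluSlope_le_of_le {v t T w₁ w₂ E₁ E₂ : ℝ} (hv : 1 ≤ v) (h0 : 0 ≤ t) (hT : t ≤ T)
    (hw₁ : w₁ ≤ 1.59576912 * (T + 0.044715 * T ^ 3))
    (hw₂ : 1.59576913 * (T + 0.044715 * T ^ 3) ≤ w₂)
    (hE₁ : E₁ ≤ exp w₁) (hE₂ : exp w₂ ≤ E₂)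
    (h1 : (v - 1) * E₂ ≤ 1 + v / E₂)
    (h2 : 1.59576913 * (T + 0.134145 * T ^ 3) ≤ (v - 1) * E₁ + v / E₂ + (2 * v - 1)) :
    geluSlope t ≤ v := by
  obtain ⟨b1, b2⟩ := two_mul_sqrt_bounds
  rw [geluSlope_le_iff]
  set b := 2 * √(2 / π)
  have hT0 : 0 ≤ T := h0.trans hT
  have ht3 : t ^ 3 ≤ T ^ 3 := pow_le_pow_left₀ h0 hT 3
  have hT3 : 0 ≤ T ^ 3 := by positivity
  have hb : 0 ≤ b := by linarith
  have hE₂0 : 0 < E₂ := (exp_pos _).trans_le hE₂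
  have l1 : E₁ ≤ exp (b * (T + 0.044715 * T ^ 3)) :=
    hE₁.trans (exp_le_exp.2 (hw₁.trans (mul_le_mul_of_nonneg_right b1 (by positivity))))
  have l2 : exp (b * (T + 0.044715 * T ^ 3)) ≤ E₂ :=
    (exp_le_exp.2 ((mul_le_mul_of_nonneg_right b2 (by positivity)).trans hw₂)).trans hE₂
  have l3 : v / E₂ ≤ v * exp (-(b * (T + 0.044715 * T ^ 3))) := by
    rw [exp_neg, div_eq_mul_inv]
    exact mul_le_mul_of_nonneg_left (inv_anti₀ (exp_pos _) l2) (by linarith)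
  have l4 := mul_le_mul_of_nonneg_left l1 (sub_nonneg.2 hv)
  have l5 := mul_le_mul_of_nonneg_left l2 (sub_nonneg.2 hv)
  have l6 : b * (t + 0.044715 * t ^ 3) ≤ b * (T + 0.044715 * T ^ 3) :=
    mul_le_mul_of_nonneg_left (by linarith) hb
  have l7 := exp_combination_anti hv l6 (by linarith)
  have l8 : b * t ^ 3 ≤ b * T ^ 3 := mul_le_mul_of_nonneg_left ht3 hb
  have l9 : b * (T + 0.134145 * T ^ 3) ≤ 1.59576913 * (T + 0.134145 * T ^ 3) :=
    mul_le_mul_of_nonneg_right b2 (by positivity)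
  linarith

theorem geluSlope_le_of_le_one {t : ℝ} (h0 : 0 ≤ t) (h1 : t ≤ 1) : geluSlope t ≤ 1.083 := by
  have u1 := (exp_nat_add_bounds 1 (x := 0.66712393) (by norm_num) (by norm_num)).1
  have u2 := (exp_nat_add_bounds 1 (x := 0.66712395) (by norm_num) (by norm_num)).2
  simp only [Finset.sum_range_succ, Finset.sum_range_zero, Nat.factorial] at u1 u2
  norm_num at u1 u2
  refine geluSlope_le_of_le (T := 1) (w₁ := 1 + 0.66712393) (w₂ := 1 + 0.66712395)
    (E₁ := 5.2969) (E₂ := 5.297) (by norm_num) h0 h1 (by norm_num) (by norm_num)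
    (le_trans (by norm_num) (u1.trans_eq (by norm_num)))
    (le_trans (le_of_eq (by norm_num)) (u2.trans (by norm_num))) (by norm_num) (by norm_num)

theorem geluSlope_le_of_le_five_fourths {t : ℝ} (h0 : 0 ≤ t) (h1 : t ≤ 1.25) :
    geluSlope t ≤ 1.129 := by
  have u1 := (exp_nat_add_bounds 2 (x := 0.134) (by norm_num) (by norm_num)).1
  have u2 := (exp_nat_add_bounds 2 (x := 0.1341) (by norm_num) (by norm_num)).2
  simp only [Finset.sum_range_succ, Finset.sum_range_zero, Nat.factorial] at u1 u2
  norm_num at u1 u2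
  refine geluSlope_le_of_le (T := 1.25) (w₁ := 2 + 0.134) (w₂ := 2 + 0.1341)
    (E₁ := 8.44) (E₂ := 8.46) (by norm_num) h0 h1 (by norm_num) (by norm_num)
    (le_trans (by norm_num) (u1.trans_eq (by norm_num)))
    (le_trans (le_of_eq (by norm_num)) (u2.trans (by norm_num))) (by norm_num) (by norm_num)

/-- The expansion of the two exponentials at the point `w` that belongs to `1.42`, to the right:
`b * g` is the increment of the exponent. -/
theorem exp_combination_ge_of_nonneg {b w x g : ℝ}
    (b1 : 1.59576912 ≤ b) (E1 : 11.826 ≤ exp w) (Y1 : 0.084558 ≤ exp (-w))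
    (Y2 : exp (-w) ≤ 0.08456)
    (hg : g = x * (1 + 0.134145 * 1.42 ^ 2 + 0.134145 * 1.42 * x + 0.044715 * x ^ 2))
    (hx : 0 ≤ x) :
    1.59576913 * ((1.42 + x) + 0.134145 * (1.42 + x) ^ 3) ≤
      (1.129 - 1) * (exp w * exp (b * g)) + 1.129 * (exp (-w) * exp (-(b * g))) +
        (2 * 1.129 - 1) := by
  have hy := add_one_le_exp (-(b * g))
  have hY := mul_le_mul_of_nonneg_left hy (exp_pos (-w)).le
  have hg0 : 0 ≤ g := by rw [hg]; positivity
  have hd : 1.59576912 * g ≤ b * g := mul_le_mul_of_nonneg_right b1 hg0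
  have hd0 : 0 ≤ b * g := by linarith
  have hg2 : 1.6 * x ^ 2 + 0.48 * x ^ 3 ≤ g ^ 2 := by
    have : x * (1.27 + 0.19 * x) ≤ g := by
      rw [hg]
      apply mul_le_mul_of_nonneg_left _ hx
      nlinarith [sq_nonneg x]
    have h2 := pow_le_pow_left₀ (by positivity) this 2
    nlinarith [pow_nonneg hx 3, pow_nonneg hx 4, pow_nonneg hx 2]
  have hd2 : 2.546 * g ^ 2 ≤ (b * g) ^ 2 := by
    have := pow_le_pow_left₀ (by positivity) hd 2
    nlinarith [sq_nonneg g]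
  have hE := mul_le_mul_of_nonneg_left (quadratic_le_exp_of_nonneg hd0) (exp_pos w).le
  have hE' := mul_le_mul_of_nonneg_right E1
    (show 0 ≤ 1 + b * g + (b * g) ^ 2 / 2 by positivity)
  have hY' := mul_le_mul_of_nonneg_right Y2 hd0
  have hg' : g = 1.270489978 * x + 0.1904859 * x ^ 2 + 0.044715 * x ^ 3 := by rw [hg]; ring
  linarith [pow_nonneg hx 3, pow_nonneg hx 2]

/-- The same expansion to the left of `1.42`. -/
theorem exp_combination_ge_of_nonpos {b w x g : ℝ}
    (b1 : 1.59576912 ≤ b) (b2 : b ≤ 1.59576913) (E1 : 11.826 ≤ exp w) (Y1 : 0.084558 ≤ exp (-w))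
    (hg : g = x * (1 + 0.134145 * 1.42 ^ 2 + 0.134145 * 1.42 * x + 0.044715 * x ^ 2))
    (hx' : -0.17 ≤ x) (hx : x ≤ 0) :
    1.59576913 * ((1.42 + x) + 0.134145 * (1.42 + x) ^ 3) ≤
      (1.129 - 1) * (exp w * exp (b * g)) + 1.129 * (exp (-w) * exp (-(b * g))) +
        (2 * 1.129 - 1) := by
  have hy := add_one_le_exp (-(b * g))
  have hY := mul_le_mul_of_nonneg_left hy (exp_pos (-w)).le
  set q := 1 + 0.134145 * 1.42 ^ 2 + 0.134145 * 1.42 * x + 0.044715 * x ^ 2 with hq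
  have q1 : 1.238 ≤ q := by rw [hq]; nlinarith [sq_nonneg x]
  have q2 : q ≤ 1.2705 := by rw [hq]; nlinarith
  have hg0 : g ≤ 0 := hg ▸ mul_nonpos_of_nonpos_of_nonneg hx (by linarith)
  have hg1 : -0.216 ≤ g := by rw [hg]; nlinarith
  have hd : 1.59576913 * g ≤ b * g := mul_le_mul_of_nonpos_right b2 hg0
  have hd0 : b * g ≤ 0 := mul_nonpos_of_nonneg_of_nonpos (by linarith) hg0
  have hd1 : -0.35 ≤ b * g := by linarith
  have hg2 : 1.53 * x ^ 2 ≤ g ^ 2 := by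
    rw [hg, mul_pow]
    nlinarith [sq_nonneg x, mul_nonneg (sq_nonneg x) (show 0 ≤ q ^ 2 - 1.53 by nlinarith)]
  have hg2' : g ^ 2 ≤ 1.615 * x ^ 2 := by
    rw [hg, mul_pow]
    nlinarith [sq_nonneg x, mul_nonneg (sq_nonneg x) (show 0 ≤ 1.615 - q ^ 2 by nlinarith)]
  have hd2 : 2.546 * g ^ 2 ≤ (b * g) ^ 2 := by
    rw [mul_pow]
    exact mul_le_mul_of_nonneg_right (by nlinarith) (sq_nonneg g)
  have hd2' : (b * g) ^ 2 ≤ 2.547 * g ^ 2 := by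
    rw [mul_pow]
    exact mul_le_mul_of_nonneg_right (by nlinarith) (sq_nonneg g)
  have hd3 : -0.35 * (b * g) ^ 2 ≤ (b * g) ^ 3 := by
    have := mul_le_mul_of_nonneg_right hd1 (sq_nonneg (b * g))
    linarith [show b * g * (b * g) ^ 2 = (b * g) ^ 3 by ring]
  have hE0 : 1 + b * g + (b * g) ^ 2 / 2 + 2 / 9 * (b * g) ^ 3 ≤ exp (b * g) := by
    have hb := exp_bound (x := b * g) (abs_le.2 ⟨by linarith, by linarith⟩)
      (n := 3) (by norm_num)
    rw [abs_of_nonpos hd0] at hb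
    have := (abs_le.1 hb).1
    simp only [Finset.sum_range_succ, Finset.sum_range_zero, Nat.factorial] at this
    norm_num at this
    linarith [show (-(b * g)) ^ 3 = -(b * g) ^ 3 by ring]
  have hE := mul_le_mul_of_nonneg_left hE0 (exp_pos w).le
  have hE' := mul_le_mul_of_nonneg_right E1
    (show 0 ≤ 1 + b * g + (b * g) ^ 2 / 2 + 2 / 9 * (b * g) ^ 3 by
      nlinarith [sq_nonneg (b * g)])
  have hY' := mul_le_mul_of_nonneg_right Y1 (neg_nonneg.2 hd0)
  have hg' : g = 1.270489978 * x + 0.1904859 * x ^ 2 + 0.044715 * x ^ 3 := by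
    rw [hg, hq]; ring
  have hx3 : x ^ 3 ≤ 0 := by
    have := mul_nonpos_of_nonpos_of_nonneg hx (sq_nonneg x)
    linarith [show x * x ^ 2 = x ^ 3 by ring]
  linarith [sq_nonneg (x + 0.0022)]

/-- Beyond `1.25` the bound comes from expanding both exponentials at `1.42`, close to the
maximum of the slope. -/
theorem geluSlope_le_of_five_fourths_le {t : ℝ} (h1 : 1.25 ≤ t) : geluSlope t ≤ 1.129 := by
  obtain ⟨b1, b2⟩ := two_mul_sqrt_bounds
  rw [geluSlope_le_iff]
  set b := 2 * √(2 / π)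
  obtain ⟨x, rfl⟩ : ∃ x, t = 1.42 + x := ⟨t - 1.42, by ring⟩
  have u1 := (exp_nat_add_bounds 2 (x := 0.470301) (by norm_num) (by norm_num)).1
  have u2 := (exp_nat_add_bounds 2 (x := 0.470302) (by norm_num) (by norm_num)).2
  simp only [Finset.sum_range_succ, Finset.sum_range_zero, Nat.factorial] at u1 u2
  norm_num at u1 u2
  set w₁ := b * (1.42 + 0.044715 * 1.42 ^ 3) with hw₁
  have E1 : 11.826 ≤ exp w₁ := by
    have : exp (2 + 0.470301) ≤ exp w₁ := exp_le_exp.2 (by rw [hw₁]; norm_num; linarith)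
    refine le_trans ?_ this
    refine le_trans ?_ (u1.trans_eq (by norm_num))
    norm_num
  have E2 : exp w₁ ≤ 11.8261 := by
    have : exp w₁ ≤ exp (2 + 0.470302) := exp_le_exp.2 (by rw [hw₁]; norm_num; linarith)
    refine this.trans ((le_of_eq (by norm_num)).trans (u2.trans ?_))
    norm_num
  have Y1 : 0.084558 ≤ exp (-w₁) := by
    rw [exp_neg]
    exact le_trans (by norm_num) (inv_anti₀ (exp_pos _) E2)
  have Y2 : exp (-w₁) ≤ 0.08456 := by
    rw [exp_neg]
    exact (inv_anti₀ (by norm_num) E1).trans (by norm_num)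
  set g := x * (1 + 0.134145 * 1.42 ^ 2 + 0.134145 * 1.42 * x + 0.044715 * x ^ 2) with hg
  have ew : b * ((1.42 + x) + 0.044715 * (1.42 + x) ^ 3) = w₁ + b * g := by
    rw [hw₁, hg]; ring
  rw [ew, neg_add, exp_add, exp_add]
  have hL : b * ((1.42 + x) + 0.134145 * (1.42 + x) ^ 3) ≤
      1.59576913 * ((1.42 + x) + 0.134145 * (1.42 + x) ^ 3) :=
    mul_le_mul_of_nonneg_right b2 (by
      have : 0 ≤ 1.42 + x := by linarith
      positivity)
  refine hL.trans ?_
  rcases le_total 0 x with hx | hx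
  · exact exp_combination_ge_of_nonneg b1 E1 Y1 Y2 hg hx
  · exact exp_combination_ge_of_nonpos b1 b2 E1 Y1 hg (by linarith) hx

theorem abs_deriv_gelu_le (t : ℝ) : |deriv gelu t| ≤ 1.129 := by
  have h : ∀ t, 0 ≤ t → geluSlope t ≤ 1.129 := fun t ht =>
    (le_total t 1.25).elim (geluSlope_le_of_le_five_fourths ht) geluSlope_le_of_five_fourths_le
  rw [(hasDerivAt_gelu t).deriv, abs_le]
  rcases le_total 0 t with ht | ht
  · exact ⟨by linarith [geluSlope_nonneg ht], h t ht⟩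
  · have h1 := h (-t) (by linarith)
    have h2 := geluSlope_nonneg (t := -t) (by linarith)
    rw [geluSlope_neg] at h1 h2
    constructor <;> linarith

theorem slopeSup_gelu_le : slopeSup gelu ≤ 1.083 := by
  refine csSup_le ((Set.nonempty_Icc.2 (by norm_num)).image _) ?_
  rintro _ ⟨t, ⟨h1, h2⟩, rfl⟩
  dsimp only
  rw [(hasDerivAt_gelu t).deriv, abs_le]
  rcases le_total 0 t with ht | ht
  · exact ⟨by linarith [geluSlope_nonneg ht], geluSlope_le_of_le_one ht h2⟩
  · have h3 := geluSlope_le_of_le_one (t := -t) (by linarith) (by linarith)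
    have h4 := geluSlope_nonneg (t := -t) (by linarith)
    rw [geluSlope_neg] at h3 h4
    constructor <;> linarith

theorem geomS_slopeSup_gelu_le (M : ℕ) : geomS M (slopeSup gelu) ≤ geomS M 1.083 := by
  have h0 : 0 ≤ slopeSup gelu :=
    sSup_nonneg fun _ ⟨_, _, h⟩ => h ▸ abs_nonneg _
  exact Finset.sum_le_sum fun j _ => pow_le_pow_left₀ h0 slopeSup_gelu_le j

theorem abs_gelu_sub_le (s t : ℝ) : |gelu s - gelu t| ≤ 1.129 * |s - t| := by
  simpa using Convex.norm_image_sub_le_of_norm_deriv_le (f := gelu) (s := Set.univ)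
    (x := t) (y := s) (C := 1.129) (fun x _ => (hasDerivAt_gelu x).differentiableAt)
    (fun x _ => abs_deriv_gelu_le x) convex_univ trivial trivial

end NetApprox

namespace NetApprox

open Real

/-! ### The lower bound for GELU networks with bounded parameters -/

/-- A layer of `m` nodes with weights at most `B` multiplies the `ℓ¹` distance of two outputs by at
most `1.129 B m ≤ e ^ (1.129 B m)`, whatever the width of the layer before it. -/
theorem sum_abs_eval_sub_le {d n : ℕ} {B : ℝ} (H : Layers Unit d n)
    (hH : H.ParamLE B) (x y : Fin d → ℝ) :
    ∑ i, |H.eval (fun _ => gelu) x i - H.eval (fun _ => gelu) y i| ≤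
      exp (1.129 * B * H.units) * ∑ i, |x i - y i| := by
  induction H with
  | input => simp [Layers.eval, Layers.units]
  | @layer n prev m W b act ih =>
    obtain ⟨h1, h2, -⟩ := hH
    specialize ih h1
    set S := ∑ i, |prev.eval (fun _ => gelu) x i - prev.eval (fun _ => gelu) y i|
    have hnode : ∀ i, |(Layers.layer prev m W b act).eval (fun _ => gelu) x i -
        (Layers.layer prev m W b act).eval (fun _ => gelu) y i| ≤ 1.129 * (B * S) := by
      intro i
      refine (abs_gelu_sub_le _ _).trans (mul_le_mul_of_nonneg_left ?_ (by norm_num))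
      rw [add_sub_add_right_eq_sub, ← Finset.sum_sub_distrib, Finset.mul_sum]
      refine (Finset.abs_sum_le_sum_abs _ _).trans (Finset.sum_le_sum fun j _ => ?_)
      rw [← mul_sub, abs_mul]
      exact mul_le_mul_of_nonneg_right (h2 i j) (abs_nonneg _)
    have hS : 0 ≤ S := Finset.sum_nonneg fun _ _ => abs_nonneg _
    calc _ ≤ ∑ _i : Fin m, 1.129 * (B * S) := Finset.sum_le_sum fun i _ => hnode i
      _ = (1.129 * B * m) * S := by simp; ring
      _ ≤ exp (1.129 * B * m) * S :=
        mul_le_mul_of_nonneg_right (by linarith [add_one_le_exp (1.129 * B * m)]) hS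
      _ ≤ exp (1.129 * B * m) * (exp (1.129 * B * prev.units) * ∑ i, |x i - y i|) :=
        mul_le_mul_of_nonneg_left ih (exp_pos _).le
      _ = _ := by
        rw [← mul_assoc, ← exp_add, Layers.units]
        push_cast
        ring_nf

theorem abs_fn_gelu_sub_le {d : ℕ} {B : ℝ} (hB : 0 ≤ B) (F : FixedNet d) (hF : F.ParamLE B)
    (x y : Fin d → ℝ) :
    |FixedNet.fn gelu F x - FixedNet.fn gelu F y| ≤
      B * (exp (1.129 * B * F.units) * ∑ i, |x i - y i|) := by
  refine le_trans ?_ (mul_le_mul_of_nonneg_left (sum_abs_eval_sub_le F.hidden hF.1 x y) hB)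
  rw [FixedNet.fn, Net.eval, Net.eval, add_sub_add_right_eq_sub, ← Finset.sum_sub_distrib,
    Finset.mul_sum]
  refine (Finset.abs_sum_le_sum_abs _ _).trans (Finset.sum_le_sum fun j _ => ?_)
  rw [← mul_sub, abs_mul]
  exact mul_le_mul_of_nonneg_right (hF.2.1 j) (abs_nonneg _)

open Polynomial in
/-- The rational function `2 η t / (η² + t²)`, which climbs from `-1` to `1` between `-η`
and `η`. -/
noncomputable def steepAct (η : ℝ) : RatAct := ⟨C (2 * η) * X, C (η ^ 2) + X ^ 2⟩

theorem steepAct_eval (η t : ℝ) : (steepAct η).eval t = 2 * η * t / (η ^ 2 + t ^ 2) := by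
  simp [steepAct, RatAct.eval]

theorem steepAct_spec {η : ℝ} (hη : 0 < η) : (steepAct η).SelfMap ∧ (steepAct η).DegreeLE 2 := by
  refine ⟨fun t _ => ?_, ?_, ?_⟩
  · have h : 0 < η ^ 2 + t ^ 2 := by positivity
    refine ⟨by simpa [steepAct] using h.ne', ?_⟩
    rw [steepAct_eval, Set.mem_Icc, le_div_iff₀ h, div_le_one h]
    constructor <;> nlinarith [sq_nonneg (η - t), sq_nonneg (η + t)]
  · exact (Polynomial.natDegree_C_mul_le _ _).trans (by simp)
  · refine (Polynomial.natDegree_add_le _ _).trans ?_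
    simp

open Polynomial in
/-- The activation `t ↦ t`. -/
noncomputable def idAct : RatAct := ⟨X, 1⟩

theorem idAct_eval (t : ℝ) : idAct.eval t = t := by simp [idAct, RatAct.eval]

theorem idAct_spec : idAct.SelfMap ∧ idAct.DegreeLE 2 :=
  ⟨fun t ht => ⟨by simp [idAct], by rwa [idAct_eval]⟩, by simp [idAct], by simp [idAct]⟩

/-- One node per layer: `steepAct η` applied to the input coordinate `i₀`, then `M` copies. -/
noncomputable def steepLayers {d : ℕ} (i₀ : Fin d) (η : ℝ) : ℕ → Layers RatAct d 1
  | 0 => .layer .input 1 (fun _ j => if j = i₀ then 1 else 0) 0 fun _ => steepAct η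
  | M + 1 => .layer (steepLayers i₀ η M) 1 (fun _ _ => 1) 0 fun _ => idAct

theorem steepLayers_spec {d : ℕ} (i₀ : Fin d) {η : ℝ} (hη : 0 < η) (M : ℕ) :
    (steepLayers i₀ η M).depth = M + 1 ∧ (steepLayers i₀ η M).WidthLE 1 ∧
      (steepLayers i₀ η M).Normalized ∧
      (steepLayers i₀ η M).ForallAct (fun r => r.SelfMap ∧ r.DegreeLE 2) ∧
      ∀ x i, (steepLayers i₀ η M).eval RatAct.eval x i = (steepAct η).eval (x i₀) := by
  induction M with
  | zero =>
    refine ⟨rfl, ⟨trivial, le_rfl⟩, ⟨trivial, fun i => ?_⟩,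
      ⟨trivial, fun _ => steepAct_spec hη⟩, fun x i => ?_⟩
    · simp [apply_ite]
    · simp [steepLayers, Layers.eval]
  | succ M ih =>
    obtain ⟨h1, h2, h3, h4, h5⟩ := ih
    refine ⟨congrArg (· + 1) h1, ⟨h2, le_rfl⟩, ⟨h3, fun i => by simp⟩,
      ⟨h4, fun _ => idAct_spec⟩, fun x i => ?_⟩
    simp [steepLayers, Layers.eval, h5, idAct_eval]

theorem widthLE_mono {A : Type} {d n k l : ℕ} (hkl : k ≤ l) (H : Layers A d n)
    (h : H.WidthLE k) : H.WidthLE l := by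
  induction H with
  | input => trivial
  | layer prev m W b act ih => exact ⟨ih h.1, h.2.trans hkl⟩

/-- A GELU network with few nodes cannot follow the jump of a steep rational node. -/
theorem gelu_net_units_lower_bound {B : ℝ} (hB : 0 < B) :
    ∃ c : ℝ, 0 < c ∧
      ∀ (d k M : ℕ) (ε : ℝ), 1 ≤ d → 1 ≤ k → 1 ≤ M → 0 < ε → ε < 1 / 8 →
      ∃ R : RatNet d, R.depth = M ∧ R.WidthLE k ∧ R.Normalized ∧
        R.ForallAct (fun r => r.SelfMap ∧ r.DegreeLE 2) ∧
        ∀ F : FixedNet d, F.ParamLE B →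
          (∀ x ∈ cube d, |RatNet.fn R x - FixedNet.fn gelu F x| ≤ ε) →
          c * (k * M * Real.log (1 / ε)) ≤ (F.units : ℝ) := by
  refine ⟨1 / (1.129 * B), by positivity, fun d k M ε hd hk hM hε hε8 => ?_⟩
  -- the jump is so steep that `2 B η ≤ ε ^ (k M)`
  set η := ε ^ (k * M) * min 1 (1 / (2 * B)) with hη
  have hεpow : 0 < ε ^ (k * M) := by positivity
  have hmin : 0 < min 1 (1 / (2 * B)) := lt_min one_pos (by positivity)
  have hη0 : 0 < η := mul_pos hεpow hmin
  have hη1 : η ≤ 1 :=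
    mul_le_one₀ (pow_le_one₀ hε.le (by linarith)) hmin.le (min_le_left _ _)
  have hηB : B * (2 * η) ≤ ε ^ (k * M) := by
    have h := mul_le_mul_of_nonneg_left (min_le_right 1 (1 / (2 * B))) hεpow.le
    rw [← hη, mul_one_div, le_div_iff₀ (by positivity)] at h
    linarith
  obtain ⟨M, rfl⟩ := Nat.exists_eq_add_of_le' hM
  have i₀ : Fin d := ⟨0, hd⟩
  obtain ⟨h1, h2, h3, h4, h5⟩ := steepLayers_spec i₀ hη0 M
  refine ⟨⟨steepLayers i₀ η M, 1, 0⟩, h1, widthLE_mono hk _ h2, ⟨h3, by simp⟩, h4,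
    fun F hF happ => ?_⟩
  set x : ℝ → Fin d → ℝ := fun s => Pi.single i₀ s with hx
  have hcube : ∀ s ∈ Set.Icc (-1 : ℝ) 1, x s ∈ cube d := by
    intro s hs i
    by_cases h : i = i₀
    · subst h; simpa [hx] using hs
    · simp [hx, h]
  have hR : ∀ s, RatNet.fn ⟨steepLayers i₀ η M, 1, 0⟩ (x s) = 2 * η * s / (η ^ 2 + s ^ 2) := by
    intro s
    simp [RatNet.fn, Net.eval, h5, steepAct_eval, hx]
  have e1 : 2 * η * η / (η ^ 2 + η ^ 2) = 1 := by field_simp; norm_num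
  have e2 : 2 * η * -η / (η ^ 2 + (-η) ^ 2) = -1 := by field_simp; norm_num
  have a1 := happ (x η) (hcube _ ⟨by linarith, hη1⟩)
  have a2 := happ (x (-η)) (hcube _ ⟨by linarith, by linarith⟩)
  rw [hR, e1] at a1
  rw [hR, e2] at a2
  have hsum : ∑ i, |x η i - x (-η) i| = 2 * η := by
    rw [Finset.sum_eq_single i₀ (fun i _ h => by simp [hx, h]) (by simp)]
    simp only [hx, Pi.single_eq_same]
    rw [abs_of_nonneg (by linarith)]
    ring
  have hF' := abs_fn_gelu_sub_le hB.le F hF (x η) (x (-η))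
  rw [hsum] at hF'
  have hE := exp_pos (1.129 * B * F.units)
  have hlow : 1 ≤ exp (1.129 * B * F.units) * ε ^ (k * (M + 1)) := by
    have := mul_le_mul_of_nonneg_left hηB hE.le
    have b1 := abs_le.1 a1
    have b2 := abs_le.1 a2
    have b3 := le_abs_self (FixedNet.fn gelu F (x η) - FixedNet.fn gelu F (x (-η)))
    linarith [b1.2, b2.1]
  have hlog := log_nonneg hlow
  rw [log_mul hE.ne' hεpow.ne', log_exp, log_pow] at hlog
  rw [one_div ε, log_inv, one_div, inv_mul_le_iff₀ (by positivity)]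
  push_cast at hlog ⊢
  linarith

end NetApprox

theorem theorem4 :
    -- (1) GELU / SiLU / Swish networks by rational networks
    (∀ σ : ℝ → ℝ, (σ = gelu ∨ σ = silu ∨ ∃ β : ℝ, σ = swish β) →
      ∃ (D : ℕ) (C : ℝ), 0 < C ∧
        ∀ (d k M : ℕ) (ε : ℝ), 1 ≤ k → 1 ≤ M → 0 < ε → ε < 1 →
        ∀ f : FixedNet d, f.depth = M → f.WidthLE k → f.Normalized →
        ∃ R : RatNet d, R.NoPoles ∧ R.ForallAct (RatAct.DegreeLE D) ∧
          ApproxOnCube (FixedNet.fn σ f) (RatNet.fn R) ε ∧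
          (R.units : ℝ) ≤
            C * (k * M * (max 1 (Real.log (Real.log (geomS M (slopeSup σ) / ε)))) ^ 3) ∧
          (RatNet.numParams R : ℝ) ≤
            C * (d + k) *
              (k * M * (max 1 (Real.log (Real.log (geomS M (slopeSup σ) / ε)))) ^ 3)) ∧
    -- the numerical bounds for the slope of GELU
    (slopeSup gelu ≤ 1.083 ∧ (∀ t : ℝ, |deriv gelu t| ≤ 1.129) ∧
      ∀ M : ℕ, geomS M (slopeSup gelu) ≤ geomS M 1.083) ∧
    -- (2) rational networks by GELU networks
    (∀ ρ K : ℝ, 1 < ρ →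
      ∃ C : ℝ, 0 < C ∧
        ∀ (d k M : ℕ) (L ε : ℝ), 1 ≤ k → 1 ≤ M → 0 < ε → ε < 1 → 0 ≤ L →
        ∀ R : RatNet d, R.depth = M → R.WidthLE k → R.Normalized →
          R.ForallAct (fun r => r.SelfMap ∧ r.BernsteinBound ρ K ∧
            ∀ s ∈ Set.Icc (-1 : ℝ) 1, ∀ t ∈ Set.Icc (-1 : ℝ) 1,
              |r.eval s - r.eval t| ≤ L * |s - t|) →
        ∃ f : FixedNet d,
          ApproxOnCube (RatNet.fn R) (FixedNet.fn gelu f) ε ∧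
          (f.units : ℝ) ≤ C * (k * M * (max 1 (Real.log (geomS M L / ε))) ^ 2) ∧
          (FixedNet.numParams f : ℝ) ≤
            C * (d + k) * (k * M * (max 1 (Real.log (geomS M L / ε))) ^ 2)) ∧
    -- (3) the worst-case lower bound for GELU networks with bounded parameters
    (∀ B : ℝ, 0 < B →
      ∃ c : ℝ, 0 < c ∧
        ∀ (d k M : ℕ) (ε : ℝ), 1 ≤ d → 1 ≤ k → 1 ≤ M → 0 < ε → ε < 1 / 8 →
        ∃ R : RatNet d, R.depth = M ∧ R.WidthLE k ∧ R.Normalized ∧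
          R.ForallAct (fun r => r.SelfMap ∧ r.DegreeLE 2) ∧
          ∀ F : FixedNet d, F.ParamLE B →
            (∀ x ∈ cube d, |RatNet.fn R x - FixedNet.fn gelu F x| ≤ ε) →
            c * (k * M * Real.log (1 / ε)) ≤ (F.units : ℝ)) :=
  ⟨fun _ hσ => NetApprox.sigmoid_net_by_rational_net hσ,
    ⟨NetApprox.slopeSup_gelu_le, NetApprox.abs_deriv_gelu_le, NetApprox.geomS_slopeSup_gelu_le⟩,
    fun _ K hρ => NetApprox.rational_net_by_gelu_net K hρ,
    fun _ hB => NetApprox.gelu_net_units_lower_bound hB⟩
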